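/- Let $E$ be a finite or countable set and let $\ell^2(E)$ be the real or complex Hilbert space with standard orthonormal basis $E$ and inner product $\langle\cdot,\cdot\rangle$, linear in the first variable. A *positive contraction* is a self-adjoint operator $Q$ on $\ell^2(E)$ with $0\le\langle Qu,u\rangle\le\langle u,u\rangle$ for all $u$. Write $2^E$ for the set of subsets of $E$ and, for $K\subseteq E$, let $\mathcal F(K)$ be the $\sigma$-field on $2^E$ generated by the events $\{S: e\in S\}$, $e\in K$; all measures are on $\mathcal F(E)$. An event $\mathcal A\subseteq 2^E$ is *increasing* if $S\in\mathcal A$ and $S\subseteq T$ imply $T\in\mathcal A$. For finite $A\subseteq E$ fix an ordering $e_1,\dots,e_k$ of $A$ and put $\bigwedge_{e\in A}f(e):=f(e_1)\wedge\cdots\wedge f(e_k)$ and $\theta_A:=\bigwedge_{e\in A}e$ (with $\theta_\emptyset:=1$); the inner product on the exterior algebra of $\ell^2(E)$ is the one for which the $\theta_A$ ($A\subseteq E$ finite) form an orthonormal basis. For every positive contraction $Q$ there is exactly one probability measure $\mathbf P^Q$ on $2^E$, the law of a random subset $S$ of $E$, such that $\mathbf P^Q[A\subseteq S]=\det\big(\langle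 Qf,e\rangle\big)_{e,f\in A}$ for all finite $A\subseteq E$. It has the following properties. 1. For all finite $A,B\subseteq E$, $$\mathbf P^Q[A\subseteq S,\ B\cap S=\emptyset]=\Big\langle \bigwedge_{e\in A}Qe\wedge\bigwedge_{e\in B}(I-Q)e,\ \theta_A\wedge\theta_B\Big\rangle .$$ 2. $\mathbf P^Q$ has conditional negative associations with external fields: let $F\subseteq E$ be finite, let $w:E\to(0,\infty)$, and let $\mathbf P$ be the probability measure whose density with respect to $\mathbf P^Q$ is proportional to $\prod_{e\in S\cap F}w(e)$. If $A,B\subseteq E$ satisfy $\mathbf P[A\subseteq S,\ B\cap S=\emptyset]>0$, then $\mathbf P':=\mathbf P(\,\cdot\mid A\subseteq S,\ B\cap S=\emptyset)$ satisfies $\mathbf P'(\mathcal A_1\cap\mathcal A_2)\le\mathbf P'(\mathcal A_1)\,\mathbf P'(\mathcal A_2)$ for every $K\subseteq E$ and all increasing events $\mathcal A_1\in\mathcal F(K)$ and $\mathcal A_2\in\mathcal F(E\setminus K)$. (The case $F=\emptyset$ is conditional negative association of $\mathbf P^Q$ itself.) 3. $\mathbf P^Q$ has a trivial tail $\sigma$-field: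 every event in $\bigcap_{K\subseteq E\text{ finite}}\mathcal F(E\setminus K)$ has probability $0$ or $1$. 4. If $A\subseteq E$ is finite and $\mu:=\mathbf E^Q\big[|S\cap A|\big]$, then for every $a>0$, $$\mathbf P^Q\Big[\big||S\cap A|-\mu\big|\ge a\Big]\le 2e^{-2a^2/|A|}$$ (for $A=\emptyset$ the left side is $0$). 5. If $Q_1,Q_2$ are commuting positive contractions on $\ell^2(E)$ with $\langle Q_1u,u\rangle\le\langle Q_2u,u\rangle$ for all $u$, then $\mathbf P^{Q_1}$ is stochastically dominated by $\mathbf P^{Q_2}$, that is, $\mathbf P^{Q_1}(\mathcal A)\le\mathbf P^{Q_2}(\mathcal A)$ for every increasing event $\mathcal A\in\mathcal F(E)$. -/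

import Mathlib

open MeasureTheory
open scoped NNReal ENNReal

noncomputable section

namespace Determinantal

/-- The Hilbert space `ℓ²(E)` over `𝕜` (which will be `ℝ` or `ℂ`). -/
abbrev L2 (𝕜 : Type*) [RCLike 𝕜] (E : Type*) : Type _ := lp (fun _ : E => 𝕜) 2

section Operators

variable {𝕜 : Type*} [RCLike 𝕜] {E : Type*}

open Classical in
/-- The element `e` of `E`, regarded as a member of the standard orthonormal basis of `ℓ²(E)`. -/
def basisVec (e : E) : L2 𝕜 E := lp.single 2 e (1 : 𝕜)

/-- `Q` is self-adjoint and `0 ≤ (Qu, u) ≤ (u, u)` for all `u`. -/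
structure IsPositiveContraction (Q : L2 𝕜 E →L[𝕜] L2 𝕜 E) : Prop where
  isSelfAdjoint : IsSelfAdjoint Q
  nonneg : ∀ u, 0 ≤ RCLike.re (inner 𝕜 (Q u) u)
  le_one : ∀ u, RCLike.re (inner 𝕜 (Q u) u) ≤ RCLike.re (inner 𝕜 u u)

/-- The `(e, f)` entry of the matrix of `Q` in the standard basis. -/
def entry (Q : L2 𝕜 E →L[𝕜] L2 𝕜 E) (e f : E) : 𝕜 := inner 𝕜 (basisVec e) (Q (basisVec f))

/-- The minor `det (Q ↾ A)`. -/
def minor (Q : L2 𝕜 E →L[𝕜] L2 𝕜 E) (A : Finset E) : 𝕜 :=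
  open Classical in Matrix.det (Matrix.of fun e f : A => entry Q e f)

/-- `P` is the determinantal probability measure of `Q`: it is the law of a random subset `S` of
`E` with `P[A ⊆ S] = det (Q ↾ A)` for all finite `A`. The σ-field on `Set E` is the product one. -/
structure IsDeterminantal (Q : L2 𝕜 E →L[𝕜] L2 𝕜 E) (P : Measure (Set E)) : Prop where
  isProbabilityMeasure : IsProbabilityMeasure P
  prob_subset : ∀ A : Finset E, ((P.real {S : Set E | (A : Set E) ⊆ S} : ℝ) : 𝕜) = minor Q A

end Operators

section Exterior

variable {𝕜 : Type*} [RCLike 𝕜] {E : Type*}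

/-- A fixed ordering of each finite subset of `E`. -/
def enum (A : Finset E) (i : Fin A.card) : E := (A.equivFin.symm i : E)

/-- `⋀_{e ∈ A} f(e)`, the factors being taken in the order `enum A`. -/
def wedge (A : Finset E) (f : E → L2 𝕜 E) : ExteriorAlgebra 𝕜 (L2 𝕜 E) :=
  ExteriorAlgebra.ιMulti 𝕜 A.card fun i => f (enum A i)

/-- `θ_A = ⋀_{e ∈ A} e`. -/
def theta (𝕜 : Type*) [RCLike 𝕜] (A : Finset E) : ExteriorAlgebra 𝕜 (L2 𝕜 E) :=
  wedge A fun e => basisVec e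

/-- The coordinates of a vector at the elements of `A`, in the order `enum A`. -/
def coords (𝕜 : Type*) [RCLike 𝕜] (A : Finset E) : L2 𝕜 E →ₗ[𝕜] (Fin A.card → 𝕜) where
  toFun u i := u (enum A i)
  map_add' _ _ := rfl
  map_smul' _ _ := rfl

/-- The coefficient of `θ_A` in a multivector. On `k`-vectors with `k = |A|` it is given by
`u₁ ∧ ⋯ ∧ u_k ↦ det [u_i(e_j)]`, where `A = {e₁, …, e_k}`, and it vanishes in all other ranks. -/
def coeff (A : Finset E) : ExteriorAlgebra 𝕜 (L2 𝕜 E) →ₗ[𝕜] 𝕜 :=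
  ExteriorAlgebra.liftAlternating
    (Pi.single A.card (Matrix.detRowAlternating.compLinearMap (coords 𝕜 A)))

/-- The inner product on the exterior algebra of `ℓ²(E)` for which the `θ_A`, with `A` ranging over
the finite subsets of `E`, are orthonormal; it is linear in the first argument. -/
def extInner (x y : ExteriorAlgebra 𝕜 (L2 𝕜 E)) : 𝕜 :=
  ∑' A : Finset E, coeff A x * starRingEnd 𝕜 (coeff A y)

end Exterior

section Measures

variable {E : Type*}

/-- `ℱ(K)`: the σ-field generated by the events `{e ∈ S}` with `e ∈ K`. -/
@[reducible] def sigmaField (K : Set E) : MeasurableSpace (Set E) :=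
  MeasurableSpace.generateFrom {𝒜 | ∃ e ∈ K, 𝒜 = {S : Set E | e ∈ S}}

/-- The tail σ-field: the intersection of `ℱ(E \ K)` over all finite `K`. -/
@[reducible] def tailSigmaField (E : Type*) : MeasurableSpace (Set E) :=
  ⨅ K : Finset E, sigmaField (K : Set E)ᶜ

/-- Every tail event has measure `0` or `1`. -/
def HasTrivialTail (P : Measure (Set E)) : Prop :=
  ∀ 𝒜 : Set (Set E), MeasurableSet[tailSigmaField E] 𝒜 → P 𝒜 = 0 ∨ P 𝒜 = 1

/-- Increasing events that are measurable with respect to complementary subsets of `E` are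
negatively correlated. -/
def HasNegAssoc (P : Measure (Set E)) : Prop :=
  ∀ (K : Set E) (𝒜₁ 𝒜₂ : Set (Set E)), IsUpperSet 𝒜₁ → IsUpperSet 𝒜₂ →
    MeasurableSet[sigmaField K] 𝒜₁ → MeasurableSet[sigmaField Kᶜ] 𝒜₂ →
      P (𝒜₁ ∩ 𝒜₂) ≤ P 𝒜₁ * P 𝒜₂

/-- The event `{A ⊆ S, B ∩ S = ∅}`. -/
def inOut (A B : Set E) : Set (Set E) := {S | A ⊆ S ∧ B ∩ S = ∅}

/-- Negative associations hold after conditioning on any event `{A ⊆ S, B ∩ S = ∅}` of positive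
probability. -/
def HasCondNegAssoc (P : Measure (Set E)) : Prop :=
  ∀ A B : Set E, P (inOut A B) ≠ 0 → HasNegAssoc (ProbabilityTheory.cond P (inOut A B))

open Classical in
/-- The weight `∏_{e ∈ S ∩ F} w(e)` of `S`. -/
def fieldWeight (F : Finset E) (w : E → ℝ≥0) (S : Set E) : ℝ≥0∞ :=
  ∏ e ∈ F, if e ∈ S then (w e : ℝ≥0∞) else 1

/-- The measure `P` with the external field `w` imposed on the elements of `F`: the probability
measure whose density with respect to `P` is proportional to `∏_{e ∈ S ∩ F} w(e)`. -/
def externalField (P : Measure (Set E)) (F : Finset E) (w : E → ℝ≥0) : Measure (Set E) :=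
  (∫⁻ S, fieldWeight F w S ∂P)⁻¹ • P.withDensity (fieldWeight F w)

/-- Conditional negative associations with external fields. (The measure `P` itself is the case
`F = ∅`.) -/
def HasCondNegAssocExternalFields (P : Measure (Set E)) : Prop :=
  ∀ (F : Finset E) (w : E → ℝ≥0), (∀ e, 0 < w e) → HasCondNegAssoc (externalField P F w)

/-- `P₁ ≼ P₂`: every increasing event is at least as likely under `P₂` as under `P₁`. -/
def StochDominatedBy (P₁ P₂ : Measure (Set E)) : Prop :=
  ∀ 𝒜 : Set (Set E), MeasurableSet 𝒜 → IsUpperSet 𝒜 → P₁ 𝒜 ≤ P₂ 𝒜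

/-- The number `|S ∩ A|`. -/
def count (A : Finset E) (S : Set E) : ℝ := ((S ∩ (A : Set E)).ncard : ℝ)

end Measures

end Determinantal

end

/-! Everything is reduced to finite index sets, where the law is explicit: the weight `pw Q S` of a
set S is the determinant whose rows come from Q on S and from 1 - Q off S. The trace of the measure
on a finite C has these weights for the compression of Q to C (`IsDeterminantal.real_tr_eq`).
Multilinearity of the determinant gives the probabilities of all events "A in, B out", hence the
exterior formula; compactness of the space of probability measures on `E → Bool` gives existence.

The core is negative association. By the Feder–Mihail argument (`IsBalanced.negAssoc`), it holds for
weights on sets of constant size whose pairwise correlations are nonpositive under every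
conditioning. For determinantal weights the correlations are minus squared moduli of entries of a
Hermitian matrix (`det_condMatrix_negCorr`); external fields are absorbed into the kernel by a
diagonal congruence. Constant size holds for projections, since the variance of |S| is tr Q - tr Q².
A general positive contraction is a corner of a projection on a doubled index set
(`IsContr.exists_dilation`), and negative association is inherited by marginals (`negAssoc_pw`).
Infinite E is reached by approximating increasing events from inside by increasing cylinder events
(`exists_approx_upperSet`).

The remaining properties are consequences. For domination, the difference of the kernels is a sum of
rank-one terms vv*; a kernel with one extra point has conditional kernels Q and Q + vv* according to
that point's status, and negative association with the extra point compares the two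
(`wsum_pw_le_add_vecMulVec`). For the tail, applying negative association to |S ∩ K| ± f bounds
covariances of functions of disjoint coordinate sets by sums of |Q(e,x)|², which are tails of
convergent series because Qe is in ℓ². For concentration, negative association bounds the moment
generating function of |S ∩ A| by that of independent indicators, and Hoeffding's lemma applies. -/

set_option linter.unusedSectionVars false

noncomputable section

namespace Determinantal

/-! ### The Feder–Mihail theorem: from pairwise negative correlation to negative association. -/

section FederMihail

variable {α : Type*} [Fintype α] [DecidableEq α]

/-- The sum of `f` with weights `μ`. -/
def wsum (μ f : Finset α → ℝ) : ℝ := ∑ S, μ S * f S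

/-- The weights `μ` restricted to the sets containing `e`. -/
def keepIn (e : α) (μ : Finset α → ℝ) (S : Finset α) : ℝ := if e ∈ S then μ S else 0

/-- The weights `μ` restricted to the sets not containing `e`. -/
def keepOut (e : α) (μ : Finset α → ℝ) (S : Finset α) : ℝ := if e ∈ S then 0 else μ S

/-- The total weight of the sets containing `A` and disjoint from `B`. -/
def mass (μ : Finset α → ℝ) (A B : Finset α) : ℝ := ∑ S with A ⊆ S ∧ Disjoint B S, μ S

/-- Pairs of elements are negatively correlated, also after fixing the status of some elements. -/
def HereditaryNegCorr (μ : Finset α → ℝ) : Prop :=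
  ∀ A B e f, e ≠ f →
    mass μ (insert e (insert f A)) B * mass μ A B ≤ mass μ (insert e A) B * mass μ (insert f A) B

/-- Nonnegative weights carried by sets of constant size and with hereditary negative
correlations. -/
structure IsBalanced (μ : Finset α → ℝ) : Prop where
  nonneg : ∀ S, 0 ≤ μ S
  homog : ∃ r : ℝ, ∀ S, μ S ≠ 0 → (S.card : ℝ) = r
  negCorr : HereditaryNegCorr μ

/-- The elements that belong to some but not all of the sets in the support of `μ`. -/
def undet (μ : Finset α → ℝ) : Finset α :=
  open Classical in
  Finset.univ.filter fun e => (∃ S, μ S ≠ 0 ∧ e ∈ S) ∧ ∃ S, μ S ≠ 0 ∧ e ∉ S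

/-- The covariance, up to normalization, of `f` and the indicator of `e ∈ S`. -/
def wcov (μ f : Finset α → ℝ) (e : α) : ℝ :=
  wsum (keepIn e μ) f * wsum μ 1 - wsum μ f * wsum (keepIn e μ) 1

/-- `f S` depends on `S ∩ K` only. -/
def DepOn {β : Type*} (K : Finset α) (f : Finset α → β) : Prop :=
  ∀ S T, S ∩ K = T ∩ K → f S = f T

lemma mem_undet {μ : Finset α → ℝ} {e : α} :
    e ∈ undet μ ↔ (∃ S, μ S ≠ 0 ∧ e ∈ S) ∧ ∃ S, μ S ≠ 0 ∧ e ∉ S := by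
  simp [undet]

lemma wsum_split (μ f : Finset α → ℝ) (e : α) :
    wsum μ f = wsum (keepIn e μ) f + wsum (keepOut e μ) f := by
  simp only [wsum, ← Finset.sum_add_distrib]
  refine Finset.sum_congr rfl fun S _ => ?_
  by_cases h : e ∈ S <;> simp [keepIn, keepOut, h]

lemma mass_keepIn (μ : Finset α → ℝ) (e : α) (A B : Finset α) :
    mass (keepIn e μ) A B = mass μ (insert e A) B := by
  simp only [mass, keepIn, Finset.sum_filter]
  refine Finset.sum_congr rfl fun S _ => ?_
  by_cases h : e ∈ S <;> simp [h, Finset.insert_subset_iff]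

lemma mass_keepOut (μ : Finset α → ℝ) (e : α) (A B : Finset α) :
    mass (keepOut e μ) A B = mass μ A (insert e B) := by
  simp only [mass, keepOut, Finset.sum_filter]
  refine Finset.sum_congr rfl fun S _ => ?_
  by_cases h : e ∈ S <;> simp [h]

lemma mass_eq_wsum (μ : Finset α → ℝ) : mass μ ∅ ∅ = wsum μ 1 := by
  simp [mass, wsum]

lemma IsBalanced.keepIn {μ : Finset α → ℝ} (h : IsBalanced μ) (e : α) :
    IsBalanced (keepIn e μ) where
  nonneg S := by
    unfold Determinantal.keepIn
    split_ifs
    exacts [h.nonneg S, le_rfl]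
  homog := by
    obtain ⟨r, hr⟩ := h.homog
    refine ⟨r, fun S hS => hr S fun h0 => hS ?_⟩
    simp [Determinantal.keepIn, h0]
  negCorr A B x y hxy := by
    simp only [mass_keepIn]
    have := h.negCorr (insert e A) B x y hxy
    simpa only [Finset.insert_comm e] using this

lemma IsBalanced.keepOut {μ : Finset α → ℝ} (h : IsBalanced μ) (e : α) :
    IsBalanced (keepOut e μ) where
  nonneg S := by
    unfold Determinantal.keepOut
    split_ifs
    exacts [le_rfl, h.nonneg S]
  homog := by
    obtain ⟨r, hr⟩ := h.homog
    refine ⟨r, fun S hS => hr S fun h0 => hS ?_⟩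
    simp [Determinantal.keepOut, h0]
  negCorr A B x y hxy := by
    simp only [mass_keepOut]
    exact h.negCorr A (insert e B) x y hxy

lemma keepIn_ne_zero {μ : Finset α → ℝ} {e : α} {S : Finset α} :
    keepIn e μ S ≠ 0 ↔ μ S ≠ 0 ∧ e ∈ S := by
  by_cases h : e ∈ S <;> simp [keepIn, h]

lemma keepOut_ne_zero {μ : Finset α → ℝ} {e : α} {S : Finset α} :
    keepOut e μ S ≠ 0 ↔ μ S ≠ 0 ∧ e ∉ S := by
  by_cases h : e ∈ S <;> simp [keepOut, h]

lemma undet_keepIn_subset (μ : Finset α → ℝ) (e : α) : undet (keepIn e μ) ⊆ undet μ := by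
  intro x
  simp only [mem_undet, keepIn_ne_zero]
  rintro ⟨⟨S, hS, hx⟩, T, hT, hx'⟩
  exact ⟨⟨S, hS.1, hx⟩, T, hT.1, hx'⟩

lemma undet_keepIn_card_lt {μ : Finset α → ℝ} {e : α} (he : e ∈ undet μ) :
    (undet (keepIn e μ)).card < (undet μ).card := by
  refine Finset.card_lt_card ⟨undet_keepIn_subset μ e, fun h => ?_⟩
  obtain ⟨-, T, hT, hx'⟩ := mem_undet.1 (h he)
  exact hx' (keepIn_ne_zero.1 hT).2

lemma undet_keepOut_card_lt {μ : Finset α → ℝ} {e : α} (he : e ∈ undet μ) :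
    (undet (keepOut e μ)).card < (undet μ).card := by
  refine Finset.card_lt_card ⟨fun x => ?_, fun h => ?_⟩
  · simp only [mem_undet, keepOut_ne_zero]
    rintro ⟨⟨S, hS, hx⟩, T, hT, hx'⟩
    exact ⟨⟨S, hS.1, hx⟩, T, hT.1, hx'⟩
  · obtain ⟨⟨T, hT, hx'⟩, -⟩ := mem_undet.1 (h he)
    exact (keepOut_ne_zero.1 hT).2 hx'

lemma wsum_one_pos {μ : Finset α → ℝ} (h : ∀ S, 0 ≤ μ S) {S : Finset α} (hS : μ S ≠ 0) :
    0 < wsum μ 1 := by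
  simp only [wsum, Pi.one_apply, mul_one]
  exact Finset.sum_pos' (fun T _ => h T) ⟨S, Finset.mem_univ _, lt_of_le_of_ne (h S) hS.symm⟩

lemma wsum_keepIn_pos {μ : Finset α → ℝ} (h : IsBalanced μ) {e : α} (he : e ∈ undet μ) :
    0 < wsum (keepIn e μ) 1 := by
  obtain ⟨⟨S, hS, hx⟩, -⟩ := mem_undet.1 he
  exact wsum_one_pos (h.keepIn e).nonneg (keepIn_ne_zero.2 ⟨hS, hx⟩)

lemma wsum_keepOut_pos {μ : Finset α → ℝ} (h : IsBalanced μ) {e : α} (he : e ∈ undet μ) :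
    0 < wsum (keepOut e μ) 1 := by
  obtain ⟨-, S, hS, hx⟩ := mem_undet.1 he
  exact wsum_one_pos (h.keepOut e).nonneg (keepOut_ne_zero.2 ⟨hS, hx⟩)

lemma wcov_eq (μ f : Finset α → ℝ) (e : α) :
    wcov μ f e = wsum (keepIn e μ) f * wsum (keepOut e μ) 1 -
      wsum (keepOut e μ) f * wsum (keepIn e μ) 1 := by
  rw [wcov, wsum_split μ 1 e, wsum_split μ f e]
  ring

lemma wcov_eq_zero {μ : Finset α → ℝ} (f : Finset α → ℝ) {e : α} (he : e ∉ undet μ) :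
    wcov μ f e = 0 := by
  rw [mem_undet, not_and_or] at he
  push Not at he
  rcases he with he | he
  · have : keepIn e μ = 0 := by
      funext S
      by_contra h
      have := keepIn_ne_zero.1 h
      exact he S this.1 this.2
    simp [wcov, this, wsum]
  · have : keepIn e μ = μ := by
      funext S
      by_cases h : e ∈ S
      · simp [keepIn, h]
      · have : μ S = 0 := by
          by_contra h'
          exact h (he S h')
        simp [keepIn, h, this]
    simp [wcov, this]

lemma sum_wsum_keepIn (μ f : Finset α → ℝ) {r : ℝ} (hr : ∀ S, μ S ≠ 0 → (S.card : ℝ) = r) :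
    ∑ e, wsum (keepIn e μ) f = r * wsum μ f := by
  simp only [wsum]
  rw [Finset.sum_comm, Finset.mul_sum]
  refine Finset.sum_congr rfl fun S _ => ?_
  rw [← Finset.sum_mul]
  simp only [keepIn, Finset.sum_ite_mem, Finset.univ_inter, Finset.sum_const, nsmul_eq_mul]
  by_cases h : μ S = 0
  · simp [h]
  · rw [hr S h]
    ring

/-- The indicators of `e ∈ S` add up to |S|, which is constant on the support, and a constant has
zero covariance with `f`. This is the only use of constant size: it forces some undetermined element
to be nonnegatively correlated with `f`. -/
lemma sum_wcov {μ : Finset α → ℝ} (h : IsBalanced μ) (f : Finset α → ℝ) :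
    ∑ e, wcov μ f e = 0 := by
  obtain ⟨r, hr⟩ := h.homog
  simp only [wcov, Finset.sum_sub_distrib, ← Finset.sum_mul, ← Finset.mul_sum,
    sum_wsum_keepIn μ _ hr]
  ring

lemma eq_of_undet_eq_empty {μ : Finset α → ℝ} (h : undet μ = ∅) {S T : Finset α} (hS : μ S ≠ 0)
    (hT : μ T ≠ 0) : S = T := by
  ext e
  by_contra hne
  have : e ∈ undet μ := by
    rw [mem_undet]
    by_cases he : e ∈ S
    · exact ⟨⟨S, hS, he⟩, T, hT, fun h' => hne (by simp [he, h'])⟩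
    · exact ⟨⟨T, hT, by by_contra h'; exact hne (by simp [he, h'])⟩, S, hS, he⟩
  simp [h] at this

lemma wsum_of_undet_eq_empty {μ : Finset α → ℝ} (h : undet μ = ∅) {T : Finset α} (hT : μ T ≠ 0)
    (f : Finset α → ℝ) : wsum μ f = μ T * f T := by
  refine Finset.sum_eq_single T (fun S _ hS => ?_) (by simp)
  have : μ S = 0 := by
    by_contra h'
    exact hS (eq_of_undet_eq_empty h h' hT)
  simp [this]

lemma wsum_eq_zero {μ : Finset α → ℝ} (h : ∀ S, μ S = 0) (f : Finset α → ℝ) : wsum μ f = 0 := by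
  simp [wsum, h]

/-- Two groups of masses `a, b` and `a', b'` carry integrals `fa, fb` and `fa', fb'`. The mean over
the primed group is larger because each of its conditional means is larger (`h1`, `h2`) and it puts
more of its mass on the first part (`hnc`), where the mean is higher (`h3`). Unnormalized forms
allow `a'` or `b'` to vanish. -/
lemma weighted_average_le {a b a' b' fa fb fa' fb' : ℝ} (ha : 0 < a) (hb : 0 < b)
    (hnc : a * b' ≤ b * a') (h1 : fa * a' ≤ fa' * a)
    (h2 : fb * b' ≤ fb' * b) (h3 : fb * a ≤ fa * b) :
    (fa + fb) * (a' + b') ≤ (fa' + fb') * (a + b) := by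
  obtain ⟨φ, rfl⟩ : ∃ φ, fa = φ * a := ⟨fa / a, by field_simp⟩
  obtain ⟨ψ, rfl⟩ : ∃ ψ, fb = ψ * b := ⟨fb / b, by field_simp⟩
  have h1' : φ * a' ≤ fa' := by
    by_contra! h
    nlinarith
  have h2' : ψ * b' ≤ fb' := by
    by_contra! h
    nlinarith
  have h3' : ψ ≤ φ := by
    by_contra! h
    nlinarith [mul_pos ha hb]
  nlinarith [mul_nonneg (sub_nonneg.2 h3') (sub_nonneg.2 hnc),
    mul_le_mul_of_nonneg_right (add_le_add h1' h2') (add_pos ha hb).le]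

/-- Law of total covariance for a two-valued conditioning: the covariances within each value are
nonpositive by `h1`, `h2`, and the covariance of the two conditional means by `hc`. -/
lemma chebyshev_two_point {zi zo fi fo gi go hi ho : ℝ} (hzi : 0 < zi) (hzo : 0 < zo)
    (h1 : hi * zi ≤ fi * gi) (h2 : ho * zo ≤ fo * go)
    (hc : (fi * zo - fo * zi) * (gi * zo - go * zi) ≤ 0) :
    (hi + ho) * (zi + zo) ≤ (fi + fo) * (gi + go) := by
  obtain ⟨φi, rfl⟩ : ∃ φ, fi = φ * zi := ⟨fi / zi, by field_simp⟩
  obtain ⟨φo, rfl⟩ : ∃ φ, fo = φ * zo := ⟨fo / zo, by field_simp⟩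
  obtain ⟨γi, rfl⟩ : ∃ φ, gi = φ * zi := ⟨gi / zi, by field_simp⟩
  obtain ⟨γo, rfl⟩ : ∃ φ, go = φ * zo := ⟨go / zo, by field_simp⟩
  have h1' : hi ≤ φi * γi * zi := by
    by_contra! h
    nlinarith
  have h2' : ho ≤ φo * γo * zo := by
    by_contra! h
    nlinarith
  have hz := mul_pos hzi hzo
  have hc' : (φi - φo) * (γi - γo) ≤ 0 := by
    by_contra! h
    have := mul_pos (mul_pos hz hz) h
    nlinarith
  have h3 := mul_le_mul_of_nonneg_right (add_le_add h1' h2') (add_pos hzi hzo).le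
  nlinarith [mul_nonneg hz.le (sub_nonneg.2 hc')]

lemma exists_undet_wcov_nonneg {μ : Finset α → ℝ} (h : IsBalanced μ) (f : Finset α → ℝ)
    (hne : undet μ ≠ ∅) : ∃ x ∈ undet μ, 0 ≤ wcov μ f x := by
  by_contra! hc
  have hsum := sum_wcov h f
  obtain ⟨x, hx⟩ := Finset.nonempty_iff_ne_empty.2 hne
  have : ∑ e, wcov μ f e < ∑ _e : α, (0 : ℝ) := by
    refine Finset.sum_lt_sum (fun e _ => ?_) ⟨x, Finset.mem_univ _, hc x hx⟩
    by_cases he : e ∈ undet μ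
    · exact (hc e he).le
    · exact (wcov_eq_zero f he).le
  simp [hsum] at this

/-- Negative association against a single element. The induction on undetermined elements conditions
on an auxiliary `x` that helps `f` once `e` is present: the presence of `e` makes `x` less likely,
and for either status of `x` the presence of `e` lowers the mean of `f`. -/
theorem wcov_nonpos_of_depOn {μ : Finset α → ℝ} (h : IsBalanced μ) {f : Finset α → ℝ}
    (hf : Monotone f) {e : α} (hfe : DepOn {e}ᶜ f) : wcov μ f e ≤ 0 := by
  induction hn : (undet μ).card using Nat.strong_induction_on generalizing μ with
  | _ n ih =>
  subst hn
  by_cases he : e ∈ undet μ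
  swap
  · exact (wcov_eq_zero f he).le
  have hin : ∀ (ν : Finset α → ℝ) (y z : α), keepIn y (keepIn z ν) = keepIn z (keepIn y ν) := by
    intro ν y z
    funext S
    simp only [keepIn]
    split_ifs <;> rfl
  have hinOut : ∀ (ν : Finset α → ℝ) (y z : α),
      keepIn y (keepOut z ν) = keepOut z (keepIn y ν) := by
    intro ν y z
    funext S
    simp only [keepIn, keepOut]
    split_ifs <;> rfl
  have houtOut : ∀ (ν : Finset α → ℝ) (y z : α),
      keepOut y (keepOut z ν) = keepOut z (keepOut y ν) := by
    intro ν y z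
    funext S
    simp only [keepOut]
    split_ifs <;> rfl
  by_cases hu : undet (keepIn e μ) = ∅
  · obtain ⟨⟨T, hT, heT⟩, -⟩ := mem_undet.1 he
    have hT' : keepIn e μ T ≠ 0 := keepIn_ne_zero.2 ⟨hT, heT⟩
    -- Given `e`, an element `x` of `T` is certain; negative correlation makes it at least as likely
    -- without conditioning, hence certain. So `T \ {e}` is the smallest possible configuration, and
    -- `f` ignores `e`.
    have hsup : ∀ S, μ S ≠ 0 → T \ {e} ⊆ S := by
      intro S hS x hx
      simp only [Finset.mem_sdiff, Finset.mem_singleton] at hx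
      by_contra hxS
      have hnc := h.negCorr ∅ ∅ e x (Ne.symm hx.2)
      have e1 : mass μ (insert e (insert x ∅)) ∅ = mass μ (insert e ∅) ∅ := by
        rw [← mass_keepIn μ e (insert x ∅), ← mass_keepIn μ e ∅]
        simp only [mass, Finset.sum_filter]
        refine Finset.sum_congr rfl fun U _ => ?_
        by_cases hU : keepIn e μ U = 0
        · simp [hU]
        · have : U = T := eq_of_undet_eq_empty hu hU hT'
          subst this
          simp [hx.1]
      rw [e1] at hnc
      have hpos : 0 < mass μ (insert e ∅) ∅ := by
        rw [← mass_keepIn, mass_eq_wsum]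
        exact wsum_keepIn_pos h he
      have h2 := le_of_mul_le_mul_left hnc hpos
      rw [← mass_keepIn, mass_eq_wsum, mass_eq_wsum, wsum_split μ 1 x] at h2
      have := wsum_one_pos (h.keepOut x).nonneg (keepOut_ne_zero.2 ⟨hS, hxS⟩)
      linarith
    have hfT : ∀ S, μ S ≠ 0 → f T ≤ f S := by
      intro S hS
      have : f T = f (T \ {e}) := hfe _ _ (by ext; simp)
      rw [this]
      exact hf (hsup S hS)
    rw [wcov, wsum_of_undet_eq_empty hu hT', wsum_of_undet_eq_empty hu hT' 1]
    have hge : f T * wsum μ 1 ≤ wsum μ f := by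
      simp only [wsum, Finset.mul_sum, Pi.one_apply, mul_one]
      refine Finset.sum_le_sum fun S _ => ?_
      by_cases hS : μ S = 0
      · simp [hS]
      · rw [mul_comm]
        exact mul_le_mul_of_nonneg_left (hfT S hS) (h.nonneg S)
    have := mul_le_mul_of_nonneg_left hge ((h.keepIn e).nonneg T)
    simp only [Pi.one_apply, mul_one]
    linarith
  -- The element `x` is chosen after conditioning on `e`, which supplies the hypothesis `h3` of
  -- `weighted_average_le`. Being undetermined for `μ` too, it makes the induction hypothesis
  -- available for both of its statuses.
  · obtain ⟨x, hx, hxc⟩ := exists_undet_wcov_nonneg (h.keepIn e) f hu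
    have hxμ := undet_keepIn_subset μ e hx
    have hxe : e ≠ x := by
      rintro rfl
      obtain ⟨-, S, hS, hxS⟩ := mem_undet.1 hx
      exact hxS (keepIn_ne_zero.1 hS).2
    have h1 := ih _ (undet_keepIn_card_lt hxμ) (h.keepIn x) rfl
    have h2 := ih _ (undet_keepOut_card_lt hxμ) (h.keepOut x) rfl
    have hnc := h.negCorr ∅ ∅ e x hxe
    simp only [← mass_keepIn, mass_eq_wsum] at hnc
    rw [wcov_eq] at h1 h2 hxc ⊢
    have hpa := wsum_keepIn_pos (h.keepIn e) hx
    have hpb := wsum_keepOut_pos (h.keepIn e) hx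
    have c1 := hin μ e x
    have c2 := hinOut μ e x
    have c3 := hinOut μ x e
    have c4 := houtOut μ e x
    rw [c1, ← c3] at h1
    rw [c2, c4] at h2
    have s1 := wsum_split μ 1 x
    have s2 := wsum_split (keepIn e μ) 1 x
    have s3 := wsum_split (keepIn x μ) 1 e
    have s4 := wsum_split (keepOut x μ) 1 e
    have s5 := wsum_split (keepOut e μ) 1 x
    have s6 := wsum_split (keepIn e μ) f x
    have s7 := wsum_split (keepOut e μ) f x
    rw [c1, ← c3] at s3
    rw [c2, c4] at s4
    rw [s1, s3, s4, s2] at hnc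
    rw [s2, s5, s6, s7]
    have := weighted_average_le hpa hpb (by nlinarith) (sub_nonpos.1 h1) (sub_nonpos.1 h2)
      (sub_nonneg.1 hxc)
    linarith

lemma wcov_nonpos_of_not_mem {μ : Finset α → ℝ} (h : IsBalanced μ) {f : Finset α → ℝ}
    (hf : Monotone f) {K : Finset α} (hfK : DepOn K f) {e : α} (he : e ∉ K) : wcov μ f e ≤ 0 := by
  refine wcov_nonpos_of_depOn h hf fun S T hST => hfK S T ?_
  ext x
  have := Finset.ext_iff.1 hST x
  simp only [Finset.mem_inter, Finset.mem_compl, Finset.mem_singleton] at this ⊢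
  by_cases hx : x = e
  · subst hx
    simp [he]
  · simpa [hx] using and_congr_left_iff.2 fun _ => by simpa [hx] using this

/-- Balanced weights have negative associations. -/
theorem IsBalanced.negAssoc {μ : Finset α → ℝ} (h : IsBalanced μ) {f g : Finset α → ℝ}
    (hf : Monotone f) (hg : Monotone g) {K : Finset α} (hfK : DepOn K f) (hgK : DepOn Kᶜ g) :
    wsum μ (f * g) * wsum μ 1 ≤ wsum μ f * wsum μ g := by
  induction hn : (undet μ).card using Nat.strong_induction_on generalizing μ with
  | _ n ih =>
  subst hn
  by_cases hu : undet μ = ∅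
  · by_cases hμ : ∃ T, μ T ≠ 0
    · obtain ⟨T, hT⟩ := hμ
      simp only [wsum_of_undet_eq_empty hu hT, Pi.mul_apply, Pi.one_apply]
      linarith
    · push Not at hμ
      simp [wsum_eq_zero hμ]
  -- A pivot on which `f` and `g` react in opposite ways: an element nonnegatively correlated with
  -- one function is nonpositively correlated with the other if the latter does not depend on it.
  · have hex : ∃ e ∈ undet μ, wcov μ f e * wcov μ g e ≤ 0 := by
      obtain ⟨x, hx, hxg⟩ := exists_undet_wcov_nonneg h g hu
      obtain ⟨y, hy, hyf⟩ := exists_undet_wcov_nonneg h f hu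
      by_cases hxK : x ∈ K
      · by_cases hyK : y ∈ K
        · exact ⟨y, hy, mul_nonpos_of_nonneg_of_nonpos hyf
            (wcov_nonpos_of_not_mem h hg hgK (by simpa using hyK))⟩
        · have h1 := wcov_nonpos_of_not_mem h hf hfK hyK
          exact ⟨y, hy, by rw [le_antisymm h1 hyf, zero_mul]⟩
      · exact ⟨x, hx, mul_nonpos_of_nonpos_of_nonneg (wcov_nonpos_of_not_mem h hf hfK hxK) hxg⟩
    obtain ⟨e, he, hc⟩ := hex
    have h1 := ih _ (undet_keepIn_card_lt he) (h.keepIn e) rfl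
    have h2 := ih _ (undet_keepOut_card_lt he) (h.keepOut e) rfl
    rw [wcov_eq, wcov_eq] at hc
    rw [wsum_split μ (f * g) e, wsum_split μ 1 e, wsum_split μ f e, wsum_split μ g e]
    exact chebyshev_two_point (wsum_keepIn_pos h he) (wsum_keepOut_pos h he) h1 h2 hc

end FederMihail

/-! ### Determinantal weights on a finite set: positivity and negative correlations. -/

section Weights

open scoped ComplexOrder

variable {𝕜 : Type*} [RCLike 𝕜] {ι : Type*} [Fintype ι] [DecidableEq ι]

/-- The determinant of the matrix with rows taken from `X` on `S` and from `Y` off `S`. -/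
def rowDet (X Y : Matrix ι ι 𝕜) (S : Finset ι) : 𝕜 :=
  Matrix.det (Matrix.of fun i => if i ∈ S then X i else Y i)

lemma det_add_eq_sum_rowDet (X Y : Matrix ι ι 𝕜) : (X + Y).det = ∑ S, rowDet X Y S := by
  have h := (Matrix.detRowAlternating (R := 𝕜) (n := ι)).toMultilinearMap.map_add_univ X Y
  refine h.trans (Finset.sum_congr rfl fun S _ => ?_)
  change Matrix.det _ = Matrix.det _
  congr 1

/-- Erasing the rows of `X` on `B` and of `Y` on `A` gives a zero row to every term of the
multilinear expansion that violates `A ⊆ S` or meets `B`, and leaves the other terms unchanged. -/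
lemma sum_rowDet (X Y : Matrix ι ι 𝕜) (A B : Finset ι) :
    ∑ S with A ⊆ S ∧ Disjoint B S, rowDet X Y S =
      Matrix.det (Matrix.of fun i => (if i ∈ B then 0 else X i) + if i ∈ A then 0 else Y i) := by
  have h := det_add_eq_sum_rowDet (𝕜 := 𝕜) (Matrix.of fun i => if i ∈ B then 0 else X i)
    (Matrix.of fun i => if i ∈ A then 0 else Y i)
  refine Eq.trans ?_ h.symm
  rw [Finset.sum_filter]
  refine Finset.sum_congr rfl fun S _ => ?_
  split_ifs with hS
  · unfold rowDet
    congr 1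
    ext i j
    by_cases hi : i ∈ S
    · have : i ∉ B := fun hB => Finset.disjoint_left.1 hS.2 hB hi
      simp [hi, this]
    · have : i ∉ A := fun hA => hi (hS.1 hA)
      simp [hi, this]
  · symm
    rw [not_and_or, Finset.not_subset, Finset.not_disjoint_iff] at hS
    rcases hS with ⟨i, hA, hi⟩ | ⟨i, hB, hi⟩
    · refine Matrix.det_eq_zero_of_row_eq_zero i fun j => ?_
      simp [hA, hi]
    · refine Matrix.det_eq_zero_of_row_eq_zero i fun j => ?_
      simp [hB, hi]

lemma mass_re_rowDet (X Y : Matrix ι ι 𝕜) (A B : Finset ι) :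
    mass (fun S => RCLike.re (rowDet X Y S)) A B = RCLike.re (Matrix.det
      (Matrix.of fun i => (if i ∈ B then 0 else X i) + if i ∈ A then 0 else Y i)) := by
  rw [← sum_rowDet, mass, map_sum]

/-- The orthogonal projection onto the coordinates in `A`. -/
def coordProj (𝕜 : Type*) [RCLike 𝕜] (A : Finset ι) : Matrix ι ι 𝕜 :=
  Matrix.diagonal fun i => if i ∈ A then 1 else 0

/-- The two matrices differ by the factor `1 + P * L * (1 - P)`, whose determinant is 1. This
replaces a matrix with erased rows by a Hermitian one, so that positivity can be used. -/
lemma det_hermitize (L P D : Matrix ι ι 𝕜) (hP : P * P = P) (hD : (1 - P) * D = 1 - P) :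
    (P * L + D).det = (P * L * P + D).det := by
  have h1 : P * L + D = (1 + P * L * (1 - P)) * (P * L * P + D) := by
    have h0 : (1 - P) * P = 0 := by rw [sub_mul, one_mul, hP, sub_self]
    have h2 : P * L * (1 - P) * (P * L * P + D) = P * L * (1 - P) := by
      rw [mul_assoc (P * L), mul_add, ← mul_assoc (1 - P), ← mul_assoc (1 - P), h0, zero_mul,
        zero_mul, zero_add, hD]
    rw [add_mul, one_mul, h2, mul_sub, mul_one]
    abel
  rw [h1, Matrix.det_mul]
  have h3 : (1 + P * L * (1 - P)).det = 1 := by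
    rw [Matrix.det_one_add_mul_comm, ← mul_assoc, sub_mul, one_mul, hP, sub_self, zero_mul,
      add_zero, Matrix.det_one]
  rw [h3, one_mul]

lemma coordProj_mul_self (A : Finset ι) : coordProj 𝕜 A * coordProj 𝕜 A = coordProj 𝕜 A := by
  simp [coordProj, Matrix.diagonal_mul_diagonal]

lemma coordProj_posSemidef (A : Finset ι) : (coordProj 𝕜 A).PosSemidef := by
  refine Matrix.PosSemidef.diagonal fun i => ?_
  dsimp only
  split_ifs <;> simp

lemma one_sub_coordProj_mul {A B : Finset ι} (h : Disjoint A B) :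
    (1 - coordProj 𝕜 Bᶜ) * coordProj 𝕜 Aᶜ = 1 - coordProj 𝕜 Bᶜ := by
  have h1 : 1 - coordProj 𝕜 Bᶜ = Matrix.diagonal fun i => if i ∈ B then (1 : 𝕜) else 0 := by
    ext i j
    by_cases hB : i ∈ B <;> simp [coordProj, hB, Matrix.one_apply, Matrix.diagonal_apply]
  rw [h1, coordProj, Matrix.diagonal_mul_diagonal]
  congr 1
  funext i
  by_cases hB : i ∈ B
  · have : i ∉ A := fun hA => Finset.disjoint_left.1 h hA hB
    simp [hB, this]
  · simp [hB]

/-- The Hermitian matrix whose determinant is the sum of the principal minors of `L` over the sets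
containing `A` and disjoint from `B`. -/
def condMatrix (L : Matrix ι ι 𝕜) (A B : Finset ι) : Matrix ι ι 𝕜 :=
  coordProj 𝕜 Bᶜ * L * coordProj 𝕜 Bᶜ + coordProj 𝕜 Aᶜ

lemma condMatrix_posSemidef {L : Matrix ι ι 𝕜} (hL : L.PosSemidef) (A B : Finset ι) :
    (condMatrix L A B).PosSemidef := by
  refine Matrix.PosSemidef.add ?_ (coordProj_posSemidef _)
  have := hL.mul_mul_conjTranspose_same (coordProj 𝕜 Bᶜ)
  rwa [(coordProj_posSemidef (𝕜 := 𝕜) Bᶜ).isHermitian.eq] at this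

lemma mass_rowDet_one (L : Matrix ι ι 𝕜) {A B : Finset ι} (h : Disjoint A B) :
    mass (fun S => RCLike.re (rowDet L 1 S)) A B = RCLike.re (condMatrix L A B).det := by
  rw [mass_re_rowDet, condMatrix, ← det_hermitize]
  · congr 2
    ext i j
    by_cases hB : i ∈ B <;> by_cases hA : i ∈ A <;>
      simp [coordProj, hA, hB, Matrix.one_apply, Matrix.diagonal_apply]
  · exact coordProj_mul_self _
  · exact one_sub_coordProj_mul h

/-- Requiring `S` to be in and its complement to be out isolates a single term, which is therefore
the determinant of a positive semidefinite matrix. -/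
lemma rowDet_one_nonneg {L : Matrix ι ι 𝕜} (hL : L.PosSemidef) (S : Finset ι) :
    0 ≤ rowDet L 1 S := by
  have h : rowDet L 1 S = (condMatrix L S Sᶜ).det := by
    rw [condMatrix, ← det_hermitize]
    · unfold rowDet
      congr 1
      ext i j
      by_cases hB : i ∈ S <;>
        simp [coordProj, hB, Matrix.one_apply, Matrix.diagonal_apply]
    · exact coordProj_mul_self _
    · exact one_sub_coordProj_mul disjoint_compl_right
  rw [h]
  exact (condMatrix_posSemidef hL _ _).det_nonneg

lemma condMatrix_eq_add {κ : Type*} [Fintype κ] [DecidableEq κ] (L : Matrix ι ι 𝕜)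
    {A B A' : Finset ι} (c : κ → ι) (hc : Function.Injective c) (hcA : ∀ k, c k ∉ A)
    (hA' : ∀ i, i ∈ A' ↔ i ∈ A ∨ ∃ k, c k = i) :
    condMatrix L A' B = condMatrix L A B +
      (-(1 : Matrix ι ι 𝕜).submatrix id c) * (1 : Matrix ι ι 𝕜).submatrix c id := by
  rw [condMatrix, condMatrix, add_assoc]
  congr 1
  ext i j
  simp only [coordProj, Matrix.add_apply, Matrix.mul_apply, Matrix.neg_apply,
    Matrix.submatrix_apply, id, Matrix.one_apply, Matrix.diagonal_apply, Finset.mem_compl, hA']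
  by_cases hi : ∃ k, c k = i
  · obtain ⟨k, rfl⟩ := hi
    rw [Finset.sum_eq_single k (fun x _ hx => by simp [hc.ne hx.symm]) (by simp)]
    by_cases hj : c k = j
    · subst hj
      simp [hcA k]
    · simp [hj]
  · have : ∀ x, ¬ i = c x := fun x hx => hi ⟨x, hx.symm⟩
    simp [hi, this]

/-- Requiring further points to be in removes the corresponding diagonal ones, a perturbation of
rank |κ|, so the matrix determinant lemma applies. Conditionally on `A` in and `B` out, the points
off `A` thus form a determinantal set with kernel 1 - G, where G is the inverse of `condMatrix L A
B`. -/
lemma det_condMatrix {κ : Type*} [Fintype κ] [DecidableEq κ] (L : Matrix ι ι 𝕜)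
    {A B A' : Finset ι} (c : κ → ι) (hc : Function.Injective c) (hcA : ∀ k, c k ∉ A)
    (hA' : ∀ i, i ∈ A' ↔ i ∈ A ∨ ∃ k, c k = i) (hu : IsUnit (condMatrix L A B).det) :
    (condMatrix L A' B).det = (condMatrix L A B).det *
      (1 - (condMatrix L A B)⁻¹.submatrix c c).det := by
  rw [condMatrix_eq_add L c hc hcA hA', Matrix.det_add_mul _ _ hu]
  congr 2
  rw [Matrix.mul_neg, ← sub_eq_add_neg]
  congr 1
  ext i j
  simp [Matrix.mul_apply, Matrix.one_apply]

lemma eq_ofReal_re {z : 𝕜} (hz : 0 ≤ z) : z = (RCLike.re z : 𝕜) := by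
  rw [RCLike.nonneg_iff] at hz
  apply RCLike.ext <;> simp [hz.2]

lemma re_mul_of_nonneg {z w : 𝕜} (hz : 0 ≤ z) : RCLike.re (z * w) = RCLike.re z * RCLike.re w := by
  rw [RCLike.nonneg_iff] at hz
  simp [hz.2]

lemma det_condMatrix_negCorr {L : Matrix ι ι 𝕜} (hL : L.PosSemidef) {A B : Finset ι} {e f : ι}
    (hef : e ≠ f) (he : e ∉ A) (hf : f ∉ A) :
    RCLike.re (condMatrix L (insert e (insert f A)) B).det * RCLike.re (condMatrix L A B).det ≤
      RCLike.re (condMatrix L (insert e A) B).det *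
        RCLike.re (condMatrix L (insert f A) B).det := by
  have hnn : ∀ A', 0 ≤ (condMatrix L A' B).det := fun A' =>
    (condMatrix_posSemidef hL A' B).det_nonneg
  by_cases h0 : (condMatrix L A B).det = 0
  · rw [h0, map_zero, mul_zero]
    exact mul_nonneg (RCLike.nonneg_iff.1 (hnn _)).1 (RCLike.nonneg_iff.1 (hnn _)).1
  have hu : IsUnit (condMatrix L A B).det := isUnit_iff_ne_zero.2 h0
  set G := (condMatrix L A B)⁻¹ with hG
  have hGp : G.PosSemidef := (condMatrix_posSemidef hL A B).inv
  have h1 := det_condMatrix L (A' := insert e A) (fun _ : Unit => e)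
    (fun _ _ _ => rfl) (fun _ => he) (fun i => by simp [or_comm, eq_comm]) hu
  have h2 := det_condMatrix L (A' := insert f A) (fun _ : Unit => f)
    (fun _ _ _ => rfl) (fun _ => hf) (fun i => by simp [or_comm, eq_comm]) hu
  have h3 := det_condMatrix L (A' := insert e (insert f A)) (![e, f])
    (by
      intro x y
      fin_cases x <;> fin_cases y <;> simp [hef, hef.symm])
    (fun k => by fin_cases k <;> simp [he, hf])
    (fun i => by
      simp only [Finset.mem_insert, Fin.exists_fin_two, Matrix.cons_val_zero, Matrix.cons_val_one]
      tauto) hu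
  rw [Matrix.det_fin_two] at h3
  rw [Matrix.det_unique (_ : Matrix Unit Unit 𝕜)] at h1 h2
  simp only [Matrix.sub_apply, Matrix.one_apply, Matrix.submatrix_apply, ← hG] at h1 h2 h3
  simp at h1 h2 h3
  have hgg : G e f * G f e = ((‖G e f‖ ^ 2 : ℝ) : 𝕜) := by
    rw [← hGp.isHermitian.apply f e]
    simpa using RCLike.mul_conj (G e f)
  have hge := eq_ofReal_re (hGp.diag_nonneg (i := e))
  have hgf := eq_ofReal_re (hGp.diag_nonneg (i := f))
  have hd := eq_ofReal_re (hnn A)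
  rw [hgg] at h3
  rw [hge] at h1 h3
  rw [hgf] at h2 h3
  rw [hd] at h1 h2 h3
  have h1' := congrArg RCLike.re h1
  have h2' := congrArg RCLike.re h2
  have h3' := congrArg RCLike.re h3
  norm_cast at h1' h2' h3'
  rw [h1', h2', h3']
  -- The right side minus the left side is the squared determinant times |G(e,f)|².
  nlinarith [mul_nonneg (sq_nonneg (RCLike.re (condMatrix L A B).det)) (sq_nonneg ‖G e f‖)]

lemma mass_nonneg {μ : Finset ι → ℝ} (h : ∀ S, 0 ≤ μ S) (A B : Finset ι) : 0 ≤ mass μ A B :=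
  Finset.sum_nonneg fun S _ => h S

lemma mass_eq_zero_of_not_disjoint (μ : Finset ι → ℝ) {A B : Finset ι} (h : ¬ Disjoint A B) :
    mass μ A B = 0 := by
  rw [mass, Finset.filter_false_of_mem, Finset.sum_empty]
  rintro S - ⟨h1, h2⟩
  exact h (Finset.disjoint_of_subset_left h1 h2.symm)

lemma HereditaryNegCorr.of_disjoint {μ : Finset ι → ℝ} (hμ : ∀ S, 0 ≤ μ S)
    (h : ∀ A B e f, e ≠ f → e ∉ A → f ∉ A → Disjoint (insert e (insert f A)) B →
      mass μ (insert e (insert f A)) B * mass μ A B ≤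
        mass μ (insert e A) B * mass μ (insert f A) B) : HereditaryNegCorr μ := by
  intro A B e f hef
  by_cases hd : Disjoint (insert e (insert f A)) B
  swap
  · rw [mass_eq_zero_of_not_disjoint μ hd, zero_mul]
    exact mul_nonneg (mass_nonneg hμ _ _) (mass_nonneg hμ _ _)
  by_cases he : e ∈ A
  · rw [Finset.insert_eq_of_mem he, Finset.insert_eq_of_mem (Finset.mem_insert_of_mem he),
      mul_comm]
  by_cases hf : f ∈ A
  · rw [Finset.insert_eq_of_mem hf]
  exact h A B e f hef he hf hd

theorem hereditaryNegCorr_rowDet_one {L : Matrix ι ι 𝕜} (hL : L.PosSemidef) :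
    HereditaryNegCorr fun S => RCLike.re (rowDet L 1 S) := by
  refine HereditaryNegCorr.of_disjoint
    (fun S => (RCLike.nonneg_iff.1 (rowDet_one_nonneg hL S)).1) fun A B e f hef he hf hd => ?_
  have d1 : Disjoint (insert e A) B := Finset.disjoint_of_subset_left
    (Finset.insert_subset_insert e (Finset.subset_insert f A)) hd
  have d2 : Disjoint (insert f A) B := Finset.disjoint_of_subset_left (Finset.subset_insert e _) hd
  have d3 : Disjoint A B := Finset.disjoint_of_subset_left (Finset.subset_insert f _) d2
  rw [mass_rowDet_one L hd, mass_rowDet_one L d1, mass_rowDet_one L d2, mass_rowDet_one L d3]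
  exact det_condMatrix_negCorr hL hef he hf

/-- Congruence by a positive diagonal matrix multiplies each principal minor by squares, so an
external field `w` amounts to the congruence with diagonal √w and keeps `L` positive semidefinite.
-/
lemma rowDet_one_field (L : Matrix ι ι 𝕜) {s : ι → ℝ} (hs : ∀ i, 0 < s i) (S : Finset ι) :
    rowDet (Matrix.diagonal (fun i => (s i : 𝕜)) * L * Matrix.diagonal fun i => (s i : 𝕜)) 1 S =
      (∏ i ∈ S, ((s i : 𝕜)) ^ 2) * rowDet L 1 S := by
  have h1 : ∀ i, (s i : 𝕜) ≠ 0 := fun i => by exact_mod_cast (hs i).ne'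
  set M : Matrix ι ι 𝕜 := Matrix.of fun i => if i ∈ S then L i else (1 : Matrix ι ι 𝕜) i with hM
  have h2 : (Matrix.of fun i => if i ∈ S then
      (Matrix.diagonal (fun i => (s i : 𝕜)) * L * Matrix.diagonal fun i => (s i : 𝕜)) i else
        (1 : Matrix ι ι 𝕜) i) =
      Matrix.diagonal (fun i => if i ∈ S then (s i : 𝕜) else (s i : 𝕜)⁻¹) * M *
        Matrix.diagonal fun i => (s i : 𝕜) := by
    ext i j
    by_cases hi : i ∈ S
    · simp [hi, hM, Matrix.mul_diagonal, Matrix.diagonal_mul]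
    · by_cases hij : i = j
      · subst hij
        simp [hi, hM, Matrix.mul_diagonal, Matrix.diagonal_mul, h1]
      · simp [hi, hM, Matrix.mul_diagonal, Matrix.diagonal_mul, hij]
  rw [rowDet, h2, Matrix.det_mul, Matrix.det_mul, Matrix.det_diagonal, Matrix.det_diagonal, rowDet,
    mul_right_comm, ← Finset.prod_mul_distrib, ← hM]
  congr 1
  rw [← Finset.prod_subset (Finset.subset_univ S)]
  · refine Finset.prod_congr rfl fun i hi => ?_
    simp [hi, sq]
  · intro i _ hi
    simp [hi, h1]

/-- `Q` is a positive contraction, as a matrix. -/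
structure IsContr (Q : Matrix ι ι 𝕜) : Prop where
  posSemidef : Q.PosSemidef
  one_sub : (1 - Q).PosSemidef

/-- When 1 - Q is invertible, the weights are proportional to the principal minors of L = Q(1 -
Q)⁻¹. Writing L as Q + Q(1 - Q)⁻¹Q shows that it is positive semidefinite. -/
lemma rowDet_one_sub_eq {Q : Matrix ι ι 𝕜} (hQ : (1 - Q).PosDef) (S : Finset ι) :
    rowDet Q (1 - Q) S = rowDet (Q + Q * (1 - Q)⁻¹ * Q) 1 S * (1 - Q).det := by
  rw [rowDet, rowDet, ← Matrix.det_mul]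
  congr 1
  have hu : IsUnit (1 - Q).det := hQ.isUnit.map Matrix.detMonoidHom
  have hL : (Q + Q * (1 - Q)⁻¹ * Q) * (1 - Q) = Q := by
    have hc : Q * (1 - Q) = (1 - Q) * Q := by noncomm_ring
    rw [add_mul, mul_assoc _ Q, hc, ← mul_assoc, mul_assoc Q, Matrix.nonsing_inv_mul _ hu,
      mul_one, sub_mul, one_mul, sub_add_cancel]
  ext i j
  by_cases hi : i ∈ S
  · conv_lhs => rw [← hL]
    simp [hi, Matrix.mul_apply]
  · simp [hi, Matrix.mul_apply, Matrix.one_apply]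

lemma posSemidef_ensemble {Q : Matrix ι ι 𝕜} (hQ : Q.PosSemidef) (hQ' : (1 - Q).PosSemidef) :
    (Q + Q * (1 - Q)⁻¹ * Q).PosSemidef := by
  refine hQ.add ?_
  have := hQ'.inv.mul_mul_conjTranspose_same Q
  rwa [hQ.isHermitian.eq] at this

lemma IsContr.smul {Q : Matrix ι ι 𝕜} (hQ : IsContr Q) {t : ℝ} (h0 : 0 ≤ t) (h1 : t < 1) :
    ((t : 𝕜) • Q).PosSemidef ∧ (1 - (t : 𝕜) • Q).PosDef := by
  have h0' : (0 : 𝕜) ≤ t := by exact_mod_cast h0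
  refine ⟨hQ.posSemidef.smul h0', ?_⟩
  have : 1 - (t : 𝕜) • Q = ((1 - t : ℝ) : 𝕜) • (1 : Matrix ι ι 𝕜) + (t : 𝕜) • (1 - Q) := by
    push_cast
    rw [smul_sub, sub_smul, one_smul]
    abel
  rw [this]
  refine Matrix.PosDef.add_posSemidef ?_ (hQ.one_sub.smul h0')
  refine Matrix.PosDef.one.smul ?_
  exact_mod_cast sub_pos.2 h1

/-- The probability that the determinantal random set with kernel `Q` equals `S`. -/
def pw (Q : Matrix ι ι 𝕜) (S : Finset ι) : ℝ := RCLike.re (rowDet Q (1 - Q) S)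

lemma continuous_rowDet_smul (Q : Matrix ι ι 𝕜) (S : Finset ι) :
    Continuous fun t : ℝ => rowDet ((t : 𝕜) • Q) (1 - (t : 𝕜) • Q) S := by
  unfold rowDet
  refine Continuous.matrix_det ?_
  refine continuous_matrix fun i j => ?_
  by_cases hi : i ∈ S
  · simp only [hi, Matrix.of_apply, if_true, Matrix.smul_apply]
    fun_prop
  · simp only [hi, Matrix.of_apply, if_false, Matrix.smul_apply, Matrix.sub_apply]
    fun_prop

/-- 1 may be an eigenvalue of Q, so the claim is proved for tQ with t < 1, where the principal-minor
form is available, and then t tends to 1. -/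
lemma rowDet_nonneg {Q : Matrix ι ι 𝕜} (hQ : IsContr Q) (S : Finset ι) :
    0 ≤ rowDet Q (1 - Q) S := by
  have hc := (continuous_rowDet_smul Q S).tendsto 1
  simp only [RCLike.ofReal_one, one_smul] at hc
  have hc' := hc.mono_left (nhdsWithin_le_nhds (s := Set.Iio 1))
  refine ge_of_tendsto hc' ?_
  filter_upwards [Ioo_mem_nhdsLT (zero_lt_one : (0 : ℝ) < 1)] with t ht
  obtain ⟨h1, h2⟩ := hQ.smul ht.1.le ht.2
  rw [rowDet_one_sub_eq h2]
  exact mul_nonneg (rowDet_one_nonneg (posSemidef_ensemble h1 h2.posSemidef) S) h2.det_pos.le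

lemma pw_nonneg {Q : Matrix ι ι 𝕜} (hQ : IsContr Q) (S : Finset ι) : 0 ≤ pw Q S :=
  (RCLike.nonneg_iff.1 (rowDet_nonneg hQ S)).1

lemma HereditaryNegCorr.const_mul {μ : Finset ι → ℝ} (h : HereditaryNegCorr μ) (c : ℝ) :
    HereditaryNegCorr fun S => c * μ S := by
  intro A B e f hef
  have hm : ∀ A B, mass (fun S => c * μ S) A B = c * mass μ A B := fun A B => by
    simp [mass, Finset.mul_sum]
  have := mul_le_mul_of_nonneg_left (h A B e f hef) (mul_self_nonneg c)
  simp only [hm]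
  linarith

theorem hereditaryNegCorr_pw {Q : Matrix ι ι 𝕜} (hQ : IsContr Q) {w : ι → ℝ}
    (hw : ∀ i, 0 < w i) : HereditaryNegCorr fun S => pw Q S * ∏ i ∈ S, w i := by
  intro A B e f hef
  have hcont : ∀ A B, Continuous fun t : ℝ =>
      mass (fun S => pw ((t : 𝕜) • Q) S * ∏ i ∈ S, w i) A B := fun A B => by
    refine continuous_finsetSum _ fun S _ => Continuous.mul ?_ continuous_const
    exact RCLike.continuous_re.comp (continuous_rowDet_smul Q S)
  have hl := ((hcont (insert e (insert f A)) B).mul (hcont A B)).tendsto 1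
  have hr := ((hcont (insert e A) B).mul (hcont (insert f A) B)).tendsto 1
  simp only [Pi.mul_apply, RCLike.ofReal_one, one_smul] at hl hr
  refine le_of_tendsto_of_tendsto (hl.mono_left (nhdsWithin_le_nhds (s := Set.Iio 1)))
    (hr.mono_left (nhdsWithin_le_nhds (s := Set.Iio 1))) ?_
  filter_upwards [Ioo_mem_nhdsLT (zero_lt_one : (0 : ℝ) < 1)] with t ht
  obtain ⟨h1, h2⟩ := hQ.smul ht.1.le ht.2
  set R := (t : 𝕜) • Q with hR
  set L := R + R * (1 - R)⁻¹ * R with hL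
  have hLp : L.PosSemidef := posSemidef_ensemble h1 h2.posSemidef
  set D : Matrix ι ι 𝕜 := Matrix.diagonal fun i => ((Real.sqrt (w i) : ℝ) : 𝕜) with hD
  have hDh : D.conjTranspose = D := by
    rw [hD, Matrix.diagonal_conjTranspose]
    congr 1
    funext i
    simp
  have hDLD : (D * L * D).PosSemidef := by
    have := hLp.mul_mul_conjTranspose_same D
    rwa [hDh] at this
  have heq : (fun S => pw R S * ∏ i ∈ S, w i) =
      fun S => RCLike.re (1 - R).det * RCLike.re (rowDet (D * L * D) 1 S) := by
    funext S
    rw [pw, rowDet_one_sub_eq h2, hD,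
      rowDet_one_field L (s := fun i => Real.sqrt (w i)) (fun i => Real.sqrt_pos.2 (hw i)),
      re_mul_of_nonneg (rowDet_one_nonneg hLp S)]
    have : (∏ i ∈ S, ((Real.sqrt (w i) : ℝ) : 𝕜) ^ 2) = ((∏ i ∈ S, w i : ℝ) : 𝕜) := by
      push_cast
      refine Finset.prod_congr rfl fun i _ => ?_
      rw [← RCLike.ofReal_pow, Real.sq_sqrt (hw i).le]
    rw [this, RCLike.re_ofReal_mul]
    ring
  have key : HereditaryNegCorr fun S => pw R S * ∏ i ∈ S, w i := by
    rw [heq]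
    exact (hereditaryNegCorr_rowDet_one hDLD).const_mul _
  exact key A B e f hef

end Weights

/-! ### Marginals, projections and dilation; negative association on a finite set. -/

section Marginals

open scoped ComplexOrder

variable {𝕜 : Type*} [RCLike 𝕜] {ι : Type*} [Fintype ι] [DecidableEq ι]
  {κ : Type*} [Fintype κ] [DecidableEq κ]

lemma det_eq_det_submatrix (φ : κ → ι) (hφ : Function.Injective φ) (M : Matrix ι ι 𝕜)
    (hM : ∀ i, i ∉ Set.range φ → ∀ j, M i j = (1 : Matrix ι ι 𝕜) i j) :
    M.det = (M.submatrix φ φ).det := by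
  classical
  rw [Matrix.twoBlockTriangular_det M (fun i => i ∈ Set.range φ)]
  · have h1 : Matrix.toSquareBlockProp M (fun i => ¬ i ∈ Set.range φ) = 1 := by
      ext i j
      change M i j = _
      rw [hM i i.2, Matrix.one_apply, Matrix.one_apply]
      simp [Subtype.ext_iff]
    rw [h1, Matrix.det_one, mul_one]
    have h2 := (Matrix.det_submatrix_equiv_self (Equiv.ofInjective φ hφ)
      (Matrix.toSquareBlockProp M fun i => i ∈ Set.range φ)).symm
    convert h2
    rfl
  · intro i hi j hj
    rw [hM i hi, Matrix.one_apply, if_neg]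
    rintro rfl
    exact hi hj

/-- The trace of `S` on `κ`. -/
def pullback (φ : κ ↪ ι) (S : Finset ι) : Finset κ := Finset.univ.filter fun k => φ k ∈ S

lemma mem_pullback {φ : κ ↪ ι} {S : Finset ι} {k : κ} : k ∈ pullback φ S ↔ φ k ∈ S := by
  simp [pullback]

lemma pullback_eq_iff {φ : κ ↪ ι} {S : Finset ι} {T : Finset κ} :
    pullback φ S = T ↔ T.map φ ⊆ S ∧ Disjoint (Tᶜ.map φ) S := by
  constructor
  · rintro rfl
    constructor
    · intro i hi
      obtain ⟨k, hk, rfl⟩ := Finset.mem_map.1 hi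
      exact mem_pullback.1 hk
    · rw [Finset.disjoint_left]
      intro i hi
      obtain ⟨k, hk, rfl⟩ := Finset.mem_map.1 hi
      simpa [mem_pullback] using hk
  · rintro ⟨h1, h2⟩
    ext k
    rw [mem_pullback]
    constructor
    · intro hk
      by_contra hT
      exact Finset.disjoint_left.1 h2 (Finset.mem_map_of_mem φ (by simpa using hT)) hk
    · intro hk
      exact h1 (Finset.mem_map_of_mem φ hk)

lemma mass_pw (Q : Matrix ι ι 𝕜) (A B : Finset ι) :
    mass (pw Q) A B = RCLike.re (Matrix.det
      (Matrix.of fun i => (if i ∈ B then 0 else Q i) + if i ∈ A then 0 else (1 - Q) i)) :=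
  mass_re_rowDet Q (1 - Q) A B

/-- Leaving the status of a point free adds its rows of Q and 1 - Q into a row of the identity, so
the determinant collapses to the range of `φ`. -/
lemma mass_pw_map (Q : Matrix ι ι 𝕜) (φ : κ ↪ ι) (T : Finset κ) :
    mass (pw Q) (T.map φ) (Tᶜ.map φ) = pw (Q.submatrix φ φ) T := by
  rw [mass_pw, pw, rowDet, det_eq_det_submatrix φ φ.injective]
  · congr 2
    ext k l
    by_cases hk : k ∈ T
    · simp [hk]
    · simp [hk, Matrix.one_apply]
  · intro i hi j
    have h : ∀ U : Finset κ, i ∉ U.map φ := fun U hU => hi (by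
      obtain ⟨k, -, rfl⟩ := Finset.mem_map.1 hU
      exact ⟨k, rfl⟩)
    simp only [h, if_false, Matrix.of_apply, Pi.add_apply, Matrix.sub_apply]
    ring

/-- The determinantal weights are compatible with restriction of the kernel. -/
lemma sum_pw_pullback (Q : Matrix ι ι 𝕜) (φ : κ ↪ ι) (F : Finset κ → ℝ) :
    ∑ S, pw Q S * F (pullback φ S) = ∑ T, pw (Q.submatrix φ φ) T * F T := by
  rw [← Finset.sum_fiberwise Finset.univ (pullback φ)]
  refine Finset.sum_congr rfl fun T _ => ?_
  rw [← mass_pw_map, mass, Finset.sum_mul]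
  simp only [pullback_eq_iff]
  refine Finset.sum_congr rfl fun S hS => ?_
  rw [Finset.mem_filter, ← pullback_eq_iff] at hS
  rw [hS.2]

lemma mass_pw_empty_right (Q : Matrix ι ι 𝕜) (A : Finset ι) :
    mass (pw Q) A ∅ = RCLike.re (Q.submatrix (Subtype.val : A → ι) Subtype.val).det := by
  rw [mass_pw, det_eq_det_submatrix (Subtype.val : A → ι) Subtype.val_injective]
  · congr 2
    ext i j
    simp
  · intro i hi j
    have : i ∉ A := by simpa using hi
    simp [this]

lemma wsum_pw_one (Q : Matrix ι ι 𝕜) : wsum (pw Q) 1 = 1 := by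
  rw [← mass_eq_wsum, mass_pw_empty_right, Matrix.det_isEmpty, RCLike.one_re]

lemma mass_pw_singleton (Q : Matrix ι ι 𝕜) (e : ι) : mass (pw Q) {e} ∅ = RCLike.re (Q e e) := by
  rw [mass_pw, det_eq_det_submatrix (fun _ : Unit => e) fun _ _ _ => rfl]
  · rw [Matrix.det_unique]
    simp
  · intro i hi j
    have : i ≠ e := fun h => hi ⟨(), h.symm⟩
    simp [this]

lemma mass_pw_pair {Q : Matrix ι ι 𝕜} (hQ : Q.PosSemidef) {e f : ι} (hef : e ≠ f) :
    mass (pw Q) {e, f} ∅ = RCLike.re (Q e e) * RCLike.re (Q f f) - ‖Q e f‖ ^ 2 := by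
  rw [mass_pw, det_eq_det_submatrix ![e, f] (by
    intro x y
    fin_cases x <;> fin_cases y <;> simp [hef, hef.symm])]
  · rw [Matrix.det_fin_two]
    have hgg : Q e f * Q f e = ((‖Q e f‖ ^ 2 : ℝ) : 𝕜) := by
      rw [← hQ.isHermitian.apply f e]
      simpa using RCLike.mul_conj (Q e f)
    simp only [Matrix.submatrix_apply, Matrix.of_apply,
      Matrix.cons_val_zero, Matrix.cons_val_one, Finset.notMem_empty, if_false,
      Finset.mem_insert, Finset.mem_singleton, true_or, or_true, if_true, add_zero, map_sub]
    rw [hgg, re_mul_of_nonneg hQ.diag_nonneg, RCLike.ofReal_re]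
  · intro i hi j
    have h1 : i ≠ e := fun h => hi ⟨0, h.symm⟩
    have h2 : i ≠ f := fun h => hi ⟨1, h.symm⟩
    simp [h1, h2]

lemma sum_pw_mul_card (Q : Matrix ι ι 𝕜) : ∑ S, pw Q S * (S.card : ℝ) = RCLike.re Q.trace := by
  have h : ∀ S : Finset ι, pw Q S * (S.card : ℝ) = ∑ e, if e ∈ S then pw Q S else 0 := fun S => by
    rw [Finset.sum_ite_mem, Finset.univ_inter, Finset.sum_const, nsmul_eq_mul, mul_comm]
  simp only [h]
  rw [Finset.sum_comm, Matrix.trace, map_sum]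
  refine Finset.sum_congr rfl fun e _ => ?_
  rw [Matrix.diag_apply, ← mass_pw_singleton, mass, Finset.sum_filter]
  simp

lemma sum_pw_mul_card_sq {Q : Matrix ι ι 𝕜} (hQ : Q.PosSemidef) :
    ∑ S, pw Q S * (S.card : ℝ) ^ 2 =
      RCLike.re Q.trace ^ 2 + RCLike.re Q.trace - ∑ e, ∑ f, ‖Q e f‖ ^ 2 := by
  have h : ∀ S : Finset ι, pw Q S * (S.card : ℝ) ^ 2 =
      ∑ e, ∑ f, if {e, f} ⊆ S then pw Q S else 0 := fun S => by
    have : ∀ e f, (if {e, f} ⊆ S then pw Q S else 0) =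
        if e ∈ S then (if f ∈ S then pw Q S else 0) else 0 := fun e f => by
      by_cases h1 : e ∈ S <;> by_cases h2 : f ∈ S <;>
        simp [h1, h2, Finset.insert_subset_iff]
    have h' : ∀ c : ℝ, ∑ e, (if e ∈ S then c else 0) = S.card * c := fun c => by
      rw [Finset.sum_ite_mem, Finset.univ_inter, Finset.sum_const, nsmul_eq_mul]
    simp only [this, Finset.sum_ite_irrel, Finset.sum_const_zero, h']
    ring
  have hm : ∀ e f, mass (pw Q) {e, f} ∅ = RCLike.re (Q e e) * RCLike.re (Q f f) - ‖Q e f‖ ^ 2 +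
      if e = f then RCLike.re (Q e e) else 0 := fun e f => by
    by_cases hef : e = f
    · subst hef
      have : ‖Q e e‖ = RCLike.re (Q e e) := by
        have h0 := hQ.diag_nonneg (i := e)
        conv_lhs => rw [eq_ofReal_re h0]
        rw [RCLike.norm_ofReal, abs_of_nonneg (RCLike.nonneg_iff.1 h0).1]
      simp only [Finset.pair_eq_singleton, mass_pw_singleton, this, if_true]
      ring
    · rw [mass_pw_pair hQ hef, if_neg hef, add_zero]
  simp only [h]
  rw [Finset.sum_comm]
  have h2 : ∀ e, ∑ S : Finset ι, ∑ f, (if {e, f} ⊆ S then pw Q S else 0) = ∑ f, mass (pw Q) {e, f} ∅ := by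
    intro e
    rw [Finset.sum_comm]
    refine Finset.sum_congr rfl fun f _ => ?_
    rw [mass, Finset.sum_filter]
    simp
  simp only [h2, hm, Finset.sum_add_distrib, Finset.sum_sub_distrib, Finset.sum_ite_eq,
    Finset.mem_univ, if_true, ← Finset.mul_sum, ← Finset.sum_mul, Matrix.trace, map_sum,
    Matrix.diag_apply]
  ring

/-- The determinantal random set of a projection has constant size. -/
lemma card_eq_of_pw_ne_zero {Q : Matrix ι ι 𝕜} (hQ : IsContr Q) (hQ2 : Q * Q = Q)
    {S : Finset ι} (hS : pw Q S ≠ 0) : (S.card : ℝ) = RCLike.re Q.trace := by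
  set r := RCLike.re Q.trace
  have hnorm : ∑ e, ∑ f, ‖Q e f‖ ^ 2 = r := by
    have h1 : ∀ e f, ((‖Q e f‖ ^ 2 : ℝ) : 𝕜) = Q e f * Q f e := fun e f => by
      rw [← hQ.posSemidef.isHermitian.apply f e]
      simpa using (RCLike.mul_conj (Q e f)).symm
    have h2 : ((∑ e, ∑ f, ‖Q e f‖ ^ 2 : ℝ) : 𝕜) = (Q * Q).trace := by
      push_cast
      simp only [Matrix.trace, Matrix.diag_apply, Matrix.mul_apply, ← h1]
      push_cast
      rfl
    rw [hQ2] at h2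
    rw [show r = RCLike.re Q.trace from rfl, ← h2, RCLike.ofReal_re]
  -- The variance of the size is tr Q - ∑ |Q(e,f)|² = tr Q - tr Q², which vanishes for a projection.
  -- As the weights are nonnegative, every set of nonzero weight has the mean size.
  have hvar : ∑ T, pw Q T * ((T.card : ℝ) - r) ^ 2 = 0 := by
    have e1 := sum_pw_mul_card Q
    have e2 := sum_pw_mul_card_sq hQ.posSemidef
    have e3 : ∑ T, pw Q T = 1 := by simpa [wsum] using wsum_pw_one Q
    calc ∑ T, pw Q T * ((T.card : ℝ) - r) ^ 2
        = ∑ T, pw Q T * (T.card : ℝ) ^ 2 - 2 * r * ∑ T, pw Q T * (T.card : ℝ)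
          + r ^ 2 * ∑ T, pw Q T := by
          rw [Finset.mul_sum, Finset.mul_sum, ← Finset.sum_sub_distrib, ← Finset.sum_add_distrib]
          exact Finset.sum_congr rfl fun T _ => by ring
      _ = 0 := by
          rw [e1, e2, e3, hnorm]
          ring
  rw [Finset.sum_eq_zero_iff_of_nonneg
    fun T _ => mul_nonneg (pw_nonneg hQ T) (sq_nonneg _)] at hvar
  have := hvar S (Finset.mem_univ _)
  rcases mul_eq_zero.1 this with h | h
  · exact absurd h hS
  · exact sub_eq_zero.1 (pow_eq_zero_iff two_ne_zero |>.1 h)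

theorem isBalanced_pw {Q : Matrix ι ι 𝕜} (hQ : IsContr Q) (hQ2 : Q * Q = Q) {w : ι → ℝ}
    (hw : ∀ i, 0 < w i) : IsBalanced fun S => pw Q S * ∏ i ∈ S, w i where
  nonneg S := mul_nonneg (pw_nonneg hQ S) (Finset.prod_nonneg fun i _ => (hw i).le)
  homog := ⟨_, fun _ hS => card_eq_of_pw_ne_zero hQ hQ2 (left_ne_zero_of_mul hS)⟩
  negCorr := hereditaryNegCorr_pw hQ hw

/-- The weights `μ` restricted to the sets containing `A` and disjoint from `B`. -/
def condWeight (A B : Finset ι) (μ : Finset ι → ℝ) (S : Finset ι) : ℝ :=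
  if A ⊆ S ∧ Disjoint B S then μ S else 0

lemma IsBalanced.condWeight {μ : Finset ι → ℝ} (h : IsBalanced μ) (A B : Finset ι) :
    IsBalanced (condWeight A B μ) where
  nonneg S := by
    unfold Determinantal.condWeight
    split_ifs
    exacts [h.nonneg S, le_rfl]
  homog := by
    obtain ⟨r, hr⟩ := h.homog
    refine ⟨r, fun S hS => hr S fun h0 => hS ?_⟩
    simp [Determinantal.condWeight, h0]
  negCorr := by
    have hm : ∀ A' B', mass (Determinantal.condWeight A B μ) A' B' = mass μ (A' ∪ A) (B' ∪ B) := by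
      intro A' B'
      simp only [mass, Determinantal.condWeight, Finset.sum_filter]
      refine Finset.sum_congr rfl fun S _ => ?_
      rw [← ite_and]
      refine if_congr ?_ rfl rfl
      rw [Finset.union_subset_iff, Finset.disjoint_union_left]
      tauto
    intro A' B' e f hef
    simp only [hm, Finset.insert_union]
    exact h.negCorr _ _ e f hef

open scoped MatrixOrder in
lemma exists_hermitian_sqrt {Q : Matrix ι ι 𝕜} (hQ : Q.PosSemidef) :
    ∃ a : Matrix ι ι 𝕜, a.IsHermitian ∧ a * a = Q :=
  ⟨CFC.sqrt Q, (Matrix.nonneg_iff_posSemidef.1 (CFC.sqrt_nonneg Q)).isHermitian, CFC.sqrt_mul_sqrt_self Q hQ.nonneg⟩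

lemma isContr_of_projection {Q : Matrix ι ι 𝕜} (hQ : Q.IsHermitian) (hQ2 : Q * Q = Q) :
    IsContr Q where
  posSemidef := by
    have := Matrix.posSemidef_conjTranspose_mul_self Q
    rwa [hQ.eq, hQ2] at this
  one_sub := by
    have := Matrix.posSemidef_conjTranspose_mul_self (1 - Q)
    rwa [(Matrix.isHermitian_one.sub hQ).eq, mul_sub, sub_mul, sub_mul, hQ2, one_mul, one_mul,
      mul_one, sub_self, sub_zero] at this

/-- Every positive contraction is a compression of a projection. -/
lemma IsContr.exists_dilation {Q : Matrix ι ι 𝕜} (hQ : IsContr Q) :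
    ∃ R : Matrix (ι ⊕ ι) (ι ⊕ ι) 𝕜, IsContr R ∧ R * R = R ∧
      R.submatrix (Function.Embedding.inl : ι ↪ ι ⊕ ι) Function.Embedding.inl = Q := by
  obtain ⟨a, ha, haQ⟩ := exists_hermitian_sqrt hQ.posSemidef
  obtain ⟨b, hb, hbQ⟩ := exists_hermitian_sqrt hQ.one_sub
  have hab : a * a + b * b = 1 := by rw [haQ, hbQ]; abel
  have key : ∀ x y : Matrix ι ι 𝕜, x * a * (a * y) + x * b * (b * y) = x * y := fun x y => by
    calc x * a * (a * y) + x * b * (b * y) = x * (a * a + b * b) * y := by noncomm_ring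
      _ = x * y := by rw [hab, mul_one]
  -- This matrix is VV* for the block column V with entries `a` and `b`; V is an isometry because `a
  -- * a + b * b = 1`, whether or not `a` and `b` commute.
  have h2 : Matrix.fromBlocks (a * a) (a * b) (b * a) (b * b) *
      Matrix.fromBlocks (a * a) (a * b) (b * a) (b * b) =
      Matrix.fromBlocks (a * a) (a * b) (b * a) (b * b) := by
    rw [Matrix.fromBlocks_multiply, key, key, key, key]
  refine ⟨Matrix.fromBlocks (a * a) (a * b) (b * a) (b * b), isContr_of_projection ?_ h2, h2, ?_⟩
  · rw [Matrix.IsHermitian, Matrix.fromBlocks_conjTranspose]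
    simp only [Matrix.conjTranspose_mul, ha.eq, hb.eq]
  · rw [← haQ]
    ext i j
    simp

/-- Determinantal weights have conditional negative associations with external fields. -/
theorem negAssoc_pw {Q : Matrix ι ι 𝕜} (hQ : IsContr Q) {w : ι → ℝ} (hw : ∀ i, 0 < w i)
    (A B : Finset ι) {f g : Finset ι → ℝ} (hf : Monotone f) (hg : Monotone g) {K : Finset ι}
    (hfK : DepOn K f) (hgK : DepOn Kᶜ g) :
    wsum (condWeight A B fun S => pw Q S * ∏ i ∈ S, w i) (f * g) *
        wsum (condWeight A B fun S => pw Q S * ∏ i ∈ S, w i) 1 ≤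
      wsum (condWeight A B fun S => pw Q S * ∏ i ∈ S, w i) f *
        wsum (condWeight A B fun S => pw Q S * ∏ i ∈ S, w i) g := by
  obtain ⟨R, hR, hR2, rfl⟩ := hQ.exists_dilation
  set φ : ι ↪ ι ⊕ ι := Function.Embedding.inl with hφ
  -- The field is trivial on the auxiliary copy, so that weighting and passing to the marginal
  -- commute.
  set v : ι ⊕ ι → ℝ := Sum.elim w 1 with hv
  have hvpos : ∀ i, 0 < v i := by
    rintro (i | i)
    · exact hw i
    · exact one_pos
  have hbal := (isBalanced_pw hR hR2 hvpos).condWeight (A.map φ) (B.map φ)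
  have hsub : ∀ (C : Finset ι) (S : Finset (ι ⊕ ι)), C.map φ ⊆ S ↔ C ⊆ pullback φ S := by
    intro C S
    simp only [Finset.subset_iff, Finset.mem_map, mem_pullback]
    constructor
    · intro h x hx
      exact h ⟨x, hx, rfl⟩
    · rintro h _ ⟨x, hx, rfl⟩
      exact h hx
  have hdis : ∀ (C : Finset ι) (S : Finset (ι ⊕ ι)),
      Disjoint (C.map φ) S ↔ Disjoint C (pullback φ S) := by
    intro C S
    simp only [Finset.disjoint_left, Finset.mem_map, mem_pullback]
    constructor
    · intro h x hx
      exact h ⟨x, hx, rfl⟩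
    · rintro h _ ⟨x, hx, rfl⟩
      exact h hx
  have hprod : ∀ S : Finset (ι ⊕ ι), ∏ i ∈ S, v i = ∏ i ∈ pullback φ S, w i := by
    intro S
    have h1 : ∏ i ∈ S, v i = ∏ i, if i ∈ S then v i else 1 := by
      rw [Finset.prod_ite_mem, Finset.univ_inter]
    rw [h1, pullback, Finset.prod_filter, Fintype.prod_sum_type]
    simp [hv, hφ]
  have hw' : ∀ F : Finset ι → ℝ,
      wsum (condWeight (A.map φ) (B.map φ) fun S => pw R S * ∏ i ∈ S, v i)
        (fun S => F (pullback φ S)) =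
      wsum (condWeight A B fun S => pw (R.submatrix φ φ) S * ∏ i ∈ S, w i) F := by
    intro F
    have h1 := sum_pw_pullback R φ
      (fun T => (if A ⊆ T ∧ Disjoint B T then ∏ i ∈ T, w i else 0) * F T)
    simp only [wsum, condWeight, hsub, hdis, hprod]
    refine Eq.trans (Finset.sum_congr rfl fun S _ => ?_)
      (h1.trans (Finset.sum_congr rfl fun S _ => ?_)) <;> split_ifs <;> ring
  have hpm : Monotone (pullback φ) := fun S T hST k hk => mem_pullback.2 (hST (mem_pullback.1 hk))
  have hdep : ∀ (K : Finset ι) (F : Finset ι → ℝ), DepOn K F →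
      DepOn (K.map φ) fun S => F (pullback φ S) := by
    intro K F hF S T hST
    refine hF _ _ ?_
    ext k
    have := Finset.ext_iff.1 hST (φ k)
    simpa [mem_pullback] using this
  have hdep' : DepOn (K.map φ)ᶜ fun S => g (pullback φ S) := by
    intro S T hST
    refine hdep _ g hgK S T ?_
    ext x
    have hx := Finset.ext_iff.1 hST x
    simp only [Finset.mem_inter, Finset.mem_compl] at hx ⊢
    by_cases hxK : x ∈ Kᶜ.map φ
    · have : x ∉ K.map φ := by
        obtain ⟨k, hk, rfl⟩ := Finset.mem_map.1 hxK
        simpa using hk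
      simpa [this, hxK] using hx
    · simp [hxK]
  have := hbal.negAssoc (f := fun S => f (pullback φ S)) (g := fun S => g (pullback φ S))
    (hf.comp hpm) (hg.comp hpm) (hdep K f hfK) hdep'
  have e1 := hw' (f * g)
  have e2 := hw' 1
  have e3 := hw' f
  have e4 := hw' g
  rw [← e1, ← e2, ← e3, ← e4]
  exact this

end Marginals

/-! ### Stochastic monotonicity in the kernel, by adding one rank-one term at a time. -/

section Domination

open scoped ComplexOrder

variable {𝕜 : Type*} [RCLike 𝕜] {ι : Type*} [Fintype ι] [DecidableEq ι]

/-- A kernel on `ι ⊕ Unit` whose determinantal measure, conditioned on the extra point being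
present or absent, has kernel `Q` or `Q + v v*`, respectively. -/
def couplingKernel (Q : Matrix ι ι 𝕜) (v : ι → 𝕜) : Matrix (ι ⊕ Unit) (ι ⊕ Unit) 𝕜 :=
  Matrix.fromBlocks (Q + (1 / 2 : 𝕜) • Matrix.vecMulVec v (star v))
    (Matrix.of fun i _ => (1 / 2 : 𝕜) * v i) (Matrix.of fun _ j => (1 / 2 : 𝕜) * star (v j))
    (Matrix.of fun _ _ => (1 / 2 : 𝕜))

lemma posSemidef_fromBlocks_zero {Q : Matrix ι ι 𝕜} (hQ : Q.PosSemidef) :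
    (Matrix.fromBlocks Q 0 0 (0 : Matrix Unit Unit 𝕜)).PosSemidef := by
  have h := hQ.conjTranspose_mul_mul_same (Matrix.fromCols (1 : Matrix ι ι 𝕜) (0 : Matrix ι Unit 𝕜))
  convert h using 1
  rw [Matrix.conjTranspose_fromCols_eq_fromRows_conjTranspose, Matrix.fromRows_mul,
    Matrix.fromRows_mul_fromCols]
  simp

/-- Exhibits the coupling kernel as a sum of two positive terms; the vector (v, -1) plays the same
role for its complement. -/
lemma couplingKernel_eq (Q : Matrix ι ι 𝕜) (v : ι → 𝕜) :
    couplingKernel Q v = Matrix.fromBlocks Q 0 0 0 + (1 / 2 : 𝕜) •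
      Matrix.vecMulVec (Sum.elim v 1 : ι ⊕ Unit → 𝕜) (star (Sum.elim v 1)) := by
  ext (i | i) (j | j) <;> simp [couplingKernel, Matrix.vecMulVec_apply]

lemma one_sub_couplingKernel_eq (Q : Matrix ι ι 𝕜) (v : ι → 𝕜) :
    1 - couplingKernel Q v = Matrix.fromBlocks (1 - (Q + Matrix.vecMulVec v (star v))) 0 0 0 +
      (1 / 2 : 𝕜) • Matrix.vecMulVec (Sum.elim v (-1) : ι ⊕ Unit → 𝕜) (star (Sum.elim v (-1))) := by
  ext (i | i) (j | j)
  · simp [couplingKernel, Matrix.vecMulVec_apply, Matrix.one_apply]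
    ring
  · simp [couplingKernel, Matrix.vecMulVec_apply]
  · simp [couplingKernel, Matrix.vecMulVec_apply]
  · simp [couplingKernel, Matrix.vecMulVec_apply]
    norm_num

lemma isContr_couplingKernel {Q : Matrix ι ι 𝕜} {v : ι → 𝕜} (hQ : Q.PosSemidef)
    (hQv : (1 - (Q + Matrix.vecMulVec v (star v))).PosSemidef) :
    IsContr (couplingKernel Q v) where
  posSemidef := by
    rw [couplingKernel_eq]
    refine (posSemidef_fromBlocks_zero hQ).add
      ((Matrix.posSemidef_vecMulVec_self_star _).smul ?_)
    simp
  one_sub := by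
    rw [one_sub_couplingKernel_eq]
    refine (posSemidef_fromBlocks_zero hQv).add
      ((Matrix.posSemidef_vecMulVec_self_star _).smul ?_)
    simp

/-- Schur complement of the extra point. With that point in, it cancels the ½vv* of the coupling
kernel and leaves Q; with it out, the sign of `Z` flips and it adds another ½vv*. -/
lemma det_fromBlocks_half (X : Matrix ι ι 𝕜) (Y : Matrix ι Unit 𝕜) (Z : Matrix Unit ι 𝕜) :
    (Matrix.fromBlocks X Y ((1 / 2 : 𝕜) • Z) ((1 / 2 : 𝕜) • (1 : Matrix Unit Unit 𝕜))).det =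
      1 / 2 * (X - Y * Z).det := by
  have h : Matrix.fromBlocks X Y ((1 / 2 : 𝕜) • Z) ((1 / 2 : 𝕜) • (1 : Matrix Unit Unit 𝕜)) =
      Matrix.fromBlocks 1 0 0 ((1 / 2 : 𝕜) • (1 : Matrix Unit Unit 𝕜)) *
        Matrix.fromBlocks X Y Z 1 := by
    rw [Matrix.fromBlocks_multiply]
    simp
  rw [h, Matrix.det_mul, Matrix.det_fromBlocks_zero₁₂, Matrix.det_fromBlocks_one₂₂]
  simp

lemma rowDet_couplingKernel_in (Q : Matrix ι ι 𝕜) (v : ι → 𝕜) (S : Finset ι) :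
    rowDet (couplingKernel Q v) (1 - couplingKernel Q v) (S.disjSum Finset.univ) =
      1 / 2 * rowDet Q (1 - Q) S := by
  rw [rowDet, rowDet]
  have h := det_fromBlocks_half (𝕜 := 𝕜)
    (Matrix.of fun i => if i ∈ S then (Q + (1 / 2 : 𝕜) • Matrix.vecMulVec v (star v)) i else
      (1 - (Q + (1 / 2 : 𝕜) • Matrix.vecMulVec v (star v))) i)
    (Matrix.of fun i _ => if i ∈ S then (1 / 2 : 𝕜) * v i else -((1 / 2 : 𝕜) * v i))
    (Matrix.of fun _ j => star (v j))
  convert h using 2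
  · ext (i | i) (j | j) <;> simp [couplingKernel, Finset.inl_mem_disjSum, Finset.inr_mem_disjSum]
    · split_ifs <;> simp [Matrix.one_apply]
    · split_ifs <;> simp
  · congr 1
    ext i j
    by_cases hi : i ∈ S <;>
      simp [hi, Matrix.mul_apply, Matrix.vecMulVec_apply] <;> ring

lemma rowDet_couplingKernel_out (Q : Matrix ι ι 𝕜) (v : ι → 𝕜) (S : Finset ι) :
    rowDet (couplingKernel Q v) (1 - couplingKernel Q v) (S.disjSum ∅) =
      1 / 2 * rowDet (Q + Matrix.vecMulVec v (star v)) (1 - (Q + Matrix.vecMulVec v (star v))) S := by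
  rw [rowDet, rowDet]
  have h := det_fromBlocks_half (𝕜 := 𝕜)
    (Matrix.of fun i => if i ∈ S then (Q + (1 / 2 : 𝕜) • Matrix.vecMulVec v (star v)) i else
      (1 - (Q + (1 / 2 : 𝕜) • Matrix.vecMulVec v (star v))) i)
    (Matrix.of fun i _ => if i ∈ S then (1 / 2 : 𝕜) * v i else -((1 / 2 : 𝕜) * v i))
    (Matrix.of fun _ j => -star (v j))
  convert h using 2
  · ext (i | i) (j | j) <;> simp [couplingKernel]
    · split_ifs <;> simp [Matrix.one_apply]
    · split_ifs <;> simp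
    · norm_num
  · congr 1
    ext i j
    by_cases hi : i ∈ S <;>
      simp [hi, Matrix.mul_apply, Matrix.vecMulVec_apply] <;> ring

lemma sum_finset_sum_unit (F : Finset (ι ⊕ Unit) → ℝ) :
    ∑ S, F S = ∑ T : Finset ι, F (T.disjSum Finset.univ) + ∑ T : Finset ι, F (T.disjSum ∅) := by
  rw [← Equiv.sum_comp (Finset.sumEquiv (α := ι) (β := Unit)).symm.toEquiv, Fintype.sum_prod_type,
    ← Finset.sum_add_distrib]
  refine Finset.sum_congr rfl fun T _ => ?_
  have : (Finset.univ : Finset (Finset Unit)) = {Finset.univ, ∅} := by decide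
  rw [this, Finset.sum_pair (by decide)]
  rfl

/-- The extra point is present with probability ½, and its presence is negatively correlated with
increasing functions of the other points. The mean of `f` given presence (kernel Q) is thus at most
the average of its means given presence and given absence (kernel Q + vv*). -/
lemma wsum_pw_le_add_vecMulVec {Q : Matrix ι ι 𝕜} {v : ι → 𝕜} (hQ : Q.PosSemidef)
    (hQv : (1 - (Q + Matrix.vecMulVec v (star v))).PosSemidef) {f : Finset ι → ℝ}
    (hf : Monotone f) : wsum (pw Q) f ≤ wsum (pw (Q + Matrix.vecMulVec v (star v))) f := by
  set R := couplingKernel Q v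
  have hin : ∀ S : Finset ι, pw R (S.disjSum Finset.univ) = 1 / 2 * pw Q S := fun S => by
    rw [pw, rowDet_couplingKernel_in, pw]
    have : (1 / 2 : 𝕜) = ((1 / 2 : ℝ) : 𝕜) := by push_cast; rfl
    rw [this, RCLike.re_ofReal_mul]
  have hout : ∀ S : Finset ι,
      pw R (S.disjSum ∅) = 1 / 2 * pw (Q + Matrix.vecMulVec v (star v)) S := fun S => by
    rw [pw, rowDet_couplingKernel_out, pw]
    have : (1 / 2 : 𝕜) = ((1 / 2 : ℝ) : 𝕜) := by push_cast; rfl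
    rw [this, RCLike.re_ofReal_mul]
  have hpm : Monotone (pullback (Function.Embedding.inl : ι ↪ ι ⊕ Unit)) :=
    fun S T hST k hk => mem_pullback.2 (hST (mem_pullback.1 hk))
  have hpull : ∀ (T : Finset ι) (U : Finset Unit),
      pullback (Function.Embedding.inl : ι ↪ ι ⊕ Unit) (T.disjSum U) = T := fun T U => by
    ext k
    simp [mem_pullback]
  set F : Finset (ι ⊕ Unit) → ℝ := fun S => f (pullback Function.Embedding.inl S) with hF
  set G : Finset (ι ⊕ Unit) → ℝ := fun S => if Sum.inr () ∈ S then 1 else 0 with hG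
  have hGm : Monotone G := by
    intro S T hST
    simp only [hG]
    split_ifs with h1 h2
    · exact le_rfl
    · exact absurd (hST h1) h2
    · exact zero_le_one
    · exact le_rfl
  have h := negAssoc_pw (isContr_couplingKernel hQ hQv) (w := 1) (fun _ => one_pos) ∅ ∅
    (f := F) (g := G) (hf.comp hpm) hGm (K := Finset.univ.map Function.Embedding.inl) (by
      intro S T hST
      have : pullback (Function.Embedding.inl : ι ↪ ι ⊕ Unit) S =
          pullback Function.Embedding.inl T := by
        ext k
        have := Finset.ext_iff.1 hST (Sum.inl k)
        simpa [mem_pullback] using this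
      simp only [hF, this]) (by
      intro S T hST
      have := Finset.ext_iff.1 hST (Sum.inr ())
      simp only [Finset.mem_inter, Finset.mem_compl, Finset.mem_map, Finset.mem_univ, true_and,
        Function.Embedding.inl_apply, reduceCtorEq, exists_false, not_false_eq_true,
        and_true] at this
      simp only [hG, this])
  have hc : (condWeight ∅ ∅ fun S => pw R S * ∏ i ∈ S, (1 : ι ⊕ Unit → ℝ) i) = pw R := by
    funext S
    simp [condWeight]
  rw [hc, wsum_pw_one, mul_one] at h
  have e1 : wsum (pw R) (F * G) = 1 / 2 * wsum (pw Q) f := by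
    simp only [wsum, sum_finset_sum_unit, hF, hG, Pi.mul_apply, hin, hout, hpull,
      Finset.inr_mem_disjSum, Finset.mem_univ, Finset.notMem_empty, if_true, if_false, mul_one,
      mul_zero, Finset.sum_const_zero, add_zero, Finset.mul_sum, mul_assoc]
  have e2 : wsum (pw R) F =
      1 / 2 * wsum (pw Q) f + 1 / 2 * wsum (pw (Q + Matrix.vecMulVec v (star v))) f := by
    simp only [wsum, sum_finset_sum_unit, hF, hin, hout, hpull, Finset.mul_sum, mul_assoc]
  have e3 : wsum (pw R) G = 1 / 2 := by
    have := wsum_pw_one Q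
    simp only [wsum, Pi.one_apply, mul_one] at this
    simp only [wsum, sum_finset_sum_unit, hG, hin, Finset.inr_mem_disjSum, Finset.mem_univ,
      Finset.notMem_empty, if_true, if_false, mul_one, mul_zero, Finset.sum_const_zero, add_zero,
      ← Finset.mul_sum, this]
  rw [e1, e2, e3] at h
  linarith

/-- Determinantal weights are stochastically increasing in the kernel. -/
theorem wsum_pw_mono {Q₁ Q₂ : Matrix ι ι 𝕜} (h₁ : IsContr Q₁) (h₂ : IsContr Q₂)
    (h : (Q₂ - Q₁).PosSemidef) {f : Finset ι → ℝ} (hf : Monotone f) :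
    wsum (pw Q₁) f ≤ wsum (pw Q₂) f := by
  obtain ⟨b, hb, hbQ⟩ := exists_hermitian_sqrt h
  have hsum : ∑ k, Matrix.vecMulVec (star (b k)) (star (star (b k))) = Q₂ - Q₁ := by
    rw [← hbQ]
    ext i j
    rw [Matrix.sum_apply, Matrix.mul_apply]
    refine Finset.sum_congr rfl fun k _ => ?_
    rw [Matrix.vecMulVec_apply, star_star, Pi.star_apply, hb.apply]
  have key : ∀ s : Finset ι, wsum (pw Q₁) f ≤
      wsum (pw (Q₁ + ∑ k ∈ s, Matrix.vecMulVec (star (b k)) (star (star (b k))))) f := by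
    intro s
    induction s using Finset.induction_on with
    | empty => simp
    | insert a s ha ih =>
      refine ih.trans ?_
      rw [Finset.sum_insert ha, add_comm (Matrix.vecMulVec _ _), ← add_assoc]
      refine wsum_pw_le_add_vecMulVec ?_ ?_ hf
      · exact h₁.posSemidef.add
          (Matrix.posSemidef_sum _ fun k _ => Matrix.posSemidef_vecMulVec_self_star _)
      -- Each intermediate kernel falls short of `Q₂` by the rank-one terms not yet added, and so
      -- remains a contraction.
      · have e : 1 - (Q₁ + ∑ k ∈ s, Matrix.vecMulVec (star (b k)) (star (star (b k))) +
            Matrix.vecMulVec (star (b a)) (star (star (b a)))) = (1 - Q₂) +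
            ∑ k ∈ (insert a s)ᶜ, Matrix.vecMulVec (star (b k)) (star (star (b k))) := by
          have h3 := Finset.sum_add_sum_compl (insert a s)
            fun k => Matrix.vecMulVec (star (b k)) (star (star (b k)))
          rw [hsum, Finset.sum_insert ha] at h3
          have h4 : Q₂ = Q₁ + (Q₂ - Q₁) := by abel
          rw [h4, ← h3]
          abel
        rw [e]
        exact h₂.one_sub.add
          (Matrix.posSemidef_sum _ fun k _ => Matrix.posSemidef_vecMulVec_self_star _)
  have := key Finset.univ
  rwa [hsum, add_sub_cancel] at this

end Domination

/-! ### Finite compressions of an operator on ℓ²(E). -/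

section Kernel

open scoped ComplexOrder Classical

variable {𝕜 : Type*} [RCLike 𝕜] {E : Type*}

/-- The matrix of `Q` restricted to `C`. -/
def kernelMat (Q : L2 𝕜 E →L[𝕜] L2 𝕜 E) (C : Finset E) : Matrix C C 𝕜 :=
  Matrix.of fun e f => entry Q e f

lemma basisVec_apply (e f : E) : (basisVec e : L2 𝕜 E) f = if f = e then 1 else 0 := by
  rw [basisVec, lp.single_apply, Pi.single_apply]

lemma inner_basisVec (e : E) (u : L2 𝕜 E) : inner 𝕜 (basisVec e) u = u e := by
  rw [basisVec, lp.inner_single_left]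
  simp

lemma entry_eq (Q : L2 𝕜 E →L[𝕜] L2 𝕜 E) (e f : E) : entry Q e f = Q (basisVec f) e :=
  inner_basisVec _ _

lemma isHermitian_kernelMat {Q : L2 𝕜 E →L[𝕜] L2 𝕜 E} (hQ : IsSelfAdjoint Q) (C : Finset E) :
    (kernelMat Q C).IsHermitian := by
  ext e f
  simp only [Matrix.conjTranspose_apply, kernelMat, Matrix.of_apply, entry, RCLike.star_def,
    inner_conj_symm]
  exact hQ.isSymmetric _ _

lemma posSemidef_kernelMat {Q : L2 𝕜 E →L[𝕜] L2 𝕜 E} (hQ : IsSelfAdjoint Q)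
    (h : ∀ u, 0 ≤ RCLike.re (inner 𝕜 (Q u) u)) (C : Finset E) : (kernelMat Q C).PosSemidef := by
  refine Matrix.PosSemidef.of_dotProduct_mulVec_nonneg (isHermitian_kernelMat hQ C) fun x => ?_
  set u : L2 𝕜 E := ∑ e : C, x e • basisVec (e : E) with hu
  have h1 : star x ⬝ᵥ (kernelMat Q C).mulVec x = inner 𝕜 u (Q u) := by
    rw [hu, map_sum, sum_inner]
    simp only [dotProduct, Matrix.mulVec, Pi.star_apply, RCLike.star_def, inner_smul_left,
      inner_sum, map_smul, inner_smul_right, kernelMat, Matrix.of_apply, entry]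
    refine Finset.sum_congr rfl fun e _ => ?_
    rw [Finset.mul_sum]
    exact Finset.sum_congr rfl fun f _ => by ring
  have hs : inner 𝕜 (Q u) u = inner 𝕜 u (Q u) := hQ.isSymmetric u u
  rw [h1, RCLike.nonneg_iff, ← hs]
  refine ⟨h u, ?_⟩
  have h2 := inner_conj_symm (𝕜 := 𝕜) u (Q u)
  rw [hs] at h2
  rw [hs]
  exact RCLike.conj_eq_iff_im.1 h2

lemma kernelMat_sub (Q R : L2 𝕜 E →L[𝕜] L2 𝕜 E) (C : Finset E) :
    kernelMat (R - Q) C = kernelMat R C - kernelMat Q C := by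
  ext e f
  simp [kernelMat, entry, inner_sub_right]

lemma kernelMat_one (C : Finset E) : kernelMat (1 : L2 𝕜 E →L[𝕜] L2 𝕜 E) C = 1 := by
  ext e f
  rw [kernelMat, Matrix.of_apply, entry_eq, one_apply_eq_self, basisVec_apply, Matrix.one_apply]
  simp only [Subtype.ext_iff]

lemma IsPositiveContraction.isContr {Q : L2 𝕜 E →L[𝕜] L2 𝕜 E} (hQ : IsPositiveContraction Q)
    (C : Finset E) : IsContr (kernelMat Q C) where
  posSemidef := posSemidef_kernelMat hQ.isSelfAdjoint hQ.nonneg C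
  one_sub := by
    have := posSemidef_kernelMat (Q := 1 - Q) ((IsSelfAdjoint.one _).sub hQ.isSelfAdjoint)
      (fun u => by
        have := hQ.le_one u
        simp only [sub_apply, one_apply_eq_self, inner_sub_left,
          map_sub]
        linarith) C
    rwa [kernelMat_sub, kernelMat_one] at this

lemma minor_map (Q : L2 𝕜 E →L[𝕜] L2 𝕜 E) {C : Finset E} (A : Finset C) :
    minor Q (A.map (Function.Embedding.subtype _)) =
      ((kernelMat Q C).submatrix (Subtype.val : A → C) Subtype.val).det := by
  let φ : A ≃ (A.map (Function.Embedding.subtype (· ∈ C)) : Finset E) :=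
    Equiv.ofBijective (fun a => ⟨a.1.1, Finset.mem_map_of_mem _ a.2⟩) (by
      constructor
      · intro a b h
        have h' := Subtype.ext_iff.1 h
        exact Subtype.ext (Subtype.ext h')
      · rintro ⟨x, hx⟩
        obtain ⟨a, ha, rfl⟩ := Finset.mem_map.1 hx
        exact ⟨⟨a, ha⟩, rfl⟩)
  rw [minor, ← Matrix.det_submatrix_equiv_self φ]
  rfl

end Kernel

/-! ### Traces of a random set on finite sets, and the finite-dimensional distributions. -/

section Trace

open scoped Classical

variable {E : Type*}

/-- The trace of a subset of `E` on a finite set `C`. -/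
def tr (C : Finset E) (S : Set E) : Finset C := Finset.univ.filter fun c => (c : E) ∈ S

lemma mem_tr {C : Finset E} {S : Set E} {c : C} : c ∈ tr C S ↔ (c : E) ∈ S := by simp [tr]

lemma tr_mono (C : Finset E) : Monotone (tr C) := fun _ _ h _ hc => mem_tr.2 (h (mem_tr.1 hc))

lemma measurableSet_preimage_tr_of {m : MeasurableSpace (Set E)} {C : Finset E}
    (h : ∀ e ∈ C, MeasurableSet[m] {S : Set E | e ∈ S}) (X : Set (Finset C)) :
    MeasurableSet[m] (tr C ⁻¹' X) := by
  have h1 : ∀ T, MeasurableSet[m] {S : Set E | tr C S = T} := fun T => by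
    have : {S : Set E | tr C S = T} = ⋂ c : C, {S : Set E | (c : E) ∈ S ↔ c ∈ T} := by
      ext S
      simp only [Set.mem_ofPred_eq, Finset.ext_iff, mem_tr, Set.mem_iInter]
    rw [this]
    refine MeasurableSet.iInter fun c => ?_
    by_cases hc : c ∈ T
    · simp only [hc, iff_true]
      exact h c c.2
    · simp only [hc, iff_false]
      exact (h c c.2).compl
  have h2 : tr C ⁻¹' X = ⋃ T ∈ X, {S : Set E | tr C S = T} := by
    ext S
    simp
  rw [h2]
  exact MeasurableSet.biUnion (Set.to_countable X) fun T _ => h1 T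

lemma measurableSet_preimage_tr (C : Finset E) (X : Set (Finset C)) :
    MeasurableSet (tr C ⁻¹' X) :=
  measurableSet_preimage_tr_of (fun e _ => measurableSet_mem e) X

lemma integral_tr (P : Measure (Set E)) [IsFiniteMeasure P] (C : Finset E) (F : Finset C → ℝ) :
    ∫ S, F (tr C S) ∂P = wsum (fun T => P.real {S | tr C S = T}) F := by
  have h : ∀ S, F (tr C S) = ∑ T, ({S | tr C S = T} : Set (Set E)).indicator (fun _ => F T) S := by
    intro S
    rw [Finset.sum_eq_single (tr C S)]
    · simp
    · intro T _ hT
      exact Set.indicator_of_notMem (fun h => hT h.symm) _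
    · simp
  simp only [h]
  have hm : ∀ T, MeasurableSet {S : Set E | tr C S = T} := fun T =>
    measurableSet_preimage_tr C {T}
  rw [integral_finsetSum]
  · refine Finset.sum_congr rfl fun T _ => ?_
    rw [integral_indicator_const _ (hm T), smul_eq_mul]
  · intro T _
    exact (integrable_const _).indicator (hm T)

lemma integrable_tr (P : Measure (Set E)) [IsFiniteMeasure P] (C : Finset E) (F : Finset C → ℝ) :
    Integrable (fun S => F (tr C S)) P := by
  have hm : Measurable fun S => F (tr C S) := fun X _ =>
    measurableSet_preimage_tr C (F ⁻¹' X)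
  refine Integrable.of_bound hm.aestronglyMeasurable (∑ T, ‖F T‖) (Filter.Eventually.of_forall
    fun S => ?_)
  exact Finset.single_le_sum (f := fun T => ‖F T‖) (fun T _ => norm_nonneg _) (Finset.mem_univ _)

lemma real_tr (P : Measure (Set E)) [IsFiniteMeasure P] (C : Finset E) (X : Finset C → Prop)
    [DecidablePred X] : P.real {S | X (tr C S)} = ∑ T with X T, P.real {S | tr C S = T} := by
  have h := integral_tr P C fun T => if X T then 1 else 0
  have h2 : ∫ S, (if X (tr C S) then (1 : ℝ) else 0) ∂P = P.real {S | X (tr C S)} := by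
    refine Eq.trans ?_ (integral_indicator_one (measurableSet_preimage_tr C {T | X T}))
    refine integral_congr_ae (Filter.Eventually.of_forall fun S => ?_)
    by_cases hS : X (tr C S) <;> simp [Set.indicator, hS]
  rw [← h2, h, wsum, Finset.sum_filter]
  simp

/-- Inclusion–exclusion in recursive form: the weight of a set is its upward mass minus the weights
of its strict supersets, which are already known by induction on the size of the complement. -/
lemma weights_eq_of_mass_eq {α : Type*} [Fintype α] [DecidableEq α] {μ ν : Finset α → ℝ}
    (h : ∀ A, mass μ A ∅ = mass ν A ∅) : μ = ν := by
  funext A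
  induction hn : Aᶜ.card using Nat.strong_induction_on generalizing A with
  | _ n ih =>
  subst hn
  have hs : ∀ ρ : Finset α → ℝ, mass ρ A ∅ = ρ A + ∑ S with A ⊂ S, ρ S := by
    intro ρ
    have : (Finset.univ.filter fun S => A ⊆ S ∧ Disjoint ∅ S) =
        insert A (Finset.univ.filter fun S => A ⊂ S) := by
      ext S
      simp only [Finset.disjoint_empty_left, and_true, Finset.mem_filter, Finset.mem_univ, true_and,
        Finset.mem_insert]
      constructor
      · intro hS
        rcases eq_or_ssubset_of_subset hS with h | h
        · exact Or.inl h.symm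
        · exact Or.inr h
      · rintro (rfl | h)
        · exact subset_rfl
        · exact h.subset
    rw [mass, this, Finset.sum_insert (by simp)]
  have hA := h A
  rw [hs, hs] at hA
  have h2 : ∑ S with A ⊂ S, μ S = ∑ S with A ⊂ S, ν S := by
    refine Finset.sum_congr rfl fun S hS => ?_
    refine ih _ (Finset.card_lt_card ?_) S rfl
    exact Finset.compl_ssubset_compl.2 (Finset.mem_filter.1 hS).2
  linarith

lemma subset_tr_iff {C : Finset E} {A : Finset C} {S : Set E} :
    A ⊆ tr C S ↔ ((A.map (Function.Embedding.subtype _) : Finset E) : Set E) ⊆ S := by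
  simp only [Finset.subset_iff, mem_tr, Set.subset_def, Finset.mem_coe, Finset.mem_map]
  constructor
  · rintro h _ ⟨c, hc, rfl⟩
    exact h hc
  · intro h c hc
    exact h c ⟨c, hc, rfl⟩

variable {𝕜 : Type*} [RCLike 𝕜]

/-- The finite-dimensional distributions of a determinantal measure. -/
theorem IsDeterminantal.real_tr_eq {Q : L2 𝕜 E →L[𝕜] L2 𝕜 E} {P : Measure (Set E)}
    (hP : IsDeterminantal Q P) (C : Finset E) :
    (fun T => P.real {S | tr C S = T}) = pw (kernelMat Q C) := by
  have := hP.isProbabilityMeasure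
  refine weights_eq_of_mass_eq fun A => ?_
  rw [mass_pw_empty_right, ← minor_map, ← hP.prob_subset, RCLike.ofReal_re, mass]
  simp only [Finset.disjoint_empty_left, and_true, ← subset_tr_iff]
  exact (real_tr P C fun T => A ⊆ T).symm

theorem IsDeterminantal.integral_tr_eq {Q : L2 𝕜 E →L[𝕜] L2 𝕜 E} {P : Measure (Set E)}
    (hP : IsDeterminantal Q P) (C : Finset E) (F : Finset C → ℝ) :
    ∫ S, F (tr C S) ∂P = wsum (pw (kernelMat Q C)) F := by
  have := hP.isProbabilityMeasure
  rw [integral_tr, hP.real_tr_eq]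

end Trace

/-! ### Existence and uniqueness of the determinantal measure. -/

section Existence

open scoped Classical

variable {𝕜 : Type*} [RCLike 𝕜] {E : Type*}

lemma measurableSpace_eq_generateFrom :
    (Set.instMeasurableSpace : MeasurableSpace (Set E)) =
      MeasurableSpace.generateFrom {𝒜 | ∃ A : Finset E, 𝒜 = {S : Set E | (A : Set E) ⊆ S}} := by
  apply le_antisymm
  · refine iSup_le fun e => ?_
    refine Measurable.comap_le ?_
    refine measurable_to_prop (MeasurableSpace.measurableSet_generateFrom ⟨{e}, ?_⟩)
    ext S
    simp only [Set.mem_preimage, Set.mem_singleton_iff, eq_iff_iff, iff_true, Finset.coe_singleton,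
      Set.singleton_subset_iff]
    rfl
  · refine MeasurableSpace.generateFrom_le ?_
    rintro _ ⟨A, rfl⟩
    have : {S : Set E | (A : Set E) ⊆ S} = ⋂ e ∈ A, {S : Set E | e ∈ S} := by
      ext S
      simp [Set.subset_def]
    rw [this]
    exact Finset.measurableSet_biInter A fun e _ => measurableSet_mem e

theorem IsDeterminantal.unique {Q : L2 𝕜 E →L[𝕜] L2 𝕜 E} {P P' : Measure (Set E)}
    (hP : IsDeterminantal Q P) (hP' : IsDeterminantal Q P') : P = P' := by
  have := hP.isProbabilityMeasure
  have := hP'.isProbabilityMeasure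
  refine ext_of_generate_finite _ measurableSpace_eq_generateFrom ?_ ?_ (by simp)
  · rintro _ ⟨A, rfl⟩ _ ⟨B, rfl⟩ -
    refine ⟨A ∪ B, ?_⟩
    ext S
    simp
  · rintro _ ⟨A, rfl⟩
    have h : ((P.real {S : Set E | (A : Set E) ⊆ S} : ℝ) : 𝕜) =
        (P'.real {S : Set E | (A : Set E) ⊆ S} : ℝ) := by
      rw [hP.prob_subset, hP'.prob_subset]
    have h' := RCLike.ofReal_injective h
    exact (measureReal_eq_measureReal_iff).1 h'

/-- The set `T ⊆ C` as a configuration on `E`. -/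
def toConfig {C : Finset E} (T : Finset C) (e : E) : Bool := decide (∃ h : e ∈ C, ⟨e, h⟩ ∈ T)

/-- The determinantal measure of the restriction of `Q` to `C`, as a measure on configurations. -/
def finiteLaw (Q : L2 𝕜 E →L[𝕜] L2 𝕜 E) (C : Finset E) : Measure (E → Bool) :=
  ∑ T, ENNReal.ofReal (pw (kernelMat Q C) T) • Measure.dirac (toConfig T)

lemma isProbabilityMeasure_finiteLaw {Q : L2 𝕜 E →L[𝕜] L2 𝕜 E} (hQ : IsPositiveContraction Q)
    (C : Finset E) : IsProbabilityMeasure (finiteLaw Q C) := by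
  constructor
  have h := wsum_pw_one (kernelMat Q C)
  simp only [wsum, Pi.one_apply, mul_one] at h
  simp only [finiteLaw, Measure.coe_finsetSum, Finset.sum_apply, Measure.smul_apply,
    measure_univ, smul_eq_mul, mul_one]
  rw [← ENNReal.ofReal_sum_of_nonneg fun T _ => pw_nonneg (hQ.isContr C) T, h, ENNReal.ofReal_one]

lemma finiteLaw_real {Q : L2 𝕜 E →L[𝕜] L2 𝕜 E} (hQ : IsPositiveContraction Q) {C : Finset E}
    (A : Finset C) :
    finiteLaw Q C {x | ∀ e ∈ A, x (e : E) = true} =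
      ENNReal.ofReal (RCLike.re (minor Q (A.map (Function.Embedding.subtype _)))) := by
  rw [minor_map, ← mass_pw_empty_right, mass, Finset.sum_filter,
    ENNReal.ofReal_sum_of_nonneg fun T _ => by
      split_ifs
      exacts [pw_nonneg (hQ.isContr C) T, le_rfl]]
  simp only [finiteLaw, Measure.coe_finsetSum, Finset.sum_apply, Measure.smul_apply, smul_eq_mul]
  refine Finset.sum_congr rfl fun T _ => ?_
  have hm : MeasurableSet {x : E → Bool | ∀ e ∈ A, x (e : E) = true} := by
    have : {x : E → Bool | ∀ e ∈ A, x (e : E) = true} =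
        ⋂ e ∈ A, (fun x : E → Bool => x (e : E)) ⁻¹' {true} := by
      ext x
      simp
    rw [this]
    exact Finset.measurableSet_biInter A fun e _ => measurable_pi_apply _ (measurableSet_singleton _)
  rw [Measure.dirac_apply' _ hm]
  have hiff : toConfig T ∈ {x : E → Bool | ∀ e ∈ A, x (e : E) = true} ↔ A ⊆ T ∧ Disjoint ∅ T := by
    simp only [toConfig, Set.mem_ofPred_eq, decide_eq_true_eq, Finset.disjoint_empty_left, and_true]
    constructor
    · intro h a ha
      exact (h a ha).2
    · intro h a ha
      exact ⟨a.2, h ha⟩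
  by_cases h : A ⊆ T ∧ Disjoint ∅ T
  · rw [Set.indicator_of_mem (hiff.2 h), if_pos h]
    simp
  · rw [Set.indicator_of_notMem (fun h' => h (hiff.1 h')), if_neg h]
    simp

theorem exists_isDeterminantal [Countable E] {Q : L2 𝕜 E →L[𝕜] L2 𝕜 E}
    (hQ : IsPositiveContraction Q) : ∃ P : Measure (Set E), IsDeterminantal Q P := by
  let ρ : Finset E → ProbabilityMeasure (E → Bool) := fun C =>
    ⟨finiteLaw Q C, isProbabilityMeasure_finiteLaw hQ C⟩
  -- Compactness of the space of probability measures provides a limit along an ultrafilter finer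
  -- than `atTop`. Each event `A ⊆ S` is clopen and has the prescribed probability as soon as C
  -- contains `A`, so the limit inherits it.
  let U : Ultrafilter (Finset E) := Ultrafilter.of Filter.atTop
  obtain ⟨μ, hμ⟩ : ∃ μ, Filter.Tendsto ρ U (nhds μ) :=
    ⟨(U.map ρ).lim, (U.map ρ).le_nhds_lim⟩
  have hset : Measurable fun x : E → Bool => {e | x e = true} := by
    rw [measurable_set_iff]
    intro e
    have h : MeasurableSet ((fun x : E → Bool => x e) ⁻¹' {true}) :=
      measurable_pi_apply e (measurableSet_singleton true)
    exact measurable_to_prop (by simpa [Set.preimage] using h)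
  have hprob : IsProbabilityMeasure ((μ : Measure (E → Bool)).map fun x => {e | x e = true}) :=
    Measure.isProbabilityMeasure_map hset.aemeasurable
  refine ⟨(μ : Measure (E → Bool)).map fun x => {e | x e = true}, hprob, fun A => ?_⟩
  have hclopen : IsClopen {x : E → Bool | ∀ e ∈ A, x e = true} := by
    have : {x : E → Bool | ∀ e ∈ A, x e = true} =
        ⋂ e ∈ A, (fun x : E → Bool => x e) ⁻¹' {true} := by
      ext x
      simp
    rw [this]
    exact isClopen_biInter_finset fun e _ => (isClopen_discrete {true}).preimage (continuous_apply e)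
  have hlim := ProbabilityMeasure.tendsto_measure_of_null_frontier_of_tendsto' hμ
    (E := {x : E → Bool | ∀ e ∈ A, x e = true}) (by simp [hclopen.frontier_eq])
  have hev : ∀ᶠ C in (U : Filter (Finset E)),
      (ρ C : Measure (E → Bool)) {x : E → Bool | ∀ e ∈ A, x e = true} =
        ENNReal.ofReal (RCLike.re (minor Q A)) := by
    have : ∀ᶠ C in (U : Filter (Finset E)), A ⊆ C :=
      Filter.Eventually.filter_mono (Ultrafilter.of_le _) (Filter.eventually_ge_atTop A)
    filter_upwards [this] with C hC
    have h := finiteLaw_real hQ (A.subtype (· ∈ C))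
    rw [Finset.subtype_map_of_mem fun x hx => hC hx] at h
    rw [← h]
    change finiteLaw Q C _ = _
    congr 1
    ext x
    simp only [Set.mem_ofPred_eq, Finset.mem_subtype, Subtype.forall]
    exact ⟨fun h a _ ha => h a ha, fun h a ha => h a (hC ha) ha⟩
  have heq := tendsto_nhds_unique hlim ((Filter.tendsto_congr' hev).2 tendsto_const_nhds)
  have hnn : 0 ≤ RCLike.re (minor Q A) := by
    have h := mass_pw_empty_right (kernelMat Q A) Finset.univ
    rw [← minor_map] at h
    have h2 : (Finset.univ : Finset A).map (Function.Embedding.subtype _) = A := by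
      ext x
      simp
    rw [h2] at h
    rw [← h]
    exact mass_nonneg (pw_nonneg (hQ.isContr A)) _ _
  have hre : minor Q A = (RCLike.re (minor Q A) : 𝕜) := by
    have := (isHermitian_kernelMat hQ.isSelfAdjoint A).det_eq_prod_eigenvalues
    have h2 : minor Q A = (kernelMat Q A).det := rfl
    rw [h2, this, ← RCLike.ofReal_prod, RCLike.ofReal_re]
  have hmeas : MeasurableSet {S : Set E | (A : Set E) ⊆ S} := by
    rw [measurableSpace_eq_generateFrom]
    exact MeasurableSpace.measurableSet_generateFrom ⟨A, rfl⟩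
  rw [hre, Measure.real, Measure.map_apply hset hmeas]
  have hpre : (fun x : E → Bool => {e | x e = true}) ⁻¹' {S : Set E | (A : Set E) ⊆ S} =
      {x : E → Bool | ∀ e ∈ A, x e = true} := by
    ext x
    simp [Set.subset_def]
  rw [hpre, heq, ENNReal.toReal_ofReal hnn]

end Existence

/-! ### From increasing cylinder events to all increasing events. -/

section Approximation

open scoped Classical

variable {E : Type*}

/-- The membership of `S` in `𝒰` depends on `S ∩ D` only. -/
def IsCylinder (D : Set E) (𝒰 : Set (Set E)) : Prop := ∀ S, S ∩ D ∈ 𝒰 ↔ S ∈ 𝒰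

lemma sigmaField_le (K : Set E) : sigmaField K ≤ Set.instMeasurableSpace := by
  refine MeasurableSpace.generateFrom_le ?_
  rintro _ ⟨e, -, rfl⟩
  exact measurableSet_mem e

lemma sigmaField_univ : sigmaField (Set.univ : Set E) = Set.instMeasurableSpace := by
  refine le_antisymm (sigmaField_le _) ?_
  refine iSup_le fun e => Measurable.comap_le ?_
  refine measurable_to_prop (MeasurableSpace.measurableSet_generateFrom ⟨e, Set.mem_univ _, ?_⟩)
  ext S
  simp only [Set.mem_preimage, Set.mem_singleton_iff, eq_iff_iff, iff_true]
  rfl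

lemma isCylinder_of_measurableSet {K : Set E} {𝒜 : Set (Set E)}
    (h : MeasurableSet[sigmaField K] 𝒜) : IsCylinder K 𝒜 := by
  have hle : sigmaField K ≤ MeasurableSpace.comap (fun S : Set E => S ∩ K) ⊤ := by
    refine MeasurableSpace.generateFrom_le ?_
    rintro _ ⟨e, he, rfl⟩
    refine ⟨{S | e ∈ S}, trivial, ?_⟩
    ext S
    simp [he]
  obtain ⟨X, -, rfl⟩ := hle _ h
  intro S
  simp [Set.inter_assoc]

lemma IsCylinder.mono {D C : Set E} {𝒰 : Set (Set E)} (h : IsCylinder D 𝒰) (hDC : D ⊆ C) :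
    IsCylinder C 𝒰 := by
  intro S
  rw [← h, ← h S, Set.inter_assoc, Set.inter_eq_self_of_subset_right hDC]

/-- The event on `C` induced by `𝒰`. -/
def onTrace (C : Finset E) (𝒰 : Set (Set E)) (T : Finset C) : Prop := (Subtype.val '' (T : Set C)) ∈ 𝒰

lemma onTrace_tr {C : Finset E} {𝒰 : Set (Set E)} (h : IsCylinder (C : Set E) 𝒰) (S : Set E) :
    onTrace C 𝒰 (tr C S) ↔ S ∈ 𝒰 := by
  rw [← h S, onTrace]
  have : Subtype.val '' (tr C S : Set C) = S ∩ C := by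
    ext e
    simp only [Set.mem_image, Finset.mem_coe, mem_tr, Set.mem_inter_iff]
    constructor
    · rintro ⟨c, hc, rfl⟩
      exact ⟨hc, c.2⟩
    · rintro ⟨h1, h2⟩
      exact ⟨⟨e, h2⟩, h1, rfl⟩
  rw [this]

lemma onTrace_mono {C : Finset E} {𝒰 : Set (Set E)} (h : IsUpperSet 𝒰) {T T' : Finset C}
    (hT : T ⊆ T') (hu : onTrace C 𝒰 T) : onTrace C 𝒰 T' :=
  h (Set.image_mono (Finset.coe_subset.2 hT)) hu

lemma setOf_onTrace {C : Finset E} {𝒰 : Set (Set E)} (h : IsCylinder (C : Set E) 𝒰) :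
    {S | onTrace C 𝒰 (tr C S)} = 𝒰 :=
  Set.ext fun S => onTrace_tr h S

lemma IsCylinder.measurableSet {C : Finset E} {𝒰 : Set (Set E)} (h : IsCylinder (C : Set E) 𝒰) :
    MeasurableSet 𝒰 := by
  rw [← setOf_onTrace h]
  exact measurableSet_preimage_tr C {T | onTrace C 𝒰 T}

lemma measurable_toSet : Measurable fun x : E → Bool => {e | x e = true} := by
  rw [measurable_set_iff]
  intro e
  have h : MeasurableSet ((fun x : E → Bool => x e) ⁻¹' {true}) :=
    measurable_pi_apply e (measurableSet_singleton true)
  exact measurable_to_prop (by simpa [Set.preimage] using h)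

lemma measurable_toConfig : Measurable fun (S : Set E) (e : E) => decide (e ∈ S) := by
  refine measurable_pi_iff.2 fun e => measurable_to_bool ?_
  simpa [Set.preimage] using measurableSet_mem e

/-- Increasing events can be approximated from inside by decreasing limits of increasing
cylinder events. -/
lemma exists_approx_upperSet [Countable E] (R : Measure (Set E)) [IsFiniteMeasure R] {K : Set E}
    {𝒜 : Set (Set E)} (hu : IsUpperSet 𝒜) (hm : MeasurableSet[sigmaField K] 𝒜) {ε : ℝ≥0∞}
    (hε : ε ≠ 0) :
    ∃ 𝒰 : Finset E → Set (Set E), Antitone 𝒰 ∧ (∀ D, IsUpperSet (𝒰 D)) ∧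
      (∀ D, ∃ D' : Finset E, (D' : Set E) ⊆ K ∧ IsCylinder (D' : Set E) (𝒰 D)) ∧
      ⋂ D, 𝒰 D ⊆ 𝒜 ∧ R 𝒜 ≤ R (⋂ D, 𝒰 D) + ε := by
  set R' : Measure (E → Bool) := R.map fun (S : Set E) (e : E) => decide (e ∈ S) with hR'
  have hfin : IsFiniteMeasure R' := Measure.isFiniteMeasure_map R _
  have hmA : MeasurableSet 𝒜 := sigmaField_le K _ hm
  have hmA' : MeasurableSet ((fun x : E → Bool => {e | x e = true}) ⁻¹' 𝒜) := measurable_toSet hmA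
  obtain ⟨𝒞, h𝒞A, h𝒞, hlt⟩ := hmA'.exists_isCompact_lt_add (μ := R') (measure_ne_top _ _) hε
  -- Here 𝒞 is a compact subset of the event, from inner regularity on the compact space `E → Bool`.
  -- `𝒰 D` consists of the sets lying above some member of 𝒞 as far as the coordinates in `D ∩ K`
  -- can tell.
  set 𝒰 : Finset E → Set (Set E) := fun D =>
    {S | ∃ x ∈ 𝒞, ∀ e ∈ D, e ∈ K → x e = true → e ∈ S} with h𝒰
  have hcyl : ∀ D : Finset E, IsCylinder ((D.filter (· ∈ K) : Finset E) : Set E) (𝒰 D) := by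
    intro D S
    constructor
    · rintro ⟨x, hx, h⟩
      exact ⟨x, hx, fun e he hK hxe => (h e he hK hxe).1⟩
    · rintro ⟨x, hx, h⟩
      exact ⟨x, hx, fun e he hK hxe => ⟨h e he hK hxe, by simp [he, hK]⟩⟩
  refine ⟨𝒰, ?_, ?_, fun D => ⟨D.filter (· ∈ K), fun e he => ?_, hcyl D⟩, ?_, ?_⟩
  · rintro D D' hD S ⟨x, hx, h⟩
    exact ⟨x, hx, fun e he => h e (hD he)⟩
  · rintro D S S' hS ⟨x, hx, h⟩
    exact ⟨x, hx, fun e he hK hxe => hS (h e he hK hxe)⟩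
  · rw [Finset.mem_coe, Finset.mem_filter] at he
    exact he.2
  · intro S hS
    rw [Set.mem_iInter] at hS
    have hcl : ∀ e, IsClosed {x : E → Bool | e ∈ K → x e = true → e ∈ S} := fun e => by
      by_cases h : e ∈ K ∧ e ∉ S
      · have : {x : E → Bool | e ∈ K → x e = true → e ∈ S} = (fun x => x e) ⁻¹' {false} := by
          ext x
          simp [h.1, h.2]
        rw [this]
        exact (isClosed_discrete _).preimage (continuous_apply e)
      · have : {x : E → Bool | e ∈ K → x e = true → e ∈ S} = Set.univ := by
          ext x
          simp only [Set.mem_ofPred_eq, Set.mem_univ, iff_true]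
          intro h1 _
          by_contra h2
          exact h ⟨h1, h2⟩
        rw [this]
        exact isClosed_univ
    -- The witness in 𝒞 may vary with `D`; the finite intersection property produces a common one,
    -- which is below `S` on all of `K`.
    obtain ⟨x, hx, hx'⟩ := h𝒞.inter_iInter_nonempty _ hcl (fun D => by
      obtain ⟨x, hx, h⟩ := hS D
      exact ⟨x, hx, Set.mem_iInter₂.2 fun e he => h e he⟩)
    rw [Set.mem_iInter] at hx'
    have h1 : {e | x e = true} ∈ 𝒜 := h𝒞A hx
    rw [← isCylinder_of_measurableSet hm] at h1
    exact hu (fun e he => hx' e he.2 he.1) h1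
  · have h1 : R' ((fun x : E → Bool => {e | x e = true}) ⁻¹' 𝒜) = R 𝒜 := by
      rw [hR', Measure.map_apply measurable_toConfig hmA', ← Set.preimage_comp]
      congr 1
      ext S
      simp
    have hmU : MeasurableSet (⋂ D, 𝒰 D) := MeasurableSet.iInter fun D => (hcyl D).measurableSet
    have h2 : R' 𝒞 ≤ R (⋂ D, 𝒰 D) := by
      have h3 : R (⋂ D, 𝒰 D) = R' ((fun x : E → Bool => {e | x e = true}) ⁻¹' ⋂ D, 𝒰 D) := by
        rw [hR', Measure.map_apply measurable_toConfig (measurable_toSet hmU), ← Set.preimage_comp]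
        congr 1
        ext S
        simp
      rw [h3]
      refine measure_mono fun x hx => ?_
      exact Set.mem_iInter.2 fun D => ⟨x, hx, fun e _ _ h => h⟩
    rw [← h1]
    exact hlt.le.trans (add_le_add_left h2 ε)

lemma tendsto_measure_iInter_finset [Countable E] (R : Measure (Set E)) [IsFiniteMeasure R]
    {𝒰 : Finset E → Set (Set E)} (hanti : Antitone 𝒰) (hm : ∀ D, MeasurableSet (𝒰 D)) :
    Filter.Tendsto (fun D => R (𝒰 D)) Filter.atTop (nhds (R (⋂ D, 𝒰 D))) :=
  tendsto_measure_iInter_atTop (fun D => (hm D).nullMeasurableSet) hanti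
    ⟨∅, measure_ne_top _ _⟩

/-- Negative association need only be checked on cylinder events. -/
theorem hasNegAssoc_of_cylinder [Countable E] (R : Measure (Set E)) [IsFiniteMeasure R]
    (h : ∀ (K : Set E) (D₁ D₂ : Finset E) (𝒰₁ 𝒰₂ : Set (Set E)), (D₁ : Set E) ⊆ K →
      (D₂ : Set E) ⊆ Kᶜ → IsUpperSet 𝒰₁ → IsUpperSet 𝒰₂ → IsCylinder (D₁ : Set E) 𝒰₁ →
      IsCylinder (D₂ : Set E) 𝒰₂ → R (𝒰₁ ∩ 𝒰₂) ≤ R 𝒰₁ * R 𝒰₂) : HasNegAssoc R := by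
  intro K 𝒜₁ 𝒜₂ hu₁ hu₂ hm₁ hm₂
  refine ENNReal.le_of_forall_pos_le_add fun ε hε _ => ?_
  have hε2 : (ε : ℝ≥0∞) / 2 ≠ 0 := (ENNReal.half_pos (by exact_mod_cast hε.ne')).ne'
  obtain ⟨𝒰₁, ha₁, hU₁, hc₁, hs₁, hl₁⟩ := exists_approx_upperSet R hu₁ hm₁ hε2
  obtain ⟨𝒰₂, ha₂, hU₂, hc₂, hs₂, hl₂⟩ := exists_approx_upperSet R hu₂ hm₂ hε2
  have hmU₁ : ∀ D, MeasurableSet (𝒰₁ D) := fun D => (hc₁ D).choose_spec.2.measurableSet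
  have hmU₂ : ∀ D, MeasurableSet (𝒰₂ D) := fun D => (hc₂ D).choose_spec.2.measurableSet
  set 𝒱₁ := ⋂ D, 𝒰₁ D with h𝒱₁
  set 𝒱₂ := ⋂ D, 𝒰₂ D with h𝒱₂
  have hmV₁ : MeasurableSet 𝒱₁ := MeasurableSet.iInter hmU₁
  have hmV₂ : MeasurableSet 𝒱₂ := MeasurableSet.iInter hmU₂
  have hd₁ : R (𝒜₁ \ 𝒱₁) ≤ ε / 2 := by
    rw [measure_sdiff hs₁ hmV₁.nullMeasurableSet (measure_ne_top _ _)]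
    exact tsub_le_iff_left.2 hl₁
  have hd₂ : R (𝒜₂ \ 𝒱₂) ≤ ε / 2 := by
    rw [measure_sdiff hs₂ hmV₂.nullMeasurableSet (measure_ne_top _ _)]
    exact tsub_le_iff_left.2 hl₂
  have hVV : R (𝒱₁ ∩ 𝒱₂) ≤ R 𝒱₁ * R 𝒱₂ := by
    have t₁ := tendsto_measure_iInter_finset R ha₁ hmU₁
    have t₂ := tendsto_measure_iInter_finset R ha₂ hmU₂
    have t₃ := tendsto_measure_iInter_finset R (𝒰 := fun D => 𝒰₁ D ∩ 𝒰₂ D)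
      (fun D D' hD => Set.inter_subset_inter (ha₁ hD) (ha₂ hD))
      (fun D => (hmU₁ D).inter (hmU₂ D))
    rw [Set.iInter_inter_distrib] at t₃
    refine le_of_tendsto_of_tendsto t₃
      (ENNReal.Tendsto.mul t₁ (Or.inr (measure_ne_top _ _)) t₂ (Or.inr (measure_ne_top _ _)))
      (Filter.Eventually.of_forall fun D => ?_)
    obtain ⟨D₁, hD₁, hc₁'⟩ := hc₁ D
    obtain ⟨D₂, hD₂, hc₂'⟩ := hc₂ D
    exact h K D₁ D₂ _ _ hD₁ hD₂ (hU₁ D) (hU₂ D) hc₁' hc₂'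
  calc R (𝒜₁ ∩ 𝒜₂) ≤ R ((𝒱₁ ∩ 𝒱₂) ∪ ((𝒜₁ \ 𝒱₁) ∪ (𝒜₂ \ 𝒱₂))) := by
        refine measure_mono fun S hS => ?_
        by_cases h1 : S ∈ 𝒱₁
        · by_cases h2 : S ∈ 𝒱₂
          · exact Or.inl ⟨h1, h2⟩
          · exact Or.inr (Or.inr ⟨hS.2, h2⟩)
        · exact Or.inr (Or.inl ⟨hS.1, h1⟩)
    _ ≤ R (𝒱₁ ∩ 𝒱₂) + (R (𝒜₁ \ 𝒱₁) + R (𝒜₂ \ 𝒱₂)) :=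
        (measure_union_le _ _).trans (by gcongr; exact measure_union_le _ _)
    _ ≤ R 𝒜₁ * R 𝒜₂ + (ε / 2 + ε / 2) := by
        refine add_le_add (hVV.trans ?_) (add_le_add hd₁ hd₂)
        exact mul_le_mul' (measure_mono hs₁) (measure_mono hs₂)
    _ = R 𝒜₁ * R 𝒜₂ + ε := by rw [ENNReal.add_halves]

theorem stochDominatedBy_of_cylinder [Countable E] (P₁ P₂ : Measure (Set E)) [IsFiniteMeasure P₁]
    [IsFiniteMeasure P₂] (h : ∀ (D : Finset E) (𝒰 : Set (Set E)), IsUpperSet 𝒰 →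
      IsCylinder (D : Set E) 𝒰 → P₁ 𝒰 ≤ P₂ 𝒰) : StochDominatedBy P₁ P₂ := by
  intro 𝒜 hm hu
  refine ENNReal.le_of_forall_pos_le_add fun ε hε _ => ?_
  have hm' : MeasurableSet[sigmaField Set.univ] 𝒜 := by rwa [sigmaField_univ]
  obtain ⟨𝒰, ha, hU, hc, hs, hl⟩ := exists_approx_upperSet P₁ hu hm'
    (ε := ε) (by exact_mod_cast hε.ne')
  have hmU : ∀ D, MeasurableSet (𝒰 D) := fun D => (hc D).choose_spec.2.measurableSet
  have hV : P₁ (⋂ D, 𝒰 D) ≤ P₂ (⋂ D, 𝒰 D) :=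
    le_of_tendsto_of_tendsto (tendsto_measure_iInter_finset P₁ ha hmU)
      (tendsto_measure_iInter_finset P₂ ha hmU)
      (Filter.Eventually.of_forall fun D => h _ _ (hU D) (hc D).choose_spec.2)
  exact hl.trans (add_le_add_left (hV.trans (measure_mono hs)) _)

end Approximation

/-! ### Stochastic domination on E. -/

section Main

open scoped Classical

variable {𝕜 : Type*} [RCLike 𝕜] {E : Type*}

lemma IsDeterminantal.eq_ofReal_wsum {Q : L2 𝕜 E →L[𝕜] L2 𝕜 E} {P : Measure (Set E)}
    (hP : IsDeterminantal Q P) {C : Finset E} {𝒰 : Set (Set E)} (h𝒰 : IsCylinder (C : Set E) 𝒰) :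
    P 𝒰 = ENNReal.ofReal
      (wsum (pw (kernelMat Q C)) fun T => if onTrace C 𝒰 T then 1 else 0) := by
  have := hP.isProbabilityMeasure
  rw [← hP.integral_tr_eq, ← ofReal_measureReal]
  congr 1
  refine (integral_indicator_one h𝒰.measurableSet).symm.trans ?_
  refine integral_congr_ae (Filter.Eventually.of_forall fun S => ?_)
  by_cases hS : S ∈ 𝒰 <;> simp [hS, onTrace_tr h𝒰]

theorem stochDominatedBy_of_le [Countable E] {Q₁ Q₂ : L2 𝕜 E →L[𝕜] L2 𝕜 E}
    (h₁ : IsPositiveContraction Q₁) (h₂ : IsPositiveContraction Q₂)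
    (hle : ∀ u, RCLike.re (inner 𝕜 (Q₁ u) u) ≤ RCLike.re (inner 𝕜 (Q₂ u) u))
    {P₁ P₂ : Measure (Set E)} (hP₁ : IsDeterminantal Q₁ P₁) (hP₂ : IsDeterminantal Q₂ P₂) :
    StochDominatedBy P₁ P₂ := by
  have := hP₁.isProbabilityMeasure
  have := hP₂.isProbabilityMeasure
  refine stochDominatedBy_of_cylinder P₁ P₂ fun D 𝒰 hU hc => ?_
  rw [hP₁.eq_ofReal_wsum hc, hP₂.eq_ofReal_wsum hc]
  refine ENNReal.ofReal_le_ofReal (wsum_pw_mono (h₁.isContr D) (h₂.isContr D) ?_ ?_)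
  · rw [← kernelMat_sub]
    refine posSemidef_kernelMat (h₂.isSelfAdjoint.sub h₁.isSelfAdjoint) (fun u => ?_) D
    have := hle u
    simp only [sub_apply, inner_sub_left, map_sub]
    linarith
  · intro T T' hT
    dsimp only
    split_ifs with h1 h2
    · exact le_rfl
    · exact absurd (onTrace_mono hU hT h1) h2
    · exact zero_le_one
    · exact le_rfl

end Main

/-! ### Conditional negative association with external fields on E. -/

section CondNegAssoc

open scoped Classical

variable {𝕜 : Type*} [RCLike 𝕜] {E : Type*}

lemma prod_tr {M : Type*} [CommMonoid M] {C D : Finset E} (hDC : D ⊆ C) (h : E → M) :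
    ∏ c ∈ tr C (D : Set E), h c = ∏ e ∈ D, h e := by
  refine Finset.prod_bij (fun c _ => (c : E)) (fun c hc => by simpa [mem_tr] using hc)
    (fun a _ b _ hab => Subtype.ext hab) (fun e he => ⟨⟨e, hDC he⟩, by simpa [mem_tr] using he, rfl⟩)
    (fun _ _ => rfl)

lemma sum_tr {C D : Finset E} (hDC : D ⊆ C) (h : E → ℝ) :
    ∑ c ∈ tr C (D : Set E), h c = ∑ e ∈ D, h e :=
  Finset.sum_bij (fun c _ => (c : E)) (fun c hc => by simpa [mem_tr] using hc)
    (fun a _ b _ hab => Subtype.ext hab) (fun e he => ⟨⟨e, hDC he⟩, by simpa [mem_tr] using he, rfl⟩)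
    (fun _ _ => rfl)

/-- The external field on `C`, equal to `1` off `F`. -/
def fieldOn (F : Finset E) (w : E → ℝ≥0) {C : Finset E} (c : C) : ℝ :=
  if (c : E) ∈ F then (w c : ℝ) else 1

lemma fieldOn_pos {F : Finset E} {w : E → ℝ≥0} (hw : ∀ e, 0 < w e) {C : Finset E} (c : C) :
    0 < fieldOn F w c := by
  unfold fieldOn
  split_ifs
  · exact_mod_cast hw c
  · exact one_pos

lemma fieldWeight_eq {F C : Finset E} (hFC : F ⊆ C) (w : E → ℝ≥0) (S : Set E) :
    fieldWeight F w S = ENNReal.ofReal (∏ c ∈ tr C S, fieldOn F w c) := by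
  have h0 : ∀ c : C, 0 ≤ fieldOn F w c := fun c => by
    unfold fieldOn
    split_ifs <;> positivity
  rw [ENNReal.ofReal_prod_of_nonneg fun c _ => h0 c]
  have h1 : ∏ c ∈ tr C S, ENNReal.ofReal (fieldOn F w c) =
      ∏ c ∈ tr C (F : Set E), if (c : E) ∈ S then (w c : ℝ≥0∞) else 1 := by
    rw [tr, tr, Finset.prod_filter, Finset.prod_filter]
    refine Finset.prod_congr rfl fun c _ => ?_
    by_cases hS : (c : E) ∈ S <;> by_cases hF : (c : E) ∈ F <;> simp [hS, hF, fieldOn]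
  rw [h1, prod_tr hFC (fun e => if e ∈ S then (w e : ℝ≥0∞) else 1)]
  rfl

/-- As `F ⊆ C`, the density is a function of the trace on `C`, so the weighted measure of an event
on `C` is a finite sum of determinantal weights. -/
lemma IsDeterminantal.withDensity_tr {Q : L2 𝕜 E →L[𝕜] L2 𝕜 E} {P : Measure (Set E)}
    (hP : IsDeterminantal Q P) {F C : Finset E} (hFC : F ⊆ C) {w : E → ℝ≥0} (hw : ∀ e, 0 < w e)
    (Y : Finset C → Prop) [DecidablePred Y] :
    P.withDensity (fieldWeight F w) {S | Y (tr C S)} =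
      ENNReal.ofReal (wsum (fun T => pw (kernelMat Q C) T * ∏ c ∈ T, fieldOn F w c)
        fun T => if Y T then 1 else 0) := by
  have := hP.isProbabilityMeasure
  have hm : MeasurableSet {S | Y (tr C S)} := measurableSet_preimage_tr C {T | Y T}
  have h1 := hP.integral_tr_eq C fun T => (∏ c ∈ T, fieldOn F w c) * if Y T then 1 else 0
  have h2 : wsum (fun T => pw (kernelMat Q C) T * ∏ c ∈ T, fieldOn F w c)
      (fun T => if Y T then 1 else 0) = wsum (pw (kernelMat Q C))
        fun T => (∏ c ∈ T, fieldOn F w c) * if Y T then 1 else 0 :=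
    Finset.sum_congr rfl fun T _ => mul_assoc _ _ _
  rw [withDensity_apply _ hm, h2, ← h1, ofReal_integral_eq_lintegral_ofReal
    (integrable_tr P C fun T => (∏ c ∈ T, fieldOn F w c) * if Y T then 1 else 0)
    (Filter.Eventually.of_forall fun S => mul_nonneg
      (Finset.prod_nonneg fun c _ => (fieldOn_pos hw c).le) (by split_ifs <;> simp)),
    ← lintegral_indicator hm]
  refine lintegral_congr fun S => ?_
  by_cases hS : Y (tr C S)
  · rw [Set.indicator_of_mem (by exact hS), fieldWeight_eq hFC]
    simp [hS]
  · rw [Set.indicator_of_notMem (by exact hS)]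
    simp [hS]

lemma depOn_onTrace {C D : Finset E} {K : Set E} (hDK : (D : Set E) ⊆ K) {𝒰 : Set (Set E)}
    (h : IsCylinder (D : Set E) 𝒰) : DepOn (tr C K) (onTrace C 𝒰) := by
  intro T T' hT
  simp only [onTrace]
  rw [eq_iff_iff, ← h, ← h (Subtype.val '' (T' : Set C))]
  have : Subtype.val '' (T : Set C) ∩ (D : Set E) = Subtype.val '' (T' : Set C) ∩ (D : Set E) := by
    ext e
    simp only [Set.mem_inter_iff, Set.mem_image, Finset.mem_coe]
    refine and_congr_left fun he => ?_
    have key : ∀ c : C, (c : E) = e → (c ∈ T ↔ c ∈ T') := by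
      rintro c rfl
      have := Finset.ext_iff.1 hT c
      simpa [mem_tr, hDK he] using this
    constructor
    · rintro ⟨c, hc, hce⟩
      exact ⟨c, (key c hce).1 hc, hce⟩
    · rintro ⟨c, hc, hce⟩
      exact ⟨c, (key c hce).2 hc, hce⟩
  rw [this]

lemma DepOn.ite {α : Type*} [Fintype α] [DecidableEq α] {K : Finset α} {X : Finset α → Prop}
    (h : DepOn K X) : DepOn K fun T => if X T then (1 : ℝ) else 0 := fun S T hST => by
  simp only [h S T hST]

lemma tr_compl (C : Finset E) (K : Set E) : tr C Kᶜ = (tr C K)ᶜ := by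
  ext c
  simp [mem_tr]

lemma monotone_ite_onTrace {C : Finset E} {𝒰 : Set (Set E)} (h : IsUpperSet 𝒰) :
    Monotone fun T : Finset C => if onTrace C 𝒰 T then (1 : ℝ) else 0 := by
  intro T T' hT
  dsimp only
  split_ifs with h1 h2
  · exact le_rfl
  · exact absurd (onTrace_mono h hT h1) h2
  · exact zero_le_one
  · exact le_rfl

/-- The event that `S` agrees on `C` with the requirement `A ⊆ S`, `B ∩ S = ∅`. -/
def inOutOn (C : Finset E) (A B : Set E) : Set (Set E) :=
  {S | tr C A ⊆ tr C S ∧ Disjoint (tr C B) (tr C S)}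

lemma mem_inOutOn {C : Finset E} {A B S : Set E} :
    S ∈ inOutOn C A B ↔ ∀ e ∈ C, (e ∈ A → e ∈ S) ∧ (e ∈ B → e ∉ S) := by
  simp only [inOutOn, Set.mem_ofPred_eq, Finset.subset_iff, Finset.disjoint_left, mem_tr,
    Subtype.forall]
  constructor
  · rintro ⟨h1, h2⟩ e he
    exact ⟨h1 e he, h2 e he⟩
  · intro h
    exact ⟨fun e he => (h e he).1, fun e he => (h e he).2⟩

lemma antitone_inOutOn (A B : Set E) : Antitone fun C => inOutOn C A B := by
  intro C C' hC S hS
  rw [mem_inOutOn] at hS ⊢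
  exact fun e he => hS e (hC he)

lemma iInter_inOutOn (A B : Set E) : ⋂ C, inOutOn C A B = inOut A B := by
  ext S
  simp only [Set.mem_iInter, mem_inOutOn, inOut, Set.mem_ofPred_eq, Set.eq_empty_iff_forall_notMem,
    Set.subset_def, Set.mem_inter_iff, not_and]
  constructor
  · intro h
    exact ⟨fun e he => (h {e} e (by simp)).1 he, fun e he => (h {e} e (by simp)).2 he⟩
  · rintro ⟨h1, h2⟩ C e -
    exact ⟨h1 e, h2 e⟩

lemma measurableSet_inOutOn (C : Finset E) (A B : Set E) : MeasurableSet (inOutOn C A B) :=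
  measurableSet_preimage_tr C {T | tr C A ⊆ T ∧ Disjoint (tr C B) T}

lemma IsDeterminantal.isFiniteMeasure_withDensity {Q : L2 𝕜 E →L[𝕜] L2 𝕜 E} {P : Measure (Set E)}
    (hP : IsDeterminantal Q P) (F : Finset E) {w : E → ℝ≥0} (hw : ∀ e, 0 < w e) :
    IsFiniteMeasure (P.withDensity (fieldWeight F w)) := by
  constructor
  have h := hP.withDensity_tr (subset_refl F) hw fun _ => True
  simp only [Set.ofPred_true] at h
  rw [h]
  exact ENNReal.ofReal_lt_top

lemma IsDeterminantal.negAssoc_inOutOn {Q : L2 𝕜 E →L[𝕜] L2 𝕜 E} (hQ : IsPositiveContraction Q)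
    {P : Measure (Set E)} (hP : IsDeterminantal Q P) {F C D₁ D₂ : Finset E} (hFC : F ⊆ C)
    (hD₁C : D₁ ⊆ C) (hD₂C : D₂ ⊆ C) {w : E → ℝ≥0} (hw : ∀ e, 0 < w e) {K : Set E}
    (hD₁ : (D₁ : Set E) ⊆ K) (hD₂ : (D₂ : Set E) ⊆ Kᶜ) {𝒰₁ 𝒰₂ : Set (Set E)}
    (hu₁ : IsUpperSet 𝒰₁) (hu₂ : IsUpperSet 𝒰₂) (hc₁ : IsCylinder (D₁ : Set E) 𝒰₁)
    (hc₂ : IsCylinder (D₂ : Set E) 𝒰₂) (A B : Set E) :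
    P.withDensity (fieldWeight F w) (inOutOn C A B ∩ (𝒰₁ ∩ 𝒰₂)) *
        P.withDensity (fieldWeight F w) (inOutOn C A B) ≤
      P.withDensity (fieldWeight F w) (inOutOn C A B ∩ 𝒰₁) *
        P.withDensity (fieldWeight F w) (inOutOn C A B ∩ 𝒰₂) := by
  set μ : Finset C → ℝ := fun T => pw (kernelMat Q C) T * ∏ c ∈ T, fieldOn F w c with hμ
  have hμ0 : ∀ T, 0 ≤ μ T := fun T => mul_nonneg (pw_nonneg (hQ.isContr C) T)
    (Finset.prod_nonneg fun c _ => (fieldOn_pos hw c).le)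
  have key : ∀ 𝒰 : Set (Set E), IsCylinder (C : Set E) 𝒰 →
      P.withDensity (fieldWeight F w) (inOutOn C A B ∩ 𝒰) =
        ENNReal.ofReal (wsum (condWeight (tr C A) (tr C B) μ)
          fun T => if onTrace C 𝒰 T then 1 else 0) := by
    intro 𝒰 h𝒰
    have h1 := hP.withDensity_tr hFC hw
      fun T => (tr C A ⊆ T ∧ Disjoint (tr C B) T) ∧ onTrace C 𝒰 T
    have h2 : {S | (tr C A ⊆ tr C S ∧ Disjoint (tr C B) (tr C S)) ∧ onTrace C 𝒰 (tr C S)} =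
        inOutOn C A B ∩ 𝒰 := by
      ext S
      simp only [Set.mem_ofPred_eq, Set.mem_inter_iff, inOutOn, onTrace_tr h𝒰]
    rw [h2] at h1
    rw [h1]
    congr 1
    refine Finset.sum_congr rfl fun T _ => ?_
    by_cases ha : tr C A ⊆ T ∧ Disjoint (tr C B) T <;> by_cases hb : onTrace C 𝒰 T <;>
      simp [condWeight, ha, hb, hμ]
  have hC₁ := hc₁.mono (Finset.coe_subset.2 hD₁C)
  have hC₂ := hc₂.mono (Finset.coe_subset.2 hD₂C)
  have hC₁₂ : IsCylinder (C : Set E) (𝒰₁ ∩ 𝒰₂) := fun S => and_congr (hC₁ S) (hC₂ S)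
  have hCu : IsCylinder (C : Set E) (Set.univ : Set (Set E)) := fun S => by simp
  have k0 := key _ hCu
  rw [Set.inter_univ] at k0
  rw [key _ hC₁₂, k0, key _ hC₁, key _ hC₂]
  have hn : ∀ g : Finset C → ℝ, (∀ T, 0 ≤ g T) →
      0 ≤ wsum (condWeight (tr C A) (tr C B) μ) g := fun g hg =>
    Finset.sum_nonneg fun T _ => mul_nonneg (by
      unfold condWeight
      split_ifs
      exacts [hμ0 T, le_rfl]) (hg T)
  have hite : ∀ (X : Finset C → Prop) (T : Finset C), (0 : ℝ) ≤ if X T then 1 else 0 := by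
    intro X T
    split_ifs <;> simp
  rw [← ENNReal.ofReal_mul (hn _ (hite _)), ← ENNReal.ofReal_mul (hn _ (hite _))]
  refine ENNReal.ofReal_le_ofReal ?_
  have hna := negAssoc_pw (hQ.isContr C) (w := fieldOn F w) (fieldOn_pos hw) (tr C A) (tr C B)
    (monotone_ite_onTrace hu₁) (monotone_ite_onTrace hu₂) (K := tr C K)
    (depOn_onTrace hD₁ hc₁).ite (by
      rw [← tr_compl]
      exact (depOn_onTrace hD₂ hc₂).ite)
  refine le_trans (le_of_eq ?_) hna
  congr 2
  · funext T
    by_cases ha : onTrace C 𝒰₁ T <;> by_cases hb : onTrace C 𝒰₂ T <;>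
      simp_all [onTrace]
  · funext T
    simp [onTrace]

theorem IsDeterminantal.hasCondNegAssocExternalFields [Countable E] {Q : L2 𝕜 E →L[𝕜] L2 𝕜 E}
    (hQ : IsPositiveContraction Q) {P : Measure (Set E)} (hP : IsDeterminantal Q P) :
    HasCondNegAssocExternalFields P := by
  intro F w hw A B hAB
  set m := P.withDensity (fieldWeight F w) with hm
  have hfin : IsFiniteMeasure m := hP.isFiniteMeasure_withDensity F hw
  set c := (∫⁻ S, fieldWeight F w S ∂P)⁻¹ with hc
  have hext : externalField P F w = c • m := rfl
  set M := externalField P F w with hM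
  have hMfin : IsFiniteMeasure M := by
    constructor
    rw [hext, Measure.smul_apply, hm, withDensity_apply _ MeasurableSet.univ,
      Measure.restrict_univ, smul_eq_mul]
    exact lt_of_le_of_lt (ENNReal.inv_mul_le_one _) ENNReal.one_lt_top
  have hIm : MeasurableSet (inOut A B) := by
    rw [← iInter_inOutOn]
    exact MeasurableSet.iInter fun C => measurableSet_inOutOn C A B
  refine hasNegAssoc_of_cylinder _ fun K D₁ D₂ 𝒰₁ 𝒰₂ hD₁ hD₂ hu₁ hu₂ hc₁ hc₂ => ?_
  have hlim : ∀ 𝒰 : Set (Set E), MeasurableSet 𝒰 →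
      Filter.Tendsto (fun C => m (inOutOn C A B ∩ 𝒰)) Filter.atTop
        (nhds (m (inOut A B ∩ 𝒰))) := by
    intro 𝒰 h𝒰
    have := tendsto_measure_iInter_finset m (𝒰 := fun C => inOutOn C A B ∩ 𝒰)
      (fun C C' hC => Set.inter_subset_inter_left _ (antitone_inOutOn A B hC))
      (fun C => (measurableSet_inOutOn C A B).inter h𝒰)
    rwa [← Set.iInter_inter, iInter_inOutOn] at this
  have hm₁ := hc₁.measurableSet
  have hm₂ := hc₂.measurableSet
  -- `A` and `B` may be infinite, so the conditioning event is a decreasing limit of its finite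
  -- versions. The multiplied-out inequality passes to the limit without any division.
  have hineq : m (inOut A B ∩ (𝒰₁ ∩ 𝒰₂)) * m (inOut A B) ≤
      m (inOut A B ∩ 𝒰₁) * m (inOut A B ∩ 𝒰₂) := by
    have t0 := hlim Set.univ MeasurableSet.univ
    simp only [Set.inter_univ] at t0
    refine le_of_tendsto_of_tendsto
      (ENNReal.Tendsto.mul (hlim _ (hm₁.inter hm₂)) (Or.inr (measure_ne_top _ _)) t0
        (Or.inr (measure_ne_top _ _)))
      (ENNReal.Tendsto.mul (hlim _ hm₁) (Or.inr (measure_ne_top _ _)) (hlim _ hm₂)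
        (Or.inr (measure_ne_top _ _))) ?_
    filter_upwards [Filter.eventually_ge_atTop (F ∪ (D₁ ∪ D₂))] with C hC
    refine hP.negAssoc_inOutOn hQ (D₁ := D₁) (D₂ := D₂) ?_ ?_ ?_ hw hD₁ hD₂ hu₁ hu₂ hc₁ hc₂ A B
    · exact Finset.subset_union_left.trans hC
    · exact (Finset.subset_union_left.trans Finset.subset_union_right).trans hC
    · exact (Finset.subset_union_right.trans Finset.subset_union_right).trans hC
  have hMineq : M (inOut A B ∩ (𝒰₁ ∩ 𝒰₂)) * M (inOut A B) ≤
      M (inOut A B ∩ 𝒰₁) * M (inOut A B ∩ 𝒰₂) := by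
    simp only [hext, Measure.smul_apply, smul_eq_mul]
    -- Both sides are quadratic in the measure, so the normalizing constant plays no role.
    calc c * m (inOut A B ∩ (𝒰₁ ∩ 𝒰₂)) * (c * m (inOut A B))
        = c * c * (m (inOut A B ∩ (𝒰₁ ∩ 𝒰₂)) * m (inOut A B)) := by ring
      _ ≤ c * c * (m (inOut A B ∩ 𝒰₁) * m (inOut A B ∩ 𝒰₂)) := by gcongr
      _ = _ := by ring
  have hfinI : M (inOut A B) ≠ ⊤ := measure_ne_top _ _
  rw [ProbabilityTheory.cond_apply hIm, ProbabilityTheory.cond_apply hIm,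
    ProbabilityTheory.cond_apply hIm]
  calc (M (inOut A B))⁻¹ * M (inOut A B ∩ (𝒰₁ ∩ 𝒰₂))
      = (M (inOut A B))⁻¹ * (M (inOut A B))⁻¹ *
          (M (inOut A B ∩ (𝒰₁ ∩ 𝒰₂)) * M (inOut A B)) := by
        rw [mul_assoc, mul_comm (M (inOut A B ∩ (𝒰₁ ∩ 𝒰₂))), ← mul_assoc (M (inOut A B))⁻¹
          (M (inOut A B)), ENNReal.inv_mul_cancel hAB hfinI, one_mul]
    _ ≤ (M (inOut A B))⁻¹ * (M (inOut A B))⁻¹ *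
          (M (inOut A B ∩ 𝒰₁) * M (inOut A B ∩ 𝒰₂)) := by gcongr
    _ = _ := by ring

end CondNegAssoc

/-! ### Covariance bounds for functions of disjoint sets of coordinates. -/

section Covariance

variable {𝕜 : Type*} [RCLike 𝕜] {ι : Type*} [Fintype ι] [DecidableEq ι]

lemma wsum_add (μ f g : Finset ι → ℝ) : wsum μ (f + g) = wsum μ f + wsum μ g := by
  simp [wsum, mul_add, Finset.sum_add_distrib]

lemma wsum_sub (μ f g : Finset ι → ℝ) : wsum μ (f - g) = wsum μ f - wsum μ g := by
  simp [wsum, mul_sub, Finset.sum_sub_distrib]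

lemma wsum_neg (μ f : Finset ι → ℝ) : wsum μ (-f) = -wsum μ f := by
  simp [wsum]

theorem negAssoc_pw_of_monotone {Q : Matrix ι ι 𝕜} (hQ : IsContr Q) {f g : Finset ι → ℝ}
    (hf : Monotone f) (hg : Monotone g) {K : Finset ι} (hfK : DepOn K f) (hgK : DepOn Kᶜ g) :
    wsum (pw Q) (f * g) ≤ wsum (pw Q) f * wsum (pw Q) g := by
  have h := negAssoc_pw hQ (w := 1) (fun _ => one_pos) ∅ ∅ hf hg hfK hgK
  have hc : (condWeight ∅ ∅ fun S => pw Q S * ∏ i ∈ S, (1 : ι → ℝ) i) = pw Q := by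
    funext S
    simp [condWeight]
  rwa [hc, wsum_pw_one, mul_one] at h

theorem negAssoc_pw_of_antitone {Q : Matrix ι ι 𝕜} (hQ : IsContr Q) {f g : Finset ι → ℝ}
    (hf : Antitone f) (hg : Antitone g) {K : Finset ι} (hfK : DepOn K f) (hgK : DepOn Kᶜ g) :
    wsum (pw Q) (f * g) ≤ wsum (pw Q) f * wsum (pw Q) g := by
  have h := negAssoc_pw_of_monotone hQ (f := -f) (g := -g) (K := K) hf.neg hg.neg
    (fun S T hST => by simp [hfK S T hST]) (fun S T hST => by simp [hgK S T hST])
  rw [wsum_neg, wsum_neg, neg_mul_neg, neg_mul_neg] at h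
  exact h

/-- The number of elements of `T ∩ K`. -/
def cardOn (K T : Finset ι) : ℝ := ∑ e ∈ K, if e ∈ T then 1 else 0

lemma cardOn_eq (K T : Finset ι) : cardOn K T = ((T ∩ K).card : ℝ) := by
  rw [cardOn, Finset.sum_ite_mem, Finset.sum_const, nsmul_eq_mul, mul_one, Finset.inter_comm]

lemma depOn_cardOn (K : Finset ι) : DepOn K (cardOn K) := fun S T hST => by
  rw [cardOn_eq, cardOn_eq, hST]

lemma depOn_mono {β : Type*} {K L : Finset ι} (hKL : K ⊆ L) {f : Finset ι → β} (h : DepOn K f) :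
    DepOn L f := by
  intro S T hST
  refine h S T ?_
  rw [← Finset.inter_eq_right.2 hKL, ← Finset.inter_assoc, hST, Finset.inter_assoc]

/-- Enlarging `S ∩ K` strictly raises the count by at least 1, while `f` can drop by at most 1.
Negative association thereby reaches functions that are not monotone. -/
lemma monotone_cardOn_add {K : Finset ι} {f : Finset ι → ℝ} (hf : DepOn K f)
    (hf1 : ∀ S T, f S ≤ f T + 1) : Monotone (cardOn K + f) := by
  intro S T hST
  simp only [Pi.add_apply, cardOn_eq]
  have hsub : S ∩ K ⊆ T ∩ K := Finset.inter_subset_inter_right hST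
  rcases eq_or_ssubset_of_subset hsub with h | h
  · rw [h, hf S T h]
  · have := Finset.card_lt_card h
    have h2 : ((S ∩ K).card : ℝ) + 1 ≤ (T ∩ K).card := by exact_mod_cast this
    linarith [hf1 S T]

lemma monotone_cardOn_sub {K : Finset ι} {f : Finset ι → ℝ} (hf : DepOn K f)
    (hf1 : ∀ S T, f S ≤ f T + 1) : Monotone (cardOn K - f) := by
  rw [sub_eq_add_neg]
  refine monotone_cardOn_add (fun S T hST => by simp [hf S T hST]) fun S T => ?_
  have := hf1 T S
  simp only [Pi.neg_apply]
  linarith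

lemma wsum_cardOn (μ : Finset ι → ℝ) (K : Finset ι) :
    wsum μ (cardOn K) = ∑ e ∈ K, mass μ {e} ∅ := by
  simp only [wsum, cardOn, mass, Finset.mul_sum, Finset.sum_filter]
  rw [Finset.sum_comm]
  simp

lemma wsum_cardOn_mul (μ : Finset ι → ℝ) (K L : Finset ι) :
    wsum μ (cardOn K * cardOn L) = ∑ e ∈ K, ∑ x ∈ L, mass μ {e, x} ∅ := by
  have h : ∀ S, μ S * (cardOn K * cardOn L) S =
      ∑ e ∈ K, ∑ x ∈ L, if {e, x} ⊆ S then μ S else 0 := by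
    intro S
    rw [Pi.mul_apply, cardOn, cardOn, Finset.sum_mul_sum, Finset.mul_sum]
    refine Finset.sum_congr rfl fun e _ => ?_
    rw [Finset.mul_sum]
    refine Finset.sum_congr rfl fun x _ => ?_
    by_cases h1 : e ∈ S <;> by_cases h2 : x ∈ S <;> simp [h1, h2, Finset.insert_subset_iff]
  simp only [wsum, h]
  rw [Finset.sum_comm]
  refine Finset.sum_congr rfl fun e _ => ?_
  rw [Finset.sum_comm]
  refine Finset.sum_congr rfl fun x _ => ?_
  rw [mass, Finset.sum_filter]
  simp

/-- Covariances of functions of disjoint sets of coordinates are controlled by the kernel. -/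
theorem abs_cov_le {Q : Matrix ι ι 𝕜} (hQ : IsContr Q) {K L : Finset ι} (hKL : Disjoint K L)
    {f g : Finset ι → ℝ} (hf : DepOn K f) (hg : DepOn L g) (hf1 : ∀ S T, f S ≤ f T + 1)
    (hg1 : ∀ S T, g S ≤ g T + 1) :
    |wsum (pw Q) (f * g) - wsum (pw Q) f * wsum (pw Q) g| ≤ ∑ e ∈ K, ∑ x ∈ L, ‖Q e x‖ ^ 2 := by
  have hLK : L ⊆ Kᶜ := fun x hx => by
    rw [Finset.mem_compl]
    exact fun hK => Finset.disjoint_left.1 hKL hK hx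
  set F := cardOn K
  set G := cardOn L
  have hF : DepOn K F := depOn_cardOn K
  have hG : DepOn L G := depOn_cardOn L
  have dadd : ∀ {M : Finset ι} {u v : Finset ι → ℝ}, DepOn M u → DepOn M v → DepOn M (u + v) :=
    fun hu hv S T hST => by simp [hu S T hST, hv S T hST]
  have dsub : ∀ {M : Finset ι} {u v : Finset ι → ℝ}, DepOn M u → DepOn M v → DepOn M (u - v) :=
    fun hu hv S T hST => by simp [hu S T hST, hv S T hST]
  have n1 := negAssoc_pw_of_monotone hQ (monotone_cardOn_add hf hf1) (monotone_cardOn_add hg hg1)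
    (dadd hF hf) (depOn_mono hLK (dadd hG hg))
  have n2 := negAssoc_pw_of_monotone hQ (monotone_cardOn_sub hf hf1) (monotone_cardOn_sub hg hg1)
    (dsub hF hf) (depOn_mono hLK (dsub hG hg))
  have n3 := negAssoc_pw_of_monotone hQ (monotone_cardOn_add hf hf1) (monotone_cardOn_sub hg hg1)
    (dadd hF hf) (depOn_mono hLK (dsub hG hg))
  have n4 := negAssoc_pw_of_monotone hQ (monotone_cardOn_sub hf hf1) (monotone_cardOn_add hg hg1)
    (dsub hF hf) (depOn_mono hLK (dadd hG hg))
  simp only [add_mul, mul_add, sub_mul, mul_sub, wsum_add, wsum_sub] at n1 n2 n3 n4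
  have hFG : wsum (pw Q) (F * G) - wsum (pw Q) F * wsum (pw Q) G =
      -∑ e ∈ K, ∑ x ∈ L, ‖Q e x‖ ^ 2 := by
    rw [wsum_cardOn_mul, wsum_cardOn, wsum_cardOn, Finset.sum_mul_sum, ← Finset.sum_sub_distrib,
      ← Finset.sum_neg_distrib]
    refine Finset.sum_congr rfl fun e he => ?_
    rw [← Finset.sum_sub_distrib, ← Finset.sum_neg_distrib]
    refine Finset.sum_congr rfl fun x hx => ?_
    have hex : e ≠ x := fun h => Finset.disjoint_left.1 hKL he (h ▸ hx)
    rw [mass_pw_pair hQ.posSemidef hex, mass_pw_singleton, mass_pw_singleton]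
    ring
  -- Adding `n1` and `n2`, and likewise `n3` and `n4`, cancels the mixed terms and leaves cov(F, G)
  -- ± cov(f, g) ≤ 0; `hFG` evaluates cov(F, G).
  rw [abs_le]
  constructor <;> linarith

end Covariance

/-! ### Triviality of the tail σ-field. -/

section Tail

open scoped Classical

variable {𝕜 : Type*} [RCLike 𝕜] {E : Type*}

lemma IsDeterminantal.real_eq_wsum {Q : L2 𝕜 E →L[𝕜] L2 𝕜 E} {P : Measure (Set E)}
    (hP : IsDeterminantal Q P) {C : Finset E} {𝒰 : Set (Set E)} (h𝒰 : IsCylinder (C : Set E) 𝒰) :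
    P.real 𝒰 = wsum (pw (kernelMat Q C)) fun T => if onTrace C 𝒰 T then 1 else 0 := by
  have := hP.isProbabilityMeasure
  rw [← hP.integral_tr_eq]
  refine (integral_indicator_one h𝒰.measurableSet).symm.trans ?_
  refine integral_congr_ae (Filter.Eventually.of_forall fun S => ?_)
  by_cases hS : S ∈ 𝒰 <;> simp [hS, onTrace_tr h𝒰]

theorem IsDeterminantal.abs_cov_le {Q : L2 𝕜 E →L[𝕜] L2 𝕜 E} (hQ : IsPositiveContraction Q)
    {P : Measure (Set E)} (hP : IsDeterminantal Q P) {D₁ D₂ : Finset E} (hD : Disjoint D₁ D₂)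
    {𝒳 𝒴 : Set (Set E)} (h𝒳 : IsCylinder (D₁ : Set E) 𝒳) (h𝒴 : IsCylinder (D₂ : Set E) 𝒴) :
    |P.real (𝒳 ∩ 𝒴) - P.real 𝒳 * P.real 𝒴| ≤ ∑ e ∈ D₁, ∑ x ∈ D₂, ‖entry Q e x‖ ^ 2 := by
  set C := D₁ ∪ D₂ with hC
  have h1 : D₁ ⊆ C := Finset.subset_union_left
  have h2 : D₂ ⊆ C := Finset.subset_union_right
  have c1 := h𝒳.mono (Finset.coe_subset.2 h1)
  have c2 := h𝒴.mono (Finset.coe_subset.2 h2)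
  have c12 : IsCylinder (C : Set E) (𝒳 ∩ 𝒴) := fun S => and_congr (c1 S) (c2 S)
  rw [hP.real_eq_wsum c1, hP.real_eq_wsum c2, hP.real_eq_wsum c12]
  have hdis : Disjoint (tr C (D₁ : Set E)) (tr C (D₂ : Set E)) := by
    rw [Finset.disjoint_left]
    intro c hc hc'
    rw [mem_tr] at hc hc'
    exact Finset.disjoint_left.1 hD hc hc'
  have hite : ∀ (X : Finset C → Prop) (S T : Finset C),
      (if X S then (1 : ℝ) else 0) ≤ (if X T then 1 else 0) + 1 := by
    intro X S T
    split_ifs <;> norm_num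
  have h := Determinantal.abs_cov_le (hQ.isContr C) hdis
    (depOn_onTrace subset_rfl h𝒳).ite (depOn_onTrace subset_rfl h𝒴).ite
    (hite (onTrace C 𝒳)) (hite (onTrace C 𝒴))
  have e1 : (fun T => if onTrace C (𝒳 ∩ 𝒴) T then (1 : ℝ) else 0) =
      (fun T => if onTrace C 𝒳 T then (1 : ℝ) else 0) *
        fun T => if onTrace C 𝒴 T then (1 : ℝ) else 0 := by
    funext T
    by_cases ha : onTrace C 𝒳 T <;> by_cases hb : onTrace C 𝒴 T <;> simp_all [onTrace]
  have e2 : ∑ e ∈ D₁, ∑ x ∈ D₂, ‖entry Q e x‖ ^ 2 =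
      ∑ e ∈ tr C (D₁ : Set E), ∑ x ∈ tr C (D₂ : Set E), ‖kernelMat Q C e x‖ ^ 2 := by
    rw [← sum_tr h1]
    refine Finset.sum_congr rfl fun e _ => ?_
    rw [← sum_tr h2]
    rfl
  rw [e1, e2]
  exact h

/-- Events of `ℱ(K)` are approximated by cylinder events on finite subsets of `K`. -/
lemma exists_cylinder_approx (P : Measure (Set E)) [IsFiniteMeasure P] {K : Set E}
    {𝒜 : Set (Set E)} (h : MeasurableSet[sigmaField K] 𝒜) {ε : ℝ} (hε : 0 < ε) :
    ∃ (D : Finset E) (𝒴 : Set (Set E)), (D : Set E) ⊆ K ∧ IsCylinder (D : Set E) 𝒴 ∧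
      P.real (symmDiff 𝒜 𝒴) ≤ ε := by
  set 𝒢 : Set (Set (Set E)) :=
    {𝒴 | ∃ D : Finset E, (D : Set E) ⊆ K ∧ IsCylinder (D : Set E) 𝒴} with h𝒢
  have halg : IsSetAlgebra 𝒢 := by
    constructor
    · exact ⟨∅, by simp, fun S => by simp⟩
    · rintro s ⟨D, hD, hs⟩
      exact ⟨D, hD, fun S => not_congr (hs S)⟩
    · rintro s t ⟨D, hD, hs⟩ ⟨D', hD', ht⟩
      refine ⟨D ∪ D', by simp [hD, hD'], fun S => ?_⟩
      have hs' := hs.mono (C := ((D ∪ D' : Finset E) : Set E)) (by simp)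
      have ht' := ht.mono (C := ((D ∪ D' : Finset E) : Set E)) (by simp)
      exact or_congr (hs' S) (ht' S)
  have hgen : sigmaField K = MeasurableSpace.generateFrom 𝒢 := by
    apply le_antisymm
    · refine MeasurableSpace.generateFrom_le ?_
      rintro _ ⟨e, he, rfl⟩
      exact MeasurableSpace.measurableSet_generateFrom
        ⟨{e}, by simpa using he, fun S => by simp⟩
    · refine MeasurableSpace.generateFrom_le ?_
      rintro 𝒴 ⟨D, hD, h𝒴⟩
      rw [← setOf_onTrace h𝒴]
      have hmem : ∀ e ∈ D, MeasurableSet[sigmaField K] {S : Set E | e ∈ S} := fun e he =>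
        MeasurableSpace.measurableSet_generateFrom ⟨e, hD he, rfl⟩
      exact measurableSet_preimage_tr_of hmem {T | onTrace D 𝒴 T}
  have hfin : IsFiniteMeasure (P.trim (sigmaField_le K)) := isFiniteMeasure_trim _
  have hdense := @Measure.MeasureDense.of_generateFrom_isSetAlgebra_finite _ (sigmaField K)
    (P.trim (sigmaField_le K)) 𝒢 hfin halg hgen
  obtain ⟨𝒴, ⟨D, hD, h𝒴⟩, hlt⟩ := @Measure.MeasureDense.approx _ (sigmaField K) _ _ hdense 𝒜 h
    (@measure_ne_top _ (sigmaField K) _ hfin 𝒜) ε hε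
  have hm𝒴 : MeasurableSet[sigmaField K] 𝒴 := @Measure.MeasureDense.measurable _ (sigmaField K) _ _ hdense 𝒴
    ⟨D, hD, h𝒴⟩
  refine ⟨D, 𝒴, hD, h𝒴, ?_⟩
  rw [trim_measurableSet_eq (sigmaField_le K) (MeasurableSet.symmDiff h hm𝒴)] at hlt
  exact ENNReal.toReal_le_of_le_ofReal hε.le hlt.le

/-- By self-adjointness the row of `e` has the same moduli as the coordinates of Qe, which lies in
ℓ². This makes distant coordinates asymptotically uncorrelated with any finite set. -/
lemma summable_norm_entry_sq {Q : L2 𝕜 E →L[𝕜] L2 𝕜 E} (hQ : IsSelfAdjoint Q) (e : E) :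
    Summable fun x => ‖entry Q e x‖ ^ 2 := by
  have h := (lp.memℓp (Q (basisVec e))).summable (by norm_num)
  have heq : ∀ x, ‖entry Q e x‖ = ‖Q (basisVec e) x‖ := fun x => by
    rw [← entry_eq, entry, entry, ← inner_conj_symm, RCLike.norm_conj]
    exact congrArg _ (hQ.isSymmetric _ _)
  simp only [heq]
  simpa using h

lemma abs_real_inter_sub_le (P : Measure (Set E)) [IsFiniteMeasure P] {𝒳 𝒜 𝒴 : Set (Set E)}
    (h𝒳 : MeasurableSet 𝒳) (h𝒜 : MeasurableSet 𝒜) (h𝒴 : MeasurableSet 𝒴) :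
    |P.real (𝒳 ∩ 𝒜) - P.real (𝒳 ∩ 𝒴)| ≤ P.real (symmDiff 𝒜 𝒴) := by
  refine (abs_measureReal_sub_le_measureReal_symmDiff (h𝒳.inter h𝒜).nullMeasurableSet
    (h𝒳.inter h𝒴).nullMeasurableSet).trans (measureReal_mono ?_)
  rw [← Set.inter_symmDiff_distrib_left]
  exact Set.inter_subset_right

theorem IsDeterminantal.hasTrivialTail {Q : L2 𝕜 E →L[𝕜] L2 𝕜 E} (hQ : IsPositiveContraction Q)
    {P : Measure (Set E)} (hP : IsDeterminantal Q P) : HasTrivialTail P := by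
  intro 𝒜 hA
  have := hP.isProbabilityMeasure
  have hAK : ∀ D : Finset E, MeasurableSet[sigmaField (D : Set E)ᶜ] 𝒜 := fun D =>
    (iInf_le (fun K : Finset E => sigmaField (K : Set E)ᶜ) D) 𝒜 hA
  have hAm : MeasurableSet 𝒜 := sigmaField_le _ _ (hAK ∅)
  have hind : ∀ (D : Finset E) (𝒳 : Set (Set E)), IsCylinder (D : Set E) 𝒳 →
      P.real (𝒳 ∩ 𝒜) = P.real 𝒳 * P.real 𝒜 := by
    intro D 𝒳 h𝒳
    have hle : ∀ ε : ℝ, 0 < ε → |P.real (𝒳 ∩ 𝒜) - P.real 𝒳 * P.real 𝒜| ≤ 3 * ε := by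
      intro ε hε
      have hsum : Summable fun x => ∑ e ∈ D, ‖entry Q e x‖ ^ 2 :=
        summable_sum fun e _ => summable_norm_entry_sq hQ.isSelfAdjoint e
      -- Off `D₀` the kernel entries linking to `D` have total square below ε. A tail event can be
      -- approximated by cylinders avoiding both `D` and `D₀`, whose covariance with 𝒳 is then at
      -- most ε.
      obtain ⟨D₀, hD₀⟩ := summable_iff_vanishing_norm.1 hsum ε hε
      obtain ⟨D₂, 𝒴, hD₂, h𝒴, hlt⟩ := exists_cylinder_approx P (hAK (D ∪ D₀)) hε
      have hd : ∀ x ∈ D₂, x ∉ D ∪ D₀ := fun x hx => by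
        have := hD₂ hx
        simpa using this
      have hdis : Disjoint D D₂ := Finset.disjoint_left.2 fun x hx hx' =>
        hd x hx' (Finset.mem_union_left _ hx)
      have hdis' : Disjoint D₂ D₀ := Finset.disjoint_left.2 fun x hx hx' =>
        hd x hx (Finset.mem_union_right _ hx')
      have hcov := hP.abs_cov_le hQ hdis h𝒳 h𝒴
      rw [Finset.sum_comm] at hcov
      have hsmall := (le_abs_self _).trans (hD₀ D₂ hdis').le
      have h1 := abs_real_inter_sub_le P h𝒳.measurableSet hAm h𝒴.measurableSet
      have h2 := abs_real_inter_sub_le P MeasurableSet.univ hAm h𝒴.measurableSet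
      rw [Set.univ_inter, Set.univ_inter] at h2
      have h3 : |P.real 𝒳 * P.real 𝒴 - P.real 𝒳 * P.real 𝒜| ≤ ε := by
        rw [← mul_sub, abs_mul, abs_of_nonneg measureReal_nonneg, abs_sub_comm]
        calc P.real 𝒳 * |P.real 𝒜 - P.real 𝒴| ≤ 1 * ε :=
              mul_le_mul measureReal_le_one (h2.trans hlt) (abs_nonneg _) zero_le_one
          _ = ε := one_mul ε
      calc |P.real (𝒳 ∩ 𝒜) - P.real 𝒳 * P.real 𝒜|
          = |(P.real (𝒳 ∩ 𝒜) - P.real (𝒳 ∩ 𝒴)) + (P.real (𝒳 ∩ 𝒴) - P.real 𝒳 * P.real 𝒴) +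
              (P.real 𝒳 * P.real 𝒴 - P.real 𝒳 * P.real 𝒜)| := by ring_nf
        _ ≤ |P.real (𝒳 ∩ 𝒜) - P.real (𝒳 ∩ 𝒴)| + |P.real (𝒳 ∩ 𝒴) - P.real 𝒳 * P.real 𝒴| +
              |P.real 𝒳 * P.real 𝒴 - P.real 𝒳 * P.real 𝒜| := abs_add_three _ _ _
        _ ≤ 3 * ε := by linarith [h1.trans hlt, hcov.trans hsmall]
    have h0 : |P.real (𝒳 ∩ 𝒜) - P.real 𝒳 * P.real 𝒜| ≤ 0 := by
      refine le_of_forall_pos_le_add fun ε hε => ?_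
      have := hle (ε / 3) (by positivity)
      linarith
    exact sub_eq_zero.1 (abs_nonpos_iff.1 h0)
  have hsq : |P.real 𝒜 - P.real 𝒜 * P.real 𝒜| ≤ 0 := by
    refine le_of_forall_pos_le_add fun ε hε => ?_
    -- The tail event is itself close to a cylinder event, of which it is independent; hence it is
    -- independent of itself.
    obtain ⟨D, 𝒳, -, h𝒳, hlt⟩ := exists_cylinder_approx P (hAK ∅) (half_pos hε)
    have hX := hind D 𝒳 h𝒳
    have h1 := abs_real_inter_sub_le P hAm hAm h𝒳.measurableSet
    have h2 := abs_real_inter_sub_le P MeasurableSet.univ hAm h𝒳.measurableSet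
    rw [Set.univ_inter, Set.univ_inter] at h2
    rw [Set.inter_self, Set.inter_comm, hX] at h1
    have h3 : |P.real 𝒳 * P.real 𝒜 - P.real 𝒜 * P.real 𝒜| ≤ ε / 2 := by
      rw [← sub_mul, abs_mul, abs_of_nonneg (measureReal_nonneg (s := 𝒜)), abs_sub_comm]
      calc |P.real 𝒜 - P.real 𝒳| * P.real 𝒜 ≤ ε / 2 * 1 :=
            mul_le_mul (h2.trans hlt) measureReal_le_one measureReal_nonneg (half_pos hε).le
        _ = ε / 2 := mul_one _
    calc |P.real 𝒜 - P.real 𝒜 * P.real 𝒜|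
        = |(P.real 𝒜 - P.real 𝒳 * P.real 𝒜) +
            (P.real 𝒳 * P.real 𝒜 - P.real 𝒜 * P.real 𝒜)| := by ring_nf
      _ ≤ |P.real 𝒜 - P.real 𝒳 * P.real 𝒜| +
            |P.real 𝒳 * P.real 𝒜 - P.real 𝒜 * P.real 𝒜| := abs_add_le _ _
      _ ≤ 0 + ε := by linarith [h1.trans hlt]
  have h0 := sub_eq_zero.1 (abs_nonpos_iff.1 hsq)
  have h01 : P.real 𝒜 * (1 - P.real 𝒜) = 0 := by linarith
  rcases mul_eq_zero.1 h01 with h | h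
  · left
    exact (measureReal_eq_zero_iff).1 h
  · right
    rw [← ofReal_measureReal, ← sub_eq_zero.1 h, ENNReal.ofReal_one]

end Tail

/-! ### Concentration of the number of points in a finite set. -/

section Concentration

open scoped Classical

variable {𝕜 : Type*} [RCLike 𝕜] {E : Type*}

lemma wsum_pw_prod_exp_le {ι : Type*} [Fintype ι] [DecidableEq ι] {Q : Matrix ι ι 𝕜}
    (hQ : IsContr Q) (t : ℝ) (B : Finset ι) :
    wsum (pw Q) (fun T => ∏ c ∈ B, Real.exp (t * if c ∈ T then 1 else 0)) ≤
      ∏ c ∈ B, wsum (pw Q) fun T => Real.exp (t * if c ∈ T then 1 else 0) := by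
  have hpos : ∀ f : Finset ι → ℝ, (∀ T, 0 ≤ f T) → 0 ≤ wsum (pw Q) f := fun f hf =>
    Finset.sum_nonneg fun T _ => mul_nonneg (pw_nonneg hQ T) (hf T)
  induction B using Finset.induction_on with
  | empty =>
    have := wsum_pw_one Q
    simp only [Finset.prod_empty]
    exact this.le
  | insert a B ha ih =>
    set f : Finset ι → ℝ := fun T => Real.exp (t * if a ∈ T then 1 else 0)
    set g : Finset ι → ℝ := fun T => ∏ c ∈ B, Real.exp (t * if c ∈ T then 1 else 0)
    have heq : (fun T => ∏ c ∈ insert a B, Real.exp (t * if c ∈ T then 1 else 0)) = f * g := by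
      funext T
      rw [Finset.prod_insert ha]
      rfl
    rw [heq, Finset.prod_insert ha]
    have hfd : DepOn {a} f := fun S T hST => by
      have := Finset.ext_iff.1 hST a
      simp only [Finset.mem_inter, Finset.mem_singleton, and_true] at this
      simp only [f, this]
    have hgd : DepOn {a}ᶜ g := fun S T hST => by
      refine Finset.prod_congr rfl fun c hc => ?_
      have hca : c ≠ a := fun h => ha (h ▸ hc)
      have := Finset.ext_iff.1 hST c
      simp only [Finset.mem_inter, Finset.mem_compl, Finset.mem_singleton, hca, not_false_eq_true,
        and_true] at this
      simp only [this]
    have hind : ∀ (c : ι) {S T : Finset ι}, S ⊆ T →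
        (if c ∈ S then (1 : ℝ) else 0) ≤ if c ∈ T then 1 else 0 := by
      intro c S T hST
      split_ifs with h1 h2
      · exact le_rfl
      · exact absurd (hST h1) h2
      · exact zero_le_one
      · exact le_rfl
    have hna : wsum (pw Q) (f * g) ≤ wsum (pw Q) f * wsum (pw Q) g := by
      -- The factors are all increasing for t ≥ 0 and all decreasing for t ≤ 0; negative association
      -- serves both cases, which yields both tails.
      rcases le_total 0 t with ht | ht
      · refine negAssoc_pw_of_monotone hQ (fun S T hST => ?_) (fun S T hST => ?_) hfd hgd
        · exact Real.exp_le_exp.2 (mul_le_mul_of_nonneg_left (hind a hST) ht)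
        · exact Finset.prod_le_prod (fun c _ => (Real.exp_pos _).le) fun c _ =>
            Real.exp_le_exp.2 (mul_le_mul_of_nonneg_left (hind c hST) ht)
      · refine negAssoc_pw_of_antitone hQ (fun S T hST => ?_) (fun S T hST => ?_) hfd hgd
        · exact Real.exp_le_exp.2 (mul_le_mul_of_nonpos_left (hind a hST) ht)
        · exact Finset.prod_le_prod (fun c _ => (Real.exp_pos _).le) fun c _ =>
            Real.exp_le_exp.2 (mul_le_mul_of_nonpos_left (hind c hST) ht)
    exact hna.trans (mul_le_mul_of_nonneg_left ih (hpos f fun T => (Real.exp_pos _).le))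

lemma count_eq_sum (A : Finset E) (S : Set E) :
    count A S = ∑ c : A, if c ∈ tr A S then (1 : ℝ) else 0 := by
  have h : S ∩ (A : Set E) = ((tr A S).map (Function.Embedding.subtype _) : Finset E) := by
    ext e
    simp only [Set.mem_inter_iff, Finset.mem_coe, Finset.mem_map, mem_tr,
      Function.Embedding.coe_subtype, Subtype.exists, exists_and_left, exists_prop,
      exists_eq_right_right]
  rw [count, h, Set.ncard_coe_finset, Finset.card_map, Finset.sum_ite_mem, Finset.univ_inter]
  simp

theorem IsDeterminantal.hasSubgaussianMGF_count {Q : L2 𝕜 E →L[𝕜] L2 𝕜 E}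
    (hQ : IsPositiveContraction Q) {P : Measure (Set E)} (hP : IsDeterminantal Q P)
    (A : Finset E) :
    ProbabilityTheory.HasSubgaussianMGF (fun S => count A S - ∫ T, count A T ∂P)
      (A.card / 4) P := by
  have := hP.isProbabilityMeasure
  set X : A → Set E → ℝ := fun c S => if c ∈ tr A S then 1 else 0 with hX
  have hcount : ∀ S, count A S = ∑ c, X c S := count_eq_sum A
  have hXint : ∀ c, Integrable (X c) P := fun c =>
    integrable_tr P A fun T => if c ∈ T then 1 else 0
  have hmean : ∫ T, count A T ∂P = ∑ c, ∫ T, X c T ∂P := by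
    simp only [hcount]
    exact integral_finsetSum _ fun c _ => hXint c
  -- Hoeffding's lemma on [0, 1] gives the variance proxy 1/4 for each indicator, hence |A|/4 for
  -- the sum.
  have hsub : ∀ c, ProbabilityTheory.HasSubgaussianMGF (fun S => X c S - ∫ T, X c T ∂P)
      ((‖(1 : ℝ) - 0‖₊ / 2) ^ 2) P := fun c =>
    ProbabilityTheory.hasSubgaussianMGF_of_mem_Icc (hXint c).aemeasurable
      (Filter.Eventually.of_forall fun S => by
        simp only [hX]
        split_ifs <;> simp)
  constructor
  · intro t
    refine (integrable_tr P A fun T => Real.exp (t * ((∑ c, if c ∈ T then (1 : ℝ) else 0) -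
      ∫ T, count A T ∂P))).congr (Filter.Eventually.of_forall fun S => ?_)
    simp only [hcount, hX]
  · intro t
    have h1 : ∫ S, ∏ c, Real.exp (t * X c S) ∂P ≤ ∏ c, ∫ S, Real.exp (t * X c S) ∂P := by
      have := wsum_pw_prod_exp_le (hQ.isContr A) t Finset.univ
      rw [← hP.integral_tr_eq] at this
      simp only [← hP.integral_tr_eq] at this
      exact this
    have h2 : ∀ c, Real.exp (-t * ∫ T, X c T ∂P) * ∫ S, Real.exp (t * X c S) ∂P ≤
        Real.exp (t ^ 2 / 8) := by
      intro c
      have h := (hsub c).mgf_le t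
      rw [ProbabilityTheory.mgf] at h
      rw [← integral_const_mul]
      refine le_trans (le_of_eq ?_) (h.trans (le_of_eq ?_))
      · refine integral_congr_ae (Filter.Eventually.of_forall fun S => ?_)
        simp only
        rw [← Real.exp_add]
        ring_nf
      · congr 1
        norm_num
        ring
    have h3 : ProbabilityTheory.mgf (fun S => count A S - ∫ T, count A T ∂P) P t =
        (∏ c, Real.exp (-t * ∫ T, X c T ∂P)) * ∫ S, ∏ c, Real.exp (t * X c S) ∂P := by
      rw [ProbabilityTheory.mgf, ← integral_const_mul]
      refine integral_congr_ae (Filter.Eventually.of_forall fun S => ?_)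
      simp only
      rw [← Real.exp_sum, ← Real.exp_sum, ← Real.exp_add, hcount, hmean, ← Finset.mul_sum,
        ← Finset.mul_sum]
      ring_nf
    rw [h3]
    calc (∏ c, Real.exp (-t * ∫ T, X c T ∂P)) * ∫ S, ∏ c, Real.exp (t * X c S) ∂P
        ≤ (∏ c, Real.exp (-t * ∫ T, X c T ∂P)) * ∏ c, ∫ S, Real.exp (t * X c S) ∂P :=
          mul_le_mul_of_nonneg_left h1 (Finset.prod_nonneg fun c _ => (Real.exp_pos _).le)
      _ = ∏ c, (Real.exp (-t * ∫ T, X c T ∂P) * ∫ S, Real.exp (t * X c S) ∂P) :=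
          Finset.prod_mul_distrib.symm
      _ ≤ ∏ _c : A, Real.exp (t ^ 2 / 8) :=
          Finset.prod_le_prod (fun c _ => mul_nonneg (Real.exp_pos _).le
            (integral_nonneg fun S => (Real.exp_pos _).le)) fun c _ => h2 c
      _ = Real.exp (((A.card / 4 : ℝ≥0) : ℝ) * t ^ 2 / 2) := by
          rw [Finset.prod_const, ← Real.exp_nat_mul, Finset.card_univ, Fintype.card_coe]
          congr 1
          push_cast
          ring

theorem IsDeterminantal.concentration {Q : L2 𝕜 E →L[𝕜] L2 𝕜 E} (hQ : IsPositiveContraction Q)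
    {P : Measure (Set E)} (hP : IsDeterminantal Q P) (A : Finset E) {a : ℝ} (ha : 0 < a) :
    P.real {S : Set E | a ≤ |count A S - ∫ T, count A T ∂P|} ≤
      2 * Real.exp (-2 * a ^ 2 / (A.card : ℝ)) := by
  have := hP.isProbabilityMeasure
  have h := hP.hasSubgaussianMGF_count hQ A
  have h1 := h.measure_ge_le ha.le
  have h2 := h.neg.measure_ge_le ha.le
  have hexp : -a ^ 2 / (2 * ((A.card / 4 : ℝ≥0) : ℝ)) = -2 * a ^ 2 / (A.card : ℝ) := by
    push_cast
    rcases eq_or_ne (A.card : ℝ) 0 with h0 | h0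
    -- For empty `A` both quotients are 0 by convention, and the bound becomes the trivial 2.
    · simp [h0]
    · field_simp
      ring
  rw [hexp] at h1 h2
  have hsub : {S : Set E | a ≤ |count A S - ∫ T, count A T ∂P|} ⊆
      {S | a ≤ count A S - ∫ T, count A T ∂P} ∪
        {S | a ≤ (-fun S => count A S - ∫ T, count A T ∂P) S} := by
    intro S hS
    have hS' : a ≤ |count A S - ∫ T, count A T ∂P| := hS
    exact le_abs.1 hS'
  calc P.real {S : Set E | a ≤ |count A S - ∫ T, count A T ∂P|}
      ≤ P.real ({S | a ≤ count A S - ∫ T, count A T ∂P} ∪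
        {S | a ≤ (-fun S => count A S - ∫ T, count A T ∂P) S}) := measureReal_mono hsub
    _ ≤ _ := measureReal_union_le _ _
    _ ≤ 2 * Real.exp (-2 * a ^ 2 / (A.card : ℝ)) := by linarith

end Concentration

/-! ### The exterior algebra formula for the events "A in, B out". -/

section ExteriorFormula

open Classical

variable {𝕜 : Type*} [RCLike 𝕜] {E : Type*}

lemma wedge_mul_wedge (A B : Finset E) (f g : E → L2 𝕜 E) :
    wedge A f * wedge B g = ExteriorAlgebra.ιMulti 𝕜 (A.card + B.card)
      (Fin.append (fun i => f (enum A i)) fun i => g (enum B i)) := by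
  rw [wedge, wedge, ExteriorAlgebra.ιMulti_apply, ExteriorAlgebra.ιMulti_apply,
    ExteriorAlgebra.ιMulti_apply, ← List.prod_append, ← List.ofFn_fin_append]
  congr 2
  funext i
  refine Fin.addCases (fun i => ?_) (fun i => ?_) i <;> simp

lemma coeff_ιMulti_of_ne {k : ℕ} {C : Finset E} (hk : k ≠ C.card) (u : Fin k → L2 𝕜 E) :
    coeff C (ExteriorAlgebra.ιMulti 𝕜 k u) = 0 := by
  rw [coeff, ExteriorAlgebra.liftAlternating_apply_ιMulti, Pi.single_eq_of_ne hk]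
  rfl

lemma coeff_ιMulti (C : Finset E) (u : Fin C.card → L2 𝕜 E) :
    coeff C (ExteriorAlgebra.ιMulti 𝕜 C.card u) =
      Matrix.det (Matrix.of fun i j => u i (enum C j)) := by
  rw [coeff, ExteriorAlgebra.liftAlternating_apply_ιMulti, Pi.single_eq_same]
  rfl

/-- The Cauchy–Binet term belonging to `C`. -/
lemma coeff_mul_conj_coeff {k : ℕ} {C : Finset E} (hk : k = C.card) (u v : Fin k → L2 𝕜 E) :
    coeff C (ExteriorAlgebra.ιMulti 𝕜 k u) *
        starRingEnd 𝕜 (coeff C (ExteriorAlgebra.ιMulti 𝕜 k v)) =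
      Matrix.det (Matrix.of fun i j => ∑ c ∈ C, u i c * starRingEnd 𝕜 (v j c)) := by
  subst hk
  rw [coeff_ιMulti, coeff_ιMulti, ← RCLike.star_def, ← Matrix.det_conjTranspose, ← Matrix.det_mul]
  congr 1
  ext i j
  simp only [Matrix.mul_apply, Matrix.of_apply, Matrix.conjTranspose_apply, RCLike.star_def, enum]
  rw [← Finset.sum_coe_sort C, ← C.equivFin.symm.sum_comp]

lemma sum_mul_conj_basisVec (C : Finset E) (u : L2 𝕜 E) (d : E) :
    ∑ c ∈ C, u c * starRingEnd 𝕜 ((basisVec d : L2 𝕜 E) c) = if d ∈ C then u d else 0 := by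
  simp [basisVec_apply, Finset.sum_ite_eq']

/-- The inner product of a decomposable multivector with a product of distinct basis vectors. -/
lemma extInner_ιMulti_basisVec {k : ℕ} (u : Fin k → L2 𝕜 E) {d : Fin k → E}
    (hd : Function.Injective d) :
    extInner (ExteriorAlgebra.ιMulti 𝕜 k u)
      (ExteriorAlgebra.ιMulti 𝕜 k fun i => basisVec (d i)) =
      Matrix.det (Matrix.of fun i j => u i (d j)) := by
  have hcard : k = (Finset.univ.image d).card := by
    rw [Finset.card_image_of_injective _ hd, Finset.card_univ, Fintype.card_fin]
  -- Only the range of `d` contributes: any other set of the same size misses some `d j`, which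
  -- gives a zero column in its Cauchy–Binet term, and other sizes have the wrong rank.
  rw [extInner, tsum_eq_single (Finset.univ.image d), coeff_mul_conj_coeff hcard]
  · simp only [sum_mul_conj_basisVec, Finset.mem_image, Finset.mem_univ, true_and,
      exists_apply_eq_apply, if_true]
  · intro C hC
    by_cases hk : k = C.card
    · obtain ⟨j, hj⟩ : ∃ j, d j ∉ C := by
        by_contra! h
        refine hC (Finset.eq_of_subset_of_card_le ?_ (hk.symm.trans hcard).le).symm
        intro x hx
        obtain ⟨j, -, rfl⟩ := Finset.mem_image.1 hx
        exact h j
      rw [coeff_mul_conj_coeff hk]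
      refine Matrix.det_eq_zero_of_column_eq_zero j fun i => ?_
      rw [Matrix.of_apply, sum_mul_conj_basisVec, if_neg hj]
    · rw [coeff_ιMulti_of_ne hk, zero_mul]

lemma enum_mem (A : Finset E) (i : Fin A.card) : enum A i ∈ A := (A.equivFin.symm i).2

lemma enum_injective (A : Finset E) : Function.Injective (enum A) :=
  Subtype.val_injective.comp A.equivFin.symm.injective

lemma exists_enum_eq {A : Finset E} {e : E} (he : e ∈ A) : ∃ i, enum A i = e :=
  ⟨A.equivFin ⟨e, he⟩, by simp [enum]⟩

lemma theta_mul_theta (A B : Finset E) :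
    theta 𝕜 A * theta 𝕜 B = ExteriorAlgebra.ιMulti 𝕜 (A.card + B.card)
      fun i => basisVec (Fin.append (enum A) (enum B) i) := by
  rw [theta, theta, wedge_mul_wedge]
  congr 1
  funext i
  refine Fin.addCases (fun i => ?_) (fun i => ?_) i <;> simp

lemma theta_mul_theta_eq_zero {A B : Finset E} (h : ¬ Disjoint A B) :
    theta 𝕜 A * theta 𝕜 B = 0 := by
  obtain ⟨e, hA, hB⟩ := Finset.not_disjoint_iff.1 h
  obtain ⟨i, hi⟩ := exists_enum_eq hA
  obtain ⟨j, hj⟩ := exists_enum_eq hB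
  rw [theta_mul_theta]
  refine AlternatingMap.map_eq_zero_of_eq _ _ (i := Fin.castAdd _ i) (j := Fin.natAdd _ j) ?_ ?_
  · simp [hi, hj]
  · intro hij
    have := congrArg Fin.val hij
    simp only [Fin.val_castAdd, Fin.val_natAdd] at this
    omega

lemma ofReal_mass_pw {ι : Type*} [Fintype ι] [DecidableEq ι] {Q : Matrix ι ι 𝕜} (hQ : IsContr Q)
    (A B : Finset ι) : ((mass (pw Q) A B : ℝ) : 𝕜) = Matrix.det
      (Matrix.of fun i => (if i ∈ B then 0 else Q i) + if i ∈ A then 0 else (1 - Q) i) := by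
  rw [← sum_rowDet, mass, RCLike.ofReal_sum]
  exact Finset.sum_congr rfl fun S _ => (eq_ofReal_re (rowDet_nonneg hQ S)).symm

lemma IsDeterminantal.real_inOut {Q : L2 𝕜 E →L[𝕜] L2 𝕜 E} {P : Measure (Set E)}
    (hP : IsDeterminantal Q P) {A B C : Finset E} (hA : A ⊆ C)
    (hB : B ⊆ C) :
    P.real {S : Set E | (A : Set E) ⊆ S ∧ (B : Set E) ∩ S = ∅} =
      mass (pw (kernelMat Q C)) (tr C A) (tr C B) := by
  have := hP.isProbabilityMeasure
  have hset : {S : Set E | (A : Set E) ⊆ S ∧ (B : Set E) ∩ S = ∅} =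
      {S | tr C A ⊆ tr C S ∧ Disjoint (tr C B) (tr C S)} := by
    ext S
    refine and_congr ⟨fun h => tr_mono C h, fun h e he => ?_⟩ ⟨fun h => ?_, fun h => ?_⟩
    · exact mem_tr.1 (h ((mem_tr (c := ⟨e, hA he⟩)).2 he))
    · refine Finset.disjoint_left.2 fun c h1 h2 => ?_
      exact Set.eq_empty_iff_forall_notMem.1 h c ⟨mem_tr.1 h1, mem_tr.1 h2⟩
    · refine Set.eq_empty_iff_forall_notMem.2 fun e ⟨h1, h2⟩ => ?_
      exact Finset.disjoint_left.1 h ((mem_tr (c := ⟨e, hB h1⟩)).2 h1)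
        (mem_tr.2 h2)
  rw [hset, real_tr P C fun T => tr C A ⊆ T ∧ Disjoint (tr C B) T, ← hP.real_tr_eq, mass]

theorem IsDeterminantal.real_eq_extInner {Q : L2 𝕜 E →L[𝕜] L2 𝕜 E} {P : Measure (Set E)}
    (hQ : IsPositiveContraction Q) (hP : IsDeterminantal Q P) (A B : Finset E) :
    ((P.real {S : Set E | (A : Set E) ⊆ S ∧ (B : Set E) ∩ S = ∅} : ℝ) : 𝕜) =
      extInner (wedge A (fun e => Q (basisVec e)) * wedge B (fun e => (1 - Q) (basisVec e)))
        (theta 𝕜 A * theta 𝕜 B) := by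
  rw [hP.real_inOut Finset.subset_union_left Finset.subset_union_right]
  by_cases hAB : Disjoint A B
  · set C := A ∪ B with hC
    set d := Fin.append (enum A) (enum B) with hd
    have hdC : ∀ i, d i ∈ C := fun i => by
      refine Fin.addCases (fun i => ?_) (fun i => ?_) i
      · simp [hd, hC, enum_mem]
      · simp [hd, hC, enum_mem]
    have hdinj : Function.Injective d := by
      rw [hd, Fin.append_injective_iff]
      exact ⟨enum_injective A, enum_injective B, fun i j h =>
        Finset.disjoint_left.1 hAB (enum_mem A i) (h ▸ enum_mem B j)⟩
    rw [wedge_mul_wedge, theta_mul_theta, extInner_ιMulti_basisVec _ hdinj,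
      ofReal_mass_pw (hQ.isContr C)]
    let φ : Fin (A.card + B.card) ≃ C := Equiv.ofBijective (fun i => ⟨d i, hdC i⟩) (by
      rw [Fintype.bijective_iff_injective_and_card]
      refine ⟨fun i j h => hdinj (congrArg Subtype.val h), ?_⟩
      rw [Fintype.card_fin, Fintype.card_coe, hC, Finset.card_union_of_disjoint hAB])
    set N : Matrix C C 𝕜 := Matrix.of fun i =>
      (if i ∈ tr C B then 0 else kernelMat Q C i) +
        if i ∈ tr C A then 0 else (1 - kernelMat Q C) i with hN
    -- The wedge of the vectors Qe produces the entries of `N` conjugated. The determinant is a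
    -- probability, hence real, so conjugation does no harm.
    have hNreal : star N.det = N.det := by
      rw [hN, ← ofReal_mass_pw (hQ.isContr C), RCLike.star_def, RCLike.conj_ofReal]
    rw [← hNreal, ← Matrix.det_conjTranspose, ← Matrix.det_submatrix_equiv_self φ,
      ← Matrix.det_transpose]
    congr 1
    have hsymm : ∀ R : L2 𝕜 E →L[𝕜] L2 𝕜 E, IsSelfAdjoint R → ∀ i j : C,
        star (kernelMat R C i j) = R (basisVec (i : E)) j := fun R hR i j => by
      rw [← entry_eq]
      exact (isHermitian_kernelMat hR C).apply j i
    have hone : (1 - kernelMat Q C) = kernelMat (1 - Q) C := by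
      rw [kernelMat_sub, kernelMat_one]
    ext i j
    simp only [Matrix.transpose_apply, Matrix.submatrix_apply, Matrix.conjTranspose_apply,
      Matrix.of_apply, hN, hone]
    have hφ : ∀ i, ((φ i : C) : E) = d i := fun _ => rfl
    revert i
    refine Fin.addCases (fun i => ?_) (fun i => ?_)
    · have h1 : φ (Fin.castAdd _ i) ∈ tr C A := by
        rw [mem_tr, hφ]; simp [hd, enum_mem]
      have h2 : φ (Fin.castAdd _ i) ∉ tr C B := by
        rw [mem_tr, hφ]
        simpa [hd] using Finset.disjoint_left.1 hAB (enum_mem A i)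
      rw [if_pos h1, if_neg h2, add_zero, hsymm Q hQ.isSelfAdjoint, hφ, hφ]
      simp [hd]
    · have h1 : φ (Fin.natAdd _ i) ∈ tr C B := by
        rw [mem_tr, hφ]; simp [hd, enum_mem]
      have h2 : φ (Fin.natAdd _ i) ∉ tr C A := by
        rw [mem_tr, hφ]
        simpa [hd] using Finset.disjoint_right.1 hAB (enum_mem B i)
      rw [if_pos h1, if_neg h2, zero_add,
        hsymm (1 - Q) ((IsSelfAdjoint.one _).sub hQ.isSelfAdjoint), hφ, hφ]
      simp only [hd, Fin.append_right]
  · have h : ¬ Disjoint (tr (A ∪ B) A) (tr (A ∪ B) (B : Set E)) := by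
      obtain ⟨e, hA, hB⟩ := Finset.not_disjoint_iff.1 hAB
      exact Finset.not_disjoint_iff.2
        ⟨⟨e, Finset.mem_union_left _ hA⟩, mem_tr.2 hA, mem_tr.2 hB⟩
    rw [mass_eq_zero_of_not_disjoint _ h, theta_mul_theta_eq_zero hAB, extInner]
    simp

end ExteriorFormula

end Determinantal

end

theorem mainTheorem1 {𝕜 : Type*} [RCLike 𝕜] {E : Type*} [Countable E] :
    (∀ Q : Determinantal.L2 𝕜 E →L[𝕜] Determinantal.L2 𝕜 E,
      Determinantal.IsPositiveContraction Q →
      (∃! P : Measure (Set E), Determinantal.IsDeterminantal Q P) ∧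
      ∀ P : Measure (Set E), Determinantal.IsDeterminantal Q P →
        (∀ A B : Finset E,
          ((P.real {S : Set E | (A : Set E) ⊆ S ∧ (B : Set E) ∩ S = ∅} : ℝ) : 𝕜) =
            Determinantal.extInner
              (Determinantal.wedge A (fun e => Q (Determinantal.basisVec e)) *
                Determinantal.wedge B (fun e => (1 - Q) (Determinantal.basisVec e)))
              (Determinantal.theta 𝕜 A * Determinantal.theta 𝕜 B)) ∧
        Determinantal.HasCondNegAssocExternalFields P ∧
        Determinantal.HasTrivialTail P ∧
        (∀ (A : Finset E) (a : ℝ), 0 < a →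
          P.real {S : Set E |
              a ≤ |Determinantal.count A S - ∫ T, Determinantal.count A T ∂P|} ≤
            2 * Real.exp (-2 * a ^ 2 / (A.card : ℝ)))) ∧
    (∀ Q₁ Q₂ : Determinantal.L2 𝕜 E →L[𝕜] Determinantal.L2 𝕜 E,
      Determinantal.IsPositiveContraction Q₁ → Determinantal.IsPositiveContraction Q₂ →
      Commute Q₁ Q₂ →
      (∀ u, RCLike.re (inner 𝕜 (Q₁ u) u) ≤ RCLike.re (inner 𝕜 (Q₂ u) u)) →
      ∀ P₁ P₂ : Measure (Set E),
        Determinantal.IsDeterminantal Q₁ P₁ → Determinantal.IsDeterminantal Q₂ P₂ →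
        Determinantal.StochDominatedBy P₁ P₂) := by
  refine ⟨fun Q hQ => ⟨?_, fun P hP => ⟨hP.real_eq_extInner hQ, hP.hasCondNegAssocExternalFields hQ,
    hP.hasTrivialTail hQ, fun A _ ha => hP.concentration hQ A ha⟩⟩,
    fun _ _ h₁ h₂ _ hle _ _ hP₁ hP₂ => Determinantal.stochDominatedBy_of_le h₁ h₂ hle hP₁ hP₂⟩
  obtain ⟨P, hP⟩ := Determinantal.exists_isDeterminantal hQ
  exact ⟨P, hP, fun P' hP' => hP'.unique hP⟩
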